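/- Let $p\in[1,\infty)$, let $G$ be a countable discrete abelian group (with counting measure), let $\hat G$ be its compact dual group with normalized Haar measure $\mu$, let $A$ be a separable unital $L^p$ operator algebra (with $\|1\|=1$) that has unique $L^p$ operator matrix norms, and let $\alpha$ be an action of $G$ on $A$ by isometric automorphisms. (Unique $L^p$ operator matrix norms means: for any two isometric representations of $A$ on separable $L^p$ spaces of $\sigma$-finite measures, all the norms induced on the matrix algebras $M_n(A)$ acting on $L^p(\{1,\dots,n\}\times X)$ coincide.) For a locally compact group $H$ with left Haar measure and a strongly continuous isometric action $\theta$ of $H$ on a Banach algebra $B$, let $F^p(H,B,\theta)$ be the completion of $C_c(H,B)$, with product the twisted convolution $(f*g)(t)=\int_H f(s)\,\theta_s(g(s^{-1}t))\,ds$, in the norm $\|f\|=\sup\|(\pi\rtimes v)(f)\|$. The supremum is over all pairs $(\pi,v)$ of a nondegenerate contractive homomorphism $\pi:B\to\mathcal B(L^p(X,\nu))$, $\nu$ $\sigma$-finite, and a strongly continuous isometric representation $v$ of $H$ on $L^p(X,\nu)$ with $v_t\pi(b)v_{t^{-1}}=\pi(\theta_t(b))$, and $(\pi\rtimes v)(f)\xi=\int_H\pi(f(s))v_s\xi\,ds$.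 Consider the following actions, given by their values on functions and extended by continuity: the dual action $\hat\alpha$ of $\hat G$ on $F^p(G,A,\alpha)$, $\hat\alpha_\gamma(f)(s)=\overline{\gamma(s)}f(s)$; the double dual action $\hat{\hat\alpha}$ of $G$ on $F^p(\hat G,F^p(G,A,\alpha),\hat\alpha)$, $\hat{\hat\alpha}_t(F)(\gamma,s)=\overline{\gamma(t)}F(\gamma,s)$; with $\beta$ the trivial action of $\hat G$ on $A$, the action $\hat\beta\otimes\alpha$ of $G$ on $F^p(\hat G,A,\beta)$, $(\hat\beta\otimes\alpha)_s(\varphi)(\gamma)=\gamma(s)\alpha_s(\varphi(\gamma))$; the actions $\mathrm{lt}\otimes\alpha$ and $\mathrm{lt}\otimes\mathrm{id}$ of $G$ on $C_0(G,A)$, $(\mathrm{lt}\otimes\alpha)_t f(s)=\alpha_t(f(t^{-1}s))$ and $(\mathrm{lt}\otimes\mathrm{id})_t f(s)=f(t^{-1}s)$; and the action $(\mathrm{rt}\otimes\alpha)\otimes\mathrm{id}$ of $G$ on $F^p(G,C_0(G,A),\mathrm{lt}\otimes\mathrm{id})$, $(((\mathrm{rt}\otimes\alpha)\otimes\mathrm{id})_rF)(s,t)=\alpha_r(F(s,tr))$.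 Then there are unique continuous algebra homomorphisms $$F^p(\hat G,F^p(G,A,\alpha),\hat\alpha)\xrightarrow{\Phi_1}F^p(G,F^p(\hat G,A,\beta),\hat\beta\otimes\alpha)\xrightarrow{\Phi_2}F^p(G,C_0(G,A),\mathrm{lt}\otimes\alpha)\xrightarrow{\Phi_3}F^p(G,C_0(G,A),\mathrm{lt}\otimes\mathrm{id})$$ such that $\Phi_1(F)(s,\gamma)=\gamma(s)F(\gamma,s)$ for $F\in C_c(\hat G\times G,A)$, $\Phi_2(F)(s,t)=\int_{\hat G}F(s,\gamma)\overline{\gamma(t)}\,d\mu(\gamma)$ for $F\in C_c(G\times\hat G,A)$, and $\Phi_3(F)(s,t)=\alpha_t^{-1}(F(s,t))$ for $F\in C_c(G,C_0(G,A))$; and for every $r\in G$ $$(\Phi_3\circ\Phi_2\circ\Phi_1)\circ\hat{\hat\alpha}_r=((\mathrm{rt}\otimes\alpha)\otimes\mathrm{id})_r\circ(\Phi_3\circ\Phi_2\circ\Phi_1)$$ on all of $F^p(\hat G,F^p(G,A,\alpha),\hat\alpha)$. -/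

import Mathlib

open MeasureTheory Topology UniformSpace
open scoped ENNReal CompactlySupported ZeroAtInfty

universe u

noncomputable section

set_option linter.unusedSectionVars false

namespace LpCrossed

/-! ### Isometric actions on Banach algebras -/

/-- A strongly continuous action of a topological group `H` on a (not necessarily unital) complex
Banach algebra `B` by isometric algebra automorphisms: a continuous homomorphism from `H` to the
group of isometric automorphisms of `B`. -/
structure IsometricAction (H B : Type u) [Group H] [TopologicalSpace H]
    [NonUnitalNormedRing B] [NormedSpace ℂ B] where
  act : H → B →ₙₐ[ℂ] B
  act_one : ∀ b, act 1 b = b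
  act_mul : ∀ s t b, act (s * t) b = act s (act t b)
  norm_act : ∀ s b, ‖act s b‖ = ‖b‖
  continuous_act : ∀ b, Continuous fun s => act s b

section General

variable {H B : Type u} [Group H] [TopologicalSpace H]
  [NonUnitalNormedRing B] [NormedSpace ℂ B]

/-- The trivial action. -/
def trivialAction (H B : Type u) [Group H] [TopologicalSpace H]
    [NonUnitalNormedRing B] [NormedSpace ℂ B] : IsometricAction H B where
  act _ := 1
  act_one _ := rfl
  act_mul _ _ _ := rfl
  norm_act _ _ := rfl
  continuous_act _ := continuous_const

theorem IsometricAction.act_inv_act (α : IsometricAction H B) (s : H) (b : B) :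
    α.act s⁻¹ (α.act s b) = b := by
  rw [← α.act_mul, inv_mul_cancel, α.act_one]

theorem IsometricAction.act_act_inv (α : IsometricAction H B) (s : H) (b : B) :
    α.act s (α.act s⁻¹ b) = b := by
  rw [← α.act_mul, mul_inv_cancel, α.act_one]

theorem continuous_of_isometries {X E F : Type*} [TopologicalSpace X] [SeminormedAddCommGroup E]
    [SeminormedAddCommGroup F] (T : X → E → F) (hsub : ∀ x a b, T x (a - b) = T x a - T x b)
    (hn : ∀ x a, ‖T x a‖ ≤ ‖a‖) (hc : ∀ a, Continuous fun x => T x a) :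
    Continuous fun q : X × E => T q.1 q.2 := by
  rw [continuous_iff_continuousAt]
  rintro ⟨x, a⟩
  have h1 : Filter.Tendsto (fun q : X × E => T q.1 a) (𝓝 (x, a)) (𝓝 (T x a)) :=
    ((hc a).comp continuous_fst).continuousAt
  have h2 : Filter.Tendsto (fun q : X × E => T q.1 (q.2 - a)) (𝓝 (x, a)) (𝓝 0) := by
    refine squeeze_zero_norm (a := fun q : X × E => ‖q.2 - a‖) (fun q => hn q.1 (q.2 - a)) ?_
    have : Continuous fun q : X × E => ‖q.2 - a‖ := by fun_prop
    simpa using this.tendsto (x, a)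
  have := h2.add h1
  simpa [hsub, ContinuousAt] using this

theorem IsometricAction.continuous_uncurry (α : IsometricAction H B) :
    Continuous fun q : H × B => α.act q.1 q.2 :=
  continuous_of_isometries (fun s b => α.act s b) (fun s a b => map_sub (α.act s) a b)
    (fun s b => (α.norm_act s b).le) α.continuous_act

/-- The isometric automorphism `act s` as a continuous linear map. -/
def IsometricAction.clm (α : IsometricAction H B) (s : H) : B →L[ℂ] B :=
  LinearMap.mkContinuous
    { toFun := α.act s
      map_add' := map_add (α.act s)
      map_smul' := fun c b => map_smul (α.act s) c b } 1
    (fun b => by simpa using (α.norm_act s b).le)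

theorem continuous_dual_eval {H : Type u} [Group H] [TopologicalSpace H]
    [LocallyCompactSpace H] :
    Continuous fun q : PontryaginDual H × H => q.1 q.2 := by
  have h : Continuous fun γ : H →ₜ* Circle => (γ : C(H, Circle)) :=
    (ContinuousMonoidHom.isInducing_toContinuousMap H Circle).continuous
  exact (h.comp continuous_fst).eval continuous_snd

/-! ### Covariant representations on `L^p` spaces -/

/-- A nondegenerate `σ`-finite contractive covariant representation `(π, v)` of the dynamical
system `(H, B, α)` on a space `L^p(X, ν)`: `π` is a nondegenerate contractive homomorphism,
`v` a (strongly continuous) isometric group representation, and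
`v_t π(b) v_{t⁻¹} = π(α_t(b))`. -/
structure CovRep (p : ℝ≥0∞) [Fact (1 ≤ p)] (α : IsometricAction H B) where
  X : Type u
  [mX : MeasurableSpace X]
  ν : Measure X
  [sigmaFinite : SigmaFinite ν]
  π : B →ₙₐ[ℂ] (Lp ℂ p ν →L[ℂ] Lp ℂ p ν)
  v : H →* (Lp ℂ p ν →L[ℂ] Lp ℂ p ν)
  norm_π_le : ∀ b, ‖π b‖ ≤ ‖b‖
  nondegenerate : Dense (Submodule.span ℂ {η | ∃ b ξ, η = π b ξ} : Set (Lp ℂ p ν))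
  norm_v : ∀ s ξ, ‖v s ξ‖ = ‖ξ‖
  continuous_v : ∀ ξ, Continuous fun s => v s ξ
  covariant : ∀ t b, v t * π b * v t⁻¹ = π (α.act t b)

attribute [instance] CovRep.mX CovRep.sigmaFinite

variable {p : ℝ≥0∞} [Fact (1 ≤ p)] {α : IsometricAction H B}

/-- The `L^p` space on which a covariant representation acts. -/
abbrev CovRep.E (ρ : CovRep p α) : Type u := Lp ℂ p ρ.ν

theorem CovRep.norm_π_apply_le (ρ : CovRep p α) (b : B) (ξ : ρ.E) : ‖ρ.π b ξ‖ ≤ ‖b‖ * ‖ξ‖ :=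
  (ρ.π b).le_of_opNorm_le (ρ.norm_π_le b) ξ

/-- The representation `π` as a continuous linear map. -/
def CovRep.πL (ρ : CovRep p α) : B →L[ℂ] (ρ.E →L[ℂ] ρ.E) :=
  LinearMap.mkContinuous
    { toFun := ρ.π
      map_add' := map_add ρ.π
      map_smul' := fun c b => map_smul ρ.π c b } 1
    (fun b => by simpa using ρ.norm_π_le b)

theorem CovRep.continuous_π (ρ : CovRep p α) : Continuous ρ.π := ρ.πL.continuous

theorem CovRep.continuous_v_uncurry (ρ : CovRep p α) :
    Continuous fun q : H × ρ.E => ρ.v q.1 q.2 :=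
  continuous_of_isometries (fun s ξ => ρ.v s ξ) (fun s a b => map_sub (ρ.v s) a b)
    (fun s ξ => (ρ.norm_v s ξ).le) ρ.continuous_v

theorem CovRep.v_π (ρ : CovRep p α) (t : H) (b : B) (ξ : ρ.E) :
    ρ.v t (ρ.π b ξ) = ρ.π (α.act t b) (ρ.v t ξ) := by
  rw [← ρ.covariant]
  change _ = ρ.v t (ρ.π b (ρ.v t⁻¹ (ρ.v t ξ)))
  have : ρ.v t⁻¹ (ρ.v t ξ) = ξ := by
    change (ρ.v t⁻¹ * ρ.v t) ξ = ξ
    rw [← map_mul]; simp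
  rw [this]

/-! ### The integrated form and the universal seminorm on `C_c(H, B)` -/

variable [MeasurableSpace H] [BorelSpace H]

theorem CovRep.continuous_integrand (ρ : CovRep p α) (f : C_c(H, B)) (ξ : ρ.E) :
    Continuous fun s => ρ.π (f s) (ρ.v s ξ) :=
  (ρ.continuous_π.comp (map_continuous f)).clm_apply (ρ.continuous_v ξ)

theorem CovRep.hasCompactSupport_integrand (ρ : CovRep p α) (f : C_c(H, B)) (ξ : ρ.E) :
    HasCompactSupport fun s => ρ.π (f s) (ρ.v s ξ) := by
  refine f.hasCompactSupport.mono ?_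
  intro s hs h0
  apply hs
  simp [h0]

theorem CovRep.integrable_integrand (ρ : CovRep p α) (μ : Measure H)
    [IsFiniteMeasureOnCompacts μ] (f : C_c(H, B)) (ξ : ρ.E) :
    Integrable (fun s => ρ.π (f s) (ρ.v s ξ)) μ :=
  (ρ.continuous_integrand f ξ).integrable_of_hasCompactSupport (ρ.hasCompactSupport_integrand f ξ)

theorem integrable_norm_Cc (μ : Measure H) [IsFiniteMeasureOnCompacts μ] (f : C_c(H, B)) :
    Integrable (fun s => ‖f s‖) μ :=
  (map_continuous f).norm.integrable_of_hasCompactSupport f.hasCompactSupport.norm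

theorem CovRep.norm_integral_le (ρ : CovRep p α) (μ : Measure H)
    [IsFiniteMeasureOnCompacts μ] (f : C_c(H, B)) (ξ : ρ.E) :
    ‖∫ s, ρ.π (f s) (ρ.v s ξ) ∂μ‖ ≤ (∫ s, ‖f s‖ ∂μ) * ‖ξ‖ := by
  refine (norm_integral_le_integral_norm _).trans ?_
  rw [← integral_mul_const]
  refine integral_mono (ρ.integrable_integrand μ f ξ).norm
    ((integrable_norm_Cc μ f).mul_const _) fun s => ?_
  simpa [ρ.norm_v] using ρ.norm_π_apply_le (f s) (ρ.v s ξ)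

/-- The integrated form `(π ⋊ v)(f) ξ = ∫ π(f(s)) v_s(ξ) dμ(s)`. -/
def CovRep.integrated (ρ : CovRep p α) (μ : Measure H) [IsFiniteMeasureOnCompacts μ]
    (f : C_c(H, B)) : ρ.E →L[ℂ] ρ.E :=
  LinearMap.mkContinuous
    { toFun := fun ξ => ∫ s, ρ.π (f s) (ρ.v s ξ) ∂μ
      map_add' := fun ξ η => by
        simp only [map_add]
        exact integral_add (ρ.integrable_integrand μ f ξ) (ρ.integrable_integrand μ f η)
      map_smul' := fun c ξ => by
        simp only [map_smul, RingHom.id_apply]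
        exact integral_smul c _ }
    (∫ s, ‖f s‖ ∂μ) (ρ.norm_integral_le μ f)

theorem CovRep.integrated_apply (ρ : CovRep p α) (μ : Measure H) [IsFiniteMeasureOnCompacts μ]
    (f : C_c(H, B)) (ξ : ρ.E) :
    ρ.integrated μ f ξ = ∫ s, ρ.π (f s) (ρ.v s ξ) ∂μ := rfl

theorem CovRep.norm_integrated_le (ρ : CovRep p α) (μ : Measure H) [IsFiniteMeasureOnCompacts μ]
    (f : C_c(H, B)) : ‖ρ.integrated μ f‖ ≤ ∫ s, ‖f s‖ ∂μ :=
  LinearMap.mkContinuous_norm_le _ (integral_nonneg fun _ => norm_nonneg _) _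

theorem CovRep.integrated_add (ρ : CovRep p α) (μ : Measure H) [IsFiniteMeasureOnCompacts μ]
    (f g : C_c(H, B)) : ρ.integrated μ (f + g) = ρ.integrated μ f + ρ.integrated μ g := by
  ext1 ξ
  simp only [CovRep.integrated_apply, _root_.add_apply,
    CompactlySupportedContinuousMap.add_apply, map_add]
  exact integral_add (ρ.integrable_integrand μ f ξ) (ρ.integrable_integrand μ g ξ)

theorem CovRep.integrated_smul (ρ : CovRep p α) (μ : Measure H) [IsFiniteMeasureOnCompacts μ]
    (c : ℂ) (f : C_c(H, B)) : ρ.integrated μ (c • f) = c • ρ.integrated μ f := by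
  ext1 ξ
  simp only [CovRep.integrated_apply, _root_.smul_apply,
    CompactlySupportedContinuousMap.smul_apply, map_smul]
  exact integral_smul c _

/-- The norm `‖f‖ = sup {‖(π ⋊ v)(f)‖}` over all nondegenerate `σ`-finite contractive covariant
representations on `L^p` spaces. -/
def universalNorm (p : ℝ≥0∞) [Fact (1 ≤ p)] (μ : Measure H) [IsFiniteMeasureOnCompacts μ]
    (α : IsometricAction H B) (f : C_c(H, B)) : ℝ :=
  ⨆ ρ : CovRep p α, ‖ρ.integrated μ f‖

theorem CovRep.norm_integrated_le_universalNorm (ρ : CovRep p α) (μ : Measure H)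
    [IsFiniteMeasureOnCompacts μ] (f : C_c(H, B)) :
    ‖ρ.integrated μ f‖ ≤ universalNorm p μ α f :=
  le_ciSup (f := fun ρ : CovRep p α => ‖ρ.integrated μ f‖)
    ⟨_, by rintro _ ⟨ρ, rfl⟩; exact ρ.norm_integrated_le μ f⟩ ρ

theorem universalNorm_le {μ : Measure H} [IsFiniteMeasureOnCompacts μ] {f : C_c(H, B)} {C : ℝ}
    (hC : 0 ≤ C) (h : ∀ ρ : CovRep p α, ‖ρ.integrated μ f‖ ≤ C) : universalNorm p μ α f ≤ C :=
  Real.iSup_le h hC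

theorem universalNorm_nonneg (p : ℝ≥0∞) [Fact (1 ≤ p)] (μ : Measure H)
    [IsFiniteMeasureOnCompacts μ] (α : IsometricAction H B) (f : C_c(H, B)) :
    0 ≤ universalNorm p μ α f :=
  Real.iSup_nonneg fun _ => norm_nonneg _

theorem universalNorm_le_integral (p : ℝ≥0∞) [Fact (1 ≤ p)] (μ : Measure H)
    [IsFiniteMeasureOnCompacts μ] (α : IsometricAction H B) (f : C_c(H, B)) :
    universalNorm p μ α f ≤ ∫ s, ‖f s‖ ∂μ :=
  universalNorm_le (integral_nonneg fun _ => norm_nonneg _) fun ρ => ρ.norm_integrated_le μ f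

/-- The universal norm, as a seminorm. -/
def universalSeminorm (p : ℝ≥0∞) [Fact (1 ≤ p)] (μ : Measure H) [IsFiniteMeasureOnCompacts μ]
    (α : IsometricAction H B) : Seminorm ℂ C_c(H, B) :=
  Seminorm.ofSMulLE (universalNorm p μ α)
    (le_antisymm ((universalNorm_le_integral p μ α 0).trans (by simp))
      (universalNorm_nonneg p μ α 0))
    (fun f g => universalNorm_le
      (add_nonneg (universalNorm_nonneg p μ α f) (universalNorm_nonneg p μ α g)) fun ρ => by
        rw [ρ.integrated_add]
        exact (norm_add_le _ _).trans (add_le_add (ρ.norm_integrated_le_universalNorm μ f)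
          (ρ.norm_integrated_le_universalNorm μ g)))
    (fun c f => universalNorm_le
      (mul_nonneg (norm_nonneg c) (universalNorm_nonneg p μ α f)) fun ρ => by
        rw [ρ.integrated_smul, norm_smul]
        exact mul_le_mul_of_nonneg_left (ρ.norm_integrated_le_universalNorm μ f) (norm_nonneg c))

/-- The space `C_c(H, B, α)`, that is `C_c(H, B)` equipped with the universal norm. -/
def PreCrossed (p : ℝ≥0∞) [Fact (1 ≤ p)] (μ : Measure H) [IsFiniteMeasureOnCompacts μ]
    (_α : IsometricAction H B) : Type u := C_c(H, B)

instance (μ : Measure H) [IsFiniteMeasureOnCompacts μ] : AddCommGroup (PreCrossed p μ α) :=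
  inferInstanceAs (AddCommGroup C_c(H, B))

instance (μ : Measure H) [IsFiniteMeasureOnCompacts μ] : Module ℂ (PreCrossed p μ α) :=
  inferInstanceAs (Module ℂ C_c(H, B))

instance (μ : Measure H) [IsFiniteMeasureOnCompacts μ] :
    SeminormedAddCommGroup (PreCrossed p μ α) :=
  AddGroupSeminorm.toSeminormedAddCommGroup
    (E := PreCrossed p μ α) (universalSeminorm p μ α).toAddGroupSeminorm

instance (μ : Measure H) [IsFiniteMeasureOnCompacts μ] : NormedSpace ℂ (PreCrossed p μ α) where
  norm_smul_le c f := (map_smul_eq_mul (universalSeminorm p μ α) c f).le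

end General

/-- The full `L^p` operator crossed product `F^p(H, B, α)` (with respect to the Haar measure `μ`
on `H`): the completion of `C_c(H, B, α)` in the universal norm. -/
def Crossed {H B : Type u} [Group H] [TopologicalSpace H]
    [NonUnitalNormedRing B] [NormedSpace ℂ B] [MeasurableSpace H] [BorelSpace H]
    (p : ℝ≥0∞) [Fact (1 ≤ p)] (μ : Measure H) [IsFiniteMeasureOnCompacts μ]
    (α : IsometricAction H B) : Type u := Completion (PreCrossed p μ α)

/-! ### Twisted convolution and the Banach algebra structure of `F^p(H, B, α)` -/

section Algebra

variable {H B : Type u} [Group H] [TopologicalSpace H] [IsTopologicalGroup H]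
  [MeasurableSpace H] [BorelSpace H]
  [NonUnitalNormedRing B] [NormedSpace ℂ B] [IsScalarTower ℂ B B] [SMulCommClass ℂ B B]
  [CompleteSpace B]
  {p : ℝ≥0∞} [Fact (1 ≤ p)] {α : IsometricAction H B}

theorem convolution_integrand_eq_zero (α : IsometricAction H B) (f g : C_c(H, B)) {s t : H}
    (h : ¬ (s ∈ tsupport f ∧ s⁻¹ * t ∈ tsupport g)) : f s * α.act s (g (s⁻¹ * t)) = 0 := by
  by_cases hs : s ∈ tsupport f
  · rw [image_eq_zero_of_notMem_tsupport fun ht => h ⟨hs, ht⟩]; simp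
  · rw [image_eq_zero_of_notMem_tsupport hs]; simp

theorem continuous_convolution_integrand (α : IsometricAction H B) (f g : C_c(H, B)) :
    Continuous fun q : H × H => f q.2 * α.act q.2 (g (q.2⁻¹ * q.1)) := by
  have hf : Continuous f := map_continuous f
  have hg : Continuous g := map_continuous g
  exact (hf.comp continuous_snd).mul (α.continuous_uncurry.comp
    (continuous_snd.prodMk (hg.comp (by fun_prop))))

/-- Twisted convolution `(f * g)(t) = ∫ f(s) α_s(g(s⁻¹ t)) dμ(s)` on `C_c(H, B)`. -/
def convolution (μ : Measure H) [IsFiniteMeasureOnCompacts μ] (α : IsometricAction H B)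
    (f g : C_c(H, B)) : C_c(H, B) where
  toFun t := ∫ s, f s * α.act s (g (s⁻¹ * t)) ∂μ
  continuous_toFun := by
    rw [← continuousOn_univ]
    refine continuousOn_integral_of_compact_support (k := tsupport f) f.hasCompactSupport
      (continuous_convolution_integrand α f g).continuousOn ?_
    intro t s _ hs
    exact convolution_integrand_eq_zero α f g fun h => hs h.1
  hasCompactSupport' := by
    refine HasCompactSupport.intro (f.hasCompactSupport.isCompact.mul
      g.hasCompactSupport.isCompact) fun t ht => ?_
    have : ∀ s, f s * α.act s (g (s⁻¹ * t)) = 0 := fun s =>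
      convolution_integrand_eq_zero α f g fun h =>
        ht ⟨s, h.1, s⁻¹ * t, h.2, mul_inv_cancel_left s t⟩
    simp [this]

theorem convolution_apply (μ : Measure H) [IsFiniteMeasureOnCompacts μ]
    (α : IsometricAction H B) (f g : C_c(H, B)) (t : H) :
    convolution μ α f g t = ∫ s, f s * α.act s (g (s⁻¹ * t)) ∂μ := rfl

theorem integrable_convolution (μ : Measure H) [IsFiniteMeasureOnCompacts μ]
    (α : IsometricAction H B) (f g : C_c(H, B)) (t : H) :
    Integrable (fun s => f s * α.act s (g (s⁻¹ * t))) μ := by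
  refine ((continuous_convolution_integrand α f g).comp
    (continuous_const.prodMk continuous_id)).integrable_of_hasCompactSupport ?_
  refine f.hasCompactSupport.mono ?_
  intro s hs h0
  exact hs (by simp [h0])

theorem convolution_add (μ : Measure H) [IsFiniteMeasureOnCompacts μ]
    (α : IsometricAction H B) (f g h : C_c(H, B)) :
    convolution μ α f (g + h) = convolution μ α f g + convolution μ α f h := by
  ext t
  simp only [convolution_apply, CompactlySupportedContinuousMap.add_apply, map_add, mul_add]
  exact integral_add (integrable_convolution μ α f g t) (integrable_convolution μ α f h t)

theorem add_convolution (μ : Measure H) [IsFiniteMeasureOnCompacts μ]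
    (α : IsometricAction H B) (f g h : C_c(H, B)) :
    convolution μ α (f + g) h = convolution μ α f h + convolution μ α g h := by
  ext t
  simp only [convolution_apply, CompactlySupportedContinuousMap.add_apply, add_mul]
  exact integral_add (integrable_convolution μ α f h t) (integrable_convolution μ α g h t)

theorem smul_convolution (μ : Measure H) [IsFiniteMeasureOnCompacts μ]
    (α : IsometricAction H B) (c : ℂ) (f g : C_c(H, B)) :
    convolution μ α (c • f) g = c • convolution μ α f g := by
  ext t
  simp only [convolution_apply, CompactlySupportedContinuousMap.smul_apply, smul_mul_assoc]
  exact integral_smul c _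

theorem convolution_smul (μ : Measure H) [IsFiniteMeasureOnCompacts μ]
    (α : IsometricAction H B) (c : ℂ) (f g : C_c(H, B)) :
    convolution μ α f (c • g) = c • convolution μ α f g := by
  ext t
  simp only [convolution_apply, CompactlySupportedContinuousMap.smul_apply, map_smul,
    mul_smul_comm]
  exact integral_smul c _

/-- The integrated form is multiplicative. -/
theorem CovRep.integrated_convolution (ρ : CovRep p α) (μ : Measure H)
    [IsFiniteMeasureOnCompacts μ] [μ.IsMulLeftInvariant] (f g : C_c(H, B)) :
    ρ.integrated μ (convolution μ α f g) = ρ.integrated μ f * ρ.integrated μ g := by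
  ext1 ξ
  change ∫ t, ρ.π (∫ s, f s * α.act s (g (s⁻¹ * t)) ∂μ) (ρ.v t ξ) ∂μ =
    ∫ s, ρ.π (f s) (ρ.v s (∫ t, ρ.π (g t) (ρ.v t ξ) ∂μ)) ∂μ
  have h1 : ∀ t, ρ.π (∫ s, f s * α.act s (g (s⁻¹ * t)) ∂μ) (ρ.v t ξ) =
      ∫ s, ρ.π (f s * α.act s (g (s⁻¹ * t))) (ρ.v t ξ) ∂μ := fun t =>
    ((ρ.πL.flip (ρ.v t ξ)).integral_comp_comm (integrable_convolution μ α f g t)).symm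
  simp only [h1]
  rw [integral_integral_swap_of_hasCompactSupport]
  · congr 1
    ext1 s
    rw [← integral_mul_left_eq_self _ s]
    have h2 : ∀ t, ρ.π (f s * α.act s (g (s⁻¹ * (s * t)))) (ρ.v (s * t) ξ) =
        ((ρ.π (f s)).comp (ρ.v s)) (ρ.π (g t) (ρ.v t ξ)) := by
      intro t
      rw [inv_mul_cancel_left, map_mul, map_mul]
      change ρ.π (f s) (ρ.π (α.act s (g t)) (ρ.v s (ρ.v t ξ))) = ρ.π (f s) (ρ.v s _)
      rw [ρ.v_π]
    simp only [h2]
    exact ((ρ.π (f s)).comp (ρ.v s)).integral_comp_comm (ρ.integrable_integrand μ g ξ)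
  · exact (ρ.continuous_π.comp (continuous_convolution_integrand α f g)).clm_apply
      ((ρ.continuous_v ξ).comp continuous_fst)
  · refine HasCompactSupport.intro ((f.hasCompactSupport.isCompact.mul
      g.hasCompactSupport.isCompact).prod f.hasCompactSupport.isCompact) ?_
    rintro ⟨t, s⟩ hts
    have : f s * α.act s (g (s⁻¹ * t)) = 0 :=
      convolution_integrand_eq_zero α f g fun h =>
        hts ⟨⟨s, h.1, s⁻¹ * t, h.2, mul_inv_cancel_left s t⟩, h.1⟩
    simp [Function.uncurry, this]

variable {μ : Measure H} [IsFiniteMeasureOnCompacts μ]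

/-- A function in `C_c(H, B)` as an element of the normed space `C_c(H, B, α)`. -/
def PreCrossed.of (p : ℝ≥0∞) [Fact (1 ≤ p)] (μ : Measure H) [IsFiniteMeasureOnCompacts μ]
    (α : IsometricAction H B) : C_c(H, B) →ₗ[ℂ] PreCrossed p μ α := LinearMap.id

theorem PreCrossed.norm_of (f : C_c(H, B)) :
    ‖PreCrossed.of p μ α f‖ = universalNorm p μ α f := rfl

instance : NormedAddCommGroup (Crossed p μ α) :=
  inferInstanceAs (NormedAddCommGroup (Completion (PreCrossed p μ α)))

instance : NormedSpace ℂ (Crossed p μ α) :=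
  inferInstanceAs (NormedSpace ℂ (Completion (PreCrossed p μ α)))

instance : CompleteSpace (Crossed p μ α) :=
  inferInstanceAs (CompleteSpace (Completion (PreCrossed p μ α)))

/-- The canonical map `C_c(H, B) → F^p(H, B, α)`. -/
def Crossed.of (p : ℝ≥0∞) [Fact (1 ≤ p)] (μ : Measure H) [IsFiniteMeasureOnCompacts μ]
    (α : IsometricAction H B) : C_c(H, B) →ₗ[ℂ] Crossed p μ α :=
  (Completion.toComplₗᵢ (𝕜 := ℂ) (E := PreCrossed p μ α)).toLinearMap ∘ₗ PreCrossed.of p μ α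

theorem Crossed.norm_of (f : C_c(H, B)) : ‖Crossed.of p μ α f‖ = universalNorm p μ α f :=
  Completion.norm_coe (PreCrossed.of p μ α f)

theorem Crossed.norm_of_le (f : C_c(H, B)) : ‖Crossed.of p μ α f‖ ≤ ∫ s, ‖f s‖ ∂μ :=
  (Crossed.norm_of f).le.trans (universalNorm_le_integral p μ α f)

theorem Crossed.denseRange_of : DenseRange (Crossed.of p μ α) :=
  Completion.denseRange_coe (α := PreCrossed p μ α)

theorem Crossed.induction_on {P : Crossed p μ α → Prop} (x : Crossed p μ α)
    (hc : IsClosed {x | P x}) (h : ∀ f, P (Crossed.of p μ α f)) : P x :=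
  Crossed.denseRange_of.induction_on x hc h

/-- Functions with the same image under every integrated form agree in `F^p(H, B, α)`. -/
theorem Crossed.of_eq_of {f g : C_c(H, B)}
    (h : ∀ ρ : CovRep p α, ρ.integrated μ f = ρ.integrated μ g) :
    Crossed.of p μ α f = Crossed.of p μ α g := by
  rw [← sub_eq_zero, ← map_sub, ← norm_le_zero_iff, Crossed.norm_of]
  refine universalNorm_le le_rfl fun ρ => ?_
  have : f - g = f + (-1 : ℂ) • g := by ext; simp [sub_eq_add_neg]
  rw [this, ρ.integrated_add, ρ.integrated_smul, h]
  simp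

theorem Crossed.clm_ext {E : Type*} [NormedAddCommGroup E] [NormedSpace ℂ E]
    {S T : Crossed p μ α →L[ℂ] E}
    (h : ∀ f, S (Crossed.of p μ α f) = T (Crossed.of p μ α f)) : S = T :=
  DFunLike.coe_injective (Crossed.denseRange_of.equalizer S.continuous T.continuous (funext h))

/-- Extension of a bounded linear map on `C_c(H, B, α)` to `F^p(H, B, α)`. -/
def Crossed.lift {E : Type*} [NormedAddCommGroup E] [NormedSpace ℂ E] [CompleteSpace E]
    (T : C_c(H, B) →ₗ[ℂ] E) (C : ℝ) (hT : ∀ f, ‖T f‖ ≤ C * universalNorm p μ α f) :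
    Crossed p μ α →L[ℂ] E :=
  (LinearMap.mkContinuous (E := PreCrossed p μ α) T C hT).extend
    (Completion.toComplL (𝕜 := ℂ) (E := PreCrossed p μ α))

theorem Crossed.lift_of {E : Type*} [NormedAddCommGroup E] [NormedSpace ℂ E] [CompleteSpace E]
    (T : C_c(H, B) →ₗ[ℂ] E) (C : ℝ) (hT : ∀ f, ‖T f‖ ≤ C * universalNorm p μ α f)
    (f : C_c(H, B)) :
    Crossed.lift T C hT (Crossed.of p μ α f) = T f :=
  ContinuousLinearMap.extend_eq _ (Completion.denseRange_coe (α := PreCrossed p μ α))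
    (Completion.isUniformInducing_coe _) _

theorem Crossed.norm_lift_le {E : Type*} [NormedAddCommGroup E] [NormedSpace ℂ E]
    [CompleteSpace E] (T : C_c(H, B) →ₗ[ℂ] E) (C : ℝ)
    (hT : ∀ f, ‖T f‖ ≤ C * universalNorm p μ α f) (x : Crossed p μ α) :
    ‖Crossed.lift T C hT x‖ ≤ C * ‖x‖ := by
  induction x using Crossed.induction_on with
  | hc => exact isClosed_le (by fun_prop) (by fun_prop)
  | h f => rw [Crossed.lift_of, Crossed.norm_of]; exact hT f

variable [μ.IsMulLeftInvariant]

theorem universalNorm_convolution_le (f g : C_c(H, B)) :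
    universalNorm p μ α (convolution μ α f g) ≤
      universalNorm p μ α f * universalNorm p μ α g :=
  universalNorm_le (mul_nonneg (universalNorm_nonneg p μ α f) (universalNorm_nonneg p μ α g))
    fun ρ => by
      rw [ρ.integrated_convolution]
      exact (norm_mul_le _ _).trans (mul_le_mul (ρ.norm_integrated_le_universalNorm μ f)
        (ρ.norm_integrated_le_universalNorm μ g) (norm_nonneg _) (universalNorm_nonneg p μ α f))

/-- Left multiplication by an element of `C_c(H, B, α)` on `F^p(H, B, α)`. -/
def Crossed.mulLeft (f : C_c(H, B)) : Crossed p μ α →L[ℂ] Crossed p μ α :=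
  Crossed.lift
    { toFun := fun g => Crossed.of p μ α (convolution μ α f g)
      map_add' := fun g h => by rw [convolution_add, map_add]
      map_smul' := fun c g => by rw [convolution_smul, map_smul]; rfl }
    (universalNorm p μ α f)
    (fun g => (Crossed.norm_of _).le.trans (universalNorm_convolution_le f g))

theorem Crossed.mulLeft_of (f g : C_c(H, B)) :
    Crossed.mulLeft f (Crossed.of p μ α g) = Crossed.of p μ α (convolution μ α f g) :=
  Crossed.lift_of _ _ _ _

theorem Crossed.norm_mulLeft_le (f : C_c(H, B)) :
    ‖Crossed.mulLeft (p := p) (μ := μ) (α := α) f‖ ≤ universalNorm p μ α f :=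
  ContinuousLinearMap.opNorm_le_bound _ (universalNorm_nonneg p μ α f)
    (Crossed.norm_lift_le _ _ _)

theorem Crossed.mulLeft_add (f g : C_c(H, B)) :
    Crossed.mulLeft (p := p) (μ := μ) (α := α) (f + g) =
      Crossed.mulLeft f + Crossed.mulLeft g :=
  Crossed.clm_ext fun k => by
    rw [_root_.add_apply, mulLeft_of, mulLeft_of, mulLeft_of, add_convolution, map_add]

theorem Crossed.mulLeft_smul (c : ℂ) (f : C_c(H, B)) :
    Crossed.mulLeft (p := p) (μ := μ) (α := α) (c • f) = c • Crossed.mulLeft f :=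
  Crossed.clm_ext fun k => by
    rw [_root_.smul_apply, mulLeft_of, mulLeft_of, smul_convolution, map_smul]

/-- The product of `F^p(H, B, α)`, as a continuous bilinear map. -/
def Crossed.mulL : Crossed p μ α →L[ℂ] Crossed p μ α →L[ℂ] Crossed p μ α :=
  Crossed.lift
    { toFun := fun f => Crossed.mulLeft f
      map_add' := Crossed.mulLeft_add
      map_smul' := Crossed.mulLeft_smul }
    1 (fun f => (Crossed.norm_mulLeft_le f).trans_eq (one_mul _).symm)

instance : Mul (Crossed p μ α) := ⟨fun x y => Crossed.mulL x y⟩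

theorem Crossed.mul_def (x y : Crossed p μ α) : x * y = Crossed.mulL x y := rfl

theorem Crossed.of_mul_of (f g : C_c(H, B)) :
    Crossed.of p μ α f * Crossed.of p μ α g = Crossed.of p μ α (convolution μ α f g) := by
  rw [Crossed.mul_def, Crossed.mulL, Crossed.lift_of]
  exact Crossed.mulLeft_of f g

theorem Crossed.mul_assoc_aux (x y z : Crossed p μ α) : x * y * z = x * (y * z) := by
  induction x using Crossed.induction_on with
  | hc =>
    simp only [Crossed.mul_def]
    exact isClosed_eq (by fun_prop) (by fun_prop)
  | h f =>
    induction y using Crossed.induction_on with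
    | hc =>
      simp only [Crossed.mul_def]
      exact isClosed_eq (by fun_prop) (by fun_prop)
    | h g =>
      induction z using Crossed.induction_on with
      | hc =>
        simp only [Crossed.mul_def]
        exact isClosed_eq (by fun_prop) (by fun_prop)
      | h k =>
        rw [Crossed.of_mul_of, Crossed.of_mul_of, Crossed.of_mul_of, Crossed.of_mul_of]
        refine Crossed.of_eq_of fun ρ => ?_
        simp only [ρ.integrated_convolution, mul_assoc]

theorem Crossed.norm_mul_le_aux (x y : Crossed p μ α) : ‖x * y‖ ≤ ‖x‖ * ‖y‖ := by
  induction x using Crossed.induction_on with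
  | hc =>
    simp only [Crossed.mul_def]
    exact isClosed_le (by fun_prop) (by fun_prop)
  | h f =>
    induction y using Crossed.induction_on with
    | hc =>
      simp only [Crossed.mul_def]
      exact isClosed_le (by fun_prop) (by fun_prop)
    | h g =>
      rw [Crossed.of_mul_of, Crossed.norm_of, Crossed.norm_of, Crossed.norm_of]
      exact universalNorm_convolution_le f g

/-- `F^p(H, B, α)` is a Banach algebra, with product extending twisted convolution. -/
instance : NonUnitalNormedRing (Crossed p μ α) :=
  { (inferInstance : NormedAddCommGroup (Crossed p μ α)),
    (inferInstance : Mul (Crossed p μ α)) with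
    left_distrib := fun x y z => map_add (Crossed.mulL x) y z
    right_distrib := fun x y z => by simp [Crossed.mul_def]
    zero_mul := fun x => by simp [Crossed.mul_def]
    mul_zero := fun x => map_zero (Crossed.mulL x)
    mul_assoc := Crossed.mul_assoc_aux
    norm_mul_le := Crossed.norm_mul_le_aux }

instance : IsScalarTower ℂ (Crossed p μ α) (Crossed p μ α) where
  smul_assoc c x y := by
    change Crossed.mulL (c • x) y = c • Crossed.mulL x y
    simp

instance : SMulCommClass ℂ (Crossed p μ α) (Crossed p μ α) where
  smul_comm c x y := by
    change c • Crossed.mulL x y = Crossed.mulL x (c • y)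
    simp

/-- Extension of a contractive multiplicative linear map on `C_c(H, B, α)` to an algebra
homomorphism on `F^p(H, B, α)`. -/
def Crossed.liftHom {D : Type*} [NonUnitalNormedRing D] [NormedSpace ℂ D] [CompleteSpace D]
    (T : C_c(H, B) →ₗ[ℂ] D) (hT : ∀ f, ‖T f‖ ≤ universalNorm p μ α f)
    (hmul : ∀ f g, T (convolution μ α f g) = T f * T g) : Crossed p μ α →ₙₐ[ℂ] D where
  toFun := Crossed.lift (p := p) (μ := μ) (α := α) T 1 (fun f => by rw [one_mul]; exact hT f)
  map_smul' c x := by simp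
  map_zero' := map_zero _
  map_add' := map_add _
  map_mul' x y := by
    induction x using Crossed.induction_on with
    | hc => exact isClosed_eq (by fun_prop) (by fun_prop)
    | h f =>
      induction y using Crossed.induction_on with
      | hc => exact isClosed_eq (by fun_prop) (by fun_prop)
      | h g => rw [Crossed.of_mul_of, Crossed.lift_of, Crossed.lift_of, Crossed.lift_of, hmul]

theorem Crossed.liftHom_of {D : Type*} [NonUnitalNormedRing D] [NormedSpace ℂ D]
    [CompleteSpace D] (T : C_c(H, B) →ₗ[ℂ] D) (hT : ∀ f, ‖T f‖ ≤ universalNorm p μ α f)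
    (hmul : ∀ f g, T (convolution μ α f g) = T f * T g) (f : C_c(H, B)) :
    Crossed.liftHom T hT hmul (Crossed.of p μ α f) = T f :=
  Crossed.lift_of _ _ _ _

theorem Crossed.norm_liftHom_le {D : Type*} [NonUnitalNormedRing D] [NormedSpace ℂ D]
    [CompleteSpace D] (T : C_c(H, B) →ₗ[ℂ] D) (hT : ∀ f, ‖T f‖ ≤ universalNorm p μ α f)
    (hmul : ∀ f g, T (convolution μ α f g) = T f * T g) (x : Crossed p μ α) :
    ‖Crossed.liftHom T hT hmul x‖ ≤ ‖x‖ :=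
  (Crossed.norm_lift_le T 1 _ x).trans_eq (one_mul _)

theorem Crossed.continuous_liftHom {D : Type*} [NonUnitalNormedRing D] [NormedSpace ℂ D]
    [CompleteSpace D] (T : C_c(H, B) →ₗ[ℂ] D) (hT : ∀ f, ‖T f‖ ≤ universalNorm p μ α f)
    (hmul : ∀ f g, T (convolution μ α f g) = T f * T g) :
    Continuous (Crossed.liftHom T hT hmul) :=
  (Crossed.lift T 1 _).continuous

end Algebra

/-! ### Functoriality, twisting by characters, and the dual action -/

section Functoriality

variable {H B B' : Type u} [Group H] [TopologicalSpace H] [IsTopologicalGroup H]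
  [MeasurableSpace H] [BorelSpace H]
  [NonUnitalNormedRing B] [NormedSpace ℂ B] [IsScalarTower ℂ B B] [SMulCommClass ℂ B B]
  [CompleteSpace B]
  [NonUnitalNormedRing B'] [NormedSpace ℂ B'] [IsScalarTower ℂ B' B'] [SMulCommClass ℂ B' B']
  [CompleteSpace B']
  {p : ℝ≥0∞} [Fact (1 ≤ p)] {α : IsometricAction H B} {α' : IsometricAction H B'}

/-- A contractive equivariant homomorphism with dense range between dynamical systems. -/
structure EquivariantHom (α : IsometricAction H B) (α' : IsometricAction H B') where
  hom : B →ₙₐ[ℂ] B'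
  norm_hom_le : ∀ b, ‖hom b‖ ≤ ‖b‖
  denseRange_hom : DenseRange hom
  equivariant : ∀ s b, hom (α.act s b) = α'.act s (hom b)

theorem EquivariantHom.continuous_hom (θ : EquivariantHom α α') : Continuous θ.hom :=
  AddMonoidHomClass.continuous_of_bound θ.hom 1 fun b => by simpa using θ.norm_hom_le b

/-- The underlying continuous linear map. -/
def EquivariantHom.clm (θ : EquivariantHom α α') : B →L[ℂ] B' where
  toFun := θ.hom
  map_add' := map_add θ.hom
  map_smul' := fun c b => map_smul θ.hom c b
  cont := θ.continuous_hom

/-- Composition with an equivariant homomorphism, `f ↦ θ ∘ f`. -/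
def EquivariantHom.compCc (θ : EquivariantHom α α') : C_c(H, B) →ₗ[ℂ] C_c(H, B') where
  toFun f :=
    { toFun := fun s => θ.hom (f s)
      continuous_toFun := θ.continuous_hom.comp (map_continuous f)
      hasCompactSupport' := f.hasCompactSupport.comp_left (map_zero θ.hom) }
  map_add' f g := by ext s; exact map_add θ.hom (f s) (g s)
  map_smul' c f := by ext s; exact map_smul θ.hom c (f s)

theorem EquivariantHom.compCc_apply (θ : EquivariantHom α α') (f : C_c(H, B)) (s : H) :
    θ.compCc f s = θ.hom (f s) := rfl

/-- Restriction of a covariant representation along an equivariant homomorphism. -/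
def CovRep.comp (ρ : CovRep p α') (θ : EquivariantHom α α') : CovRep p α where
  X := ρ.X
  ν := ρ.ν
  π := ρ.π.comp θ.hom
  v := ρ.v
  norm_π_le b := (ρ.norm_π_le _).trans (θ.norm_hom_le b)
  nondegenerate := by
    have key : (Submodule.span ℂ {η | ∃ b ξ, η = ρ.π b ξ} : Set ρ.E) ⊆
        closure (Submodule.span ℂ {η | ∃ b ξ, η = (ρ.π.comp θ.hom) b ξ} : Set ρ.E) := by
      rw [← Submodule.topologicalClosure_coe]
      refine Submodule.span_le.2 ?_
      rintro _ ⟨b, ξ, rfl⟩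
      have hc : Continuous fun b => ρ.π b ξ := ρ.continuous_π.clm_apply continuous_const
      refine θ.denseRange_hom.induction_on (p := fun b => ρ.π b ξ ∈ _) b
        ((Submodule.isClosed_topologicalClosure _).preimage hc) fun b => ?_
      exact Submodule.le_topologicalClosure _ (Submodule.subset_span ⟨b, ξ, rfl⟩)
    exact dense_closure.1 (ρ.nondegenerate.mono key)
  norm_v := ρ.norm_v
  continuous_v := ρ.continuous_v
  covariant t b := by
    change _ = ρ.π (θ.hom (α.act t b))
    rw [θ.equivariant]
    exact ρ.covariant t _

variable {μ : Measure H} [IsFiniteMeasureOnCompacts μ]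

theorem EquivariantHom.universalNorm_compCc_le (θ : EquivariantHom α α') (f : C_c(H, B)) :
    universalNorm p μ α' (θ.compCc f) ≤ universalNorm p μ α f :=
  universalNorm_le (universalNorm_nonneg p μ α f) fun ρ =>
    (ρ.comp θ).norm_integrated_le_universalNorm μ f

theorem EquivariantHom.compCc_convolution (θ : EquivariantHom α α') (f g : C_c(H, B)) :
    θ.compCc (convolution μ α f g) = convolution μ α' (θ.compCc f) (θ.compCc g) := by
  ext t
  rw [compCc_apply, convolution_apply, convolution_apply]
  refine (θ.clm.integral_comp_comm (integrable_convolution μ α f g t)).symm.trans ?_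
  refine integral_congr_ae (Filter.Eventually.of_forall fun s => ?_)
  change θ.hom (f s * α.act s (g (s⁻¹ * t))) = _
  rw [map_mul, θ.equivariant]
  rfl

variable [μ.IsMulLeftInvariant]

/-- The homomorphism `θ ⋊ id : F^p(H, B, α) → F^p(H, B', α')` induced by an equivariant
homomorphism `θ`; it is given on `C_c(H, B)` by `f ↦ θ ∘ f`. -/
def Crossed.map (p : ℝ≥0∞) [Fact (1 ≤ p)] (μ : Measure H) [IsFiniteMeasureOnCompacts μ]
    [μ.IsMulLeftInvariant] (θ : EquivariantHom α α') : Crossed p μ α →ₙₐ[ℂ] Crossed p μ α' :=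
  Crossed.liftHom (Crossed.of p μ α' ∘ₗ θ.compCc)
    (fun f => (Crossed.norm_of _).le.trans (θ.universalNorm_compCc_le f))
    (fun f g => by
      simp only [LinearMap.comp_apply, Crossed.of_mul_of, θ.compCc_convolution (μ := μ)])

theorem Crossed.map_of (θ : EquivariantHom α α') (f : C_c(H, B)) :
    Crossed.map p μ θ (Crossed.of p μ α f) = Crossed.of p μ α' (θ.compCc f) :=
  Crossed.liftHom_of _ _ _ _

theorem Crossed.norm_map_le (θ : EquivariantHom α α') (x : Crossed p μ α) :
    ‖Crossed.map p μ θ x‖ ≤ ‖x‖ :=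
  Crossed.norm_liftHom_le _ _ _ x

theorem Crossed.continuous_map (θ : EquivariantHom α α') : Continuous (Crossed.map p μ θ) :=
  Crossed.continuous_liftHom _ _ _

/-! #### Twisting by characters -/

/-- Multiplication by a conjugate character, `f ↦ (s ↦ conj (χ s) • f s)`. -/
def twistCc (χ : PontryaginDual H) : C_c(H, B) →ₗ[ℂ] C_c(H, B) where
  toFun f :=
    { toFun := fun s => (starRingEnd ℂ (χ s : ℂ)) • f s
      continuous_toFun := by
        have h1 : Continuous χ := map_continuous χ
        have h2 : Continuous f := map_continuous f
        fun_prop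
      hasCompactSupport' := f.hasCompactSupport.smul_left }
  map_add' f g := by ext s; exact smul_add _ (f s) (g s)
  map_smul' c f := by ext s; exact smul_comm _ c (f s)

theorem twistCc_apply (χ : PontryaginDual H) (f : C_c(H, B)) (s : H) :
    twistCc χ f s = (starRingEnd ℂ (χ s : ℂ)) • f s := rfl

/-- Multiply the group representation of a covariant representation by a conjugate character. -/
def CovRep.twist (ρ : CovRep p α) (χ : PontryaginDual H) : CovRep p α where
  X := ρ.X
  ν := ρ.ν
  π := ρ.π
  v :=
    { toFun := fun s => (starRingEnd ℂ (χ s : ℂ)) • ρ.v s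
      map_one' := by simp
      map_mul' := fun s t => by
        rw [map_mul, map_mul, Circle.coe_mul, map_mul, smul_mul_smul_comm] }
  norm_π_le := ρ.norm_π_le
  nondegenerate := ρ.nondegenerate
  norm_v s ξ := by
    change ‖(starRingEnd ℂ (χ s : ℂ)) • ρ.v s ξ‖ = ‖ξ‖
    rw [norm_smul, ρ.norm_v, RCLike.norm_conj, Circle.norm_coe, one_mul]
  continuous_v ξ := by
    have h1 : Continuous χ := map_continuous χ
    have h2 := ρ.continuous_v ξ
    change Continuous fun s => (starRingEnd ℂ (χ s : ℂ)) • ρ.v s ξ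
    fun_prop
  covariant t b := by
    change ((starRingEnd ℂ (χ t : ℂ)) • ρ.v t) * ρ.π b *
      ((starRingEnd ℂ (χ t⁻¹ : ℂ)) • ρ.v t⁻¹) = _
    rw [smul_mul_assoc, smul_mul_smul_comm, ρ.covariant, ← map_mul, ← Circle.coe_mul, ← map_mul]
    simp

theorem CovRep.integrated_twistCc (ρ : CovRep p α) (χ : PontryaginDual H) (f : C_c(H, B)) :
    ρ.integrated μ (twistCc χ f) = (ρ.twist χ).integrated μ f := by
  ext1 ξ
  change ∫ s, ρ.π ((starRingEnd ℂ (χ s : ℂ)) • f s) (ρ.v s ξ) ∂μ =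
    ∫ s, ρ.π (f s) ((starRingEnd ℂ (χ s : ℂ)) • ρ.v s ξ) ∂μ
  simp

theorem universalNorm_twistCc_le (χ : PontryaginDual H) (f : C_c(H, B)) :
    universalNorm p μ α (twistCc χ f) ≤ universalNorm p μ α f :=
  universalNorm_le (universalNorm_nonneg p μ α f) fun ρ => by
    rw [ρ.integrated_twistCc]
    exact (ρ.twist χ).norm_integrated_le_universalNorm μ f

theorem twistCc_convolution (χ : PontryaginDual H) (f g : C_c(H, B)) :
    twistCc χ (convolution μ α f g) = convolution μ α (twistCc χ f) (twistCc χ g) := by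
  ext t
  rw [twistCc_apply, convolution_apply, convolution_apply, ← integral_smul]
  refine integral_congr_ae (Filter.Eventually.of_forall fun s => ?_)
  change _ = ((starRingEnd ℂ (χ s : ℂ)) • f s) *
    α.act s ((starRingEnd ℂ (χ (s⁻¹ * t) : ℂ)) • g (s⁻¹ * t))
  rw [map_smul, smul_mul_smul_comm, ← map_mul, ← Circle.coe_mul, ← map_mul, mul_inv_cancel_left]

/-- The automorphism of `F^p(H, B, α)` given on `C_c(H, B)` by multiplication by the conjugate
of a character. -/
def Crossed.twist (p : ℝ≥0∞) [Fact (1 ≤ p)] (μ : Measure H) [IsFiniteMeasureOnCompacts μ]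
    [μ.IsMulLeftInvariant] (α : IsometricAction H B) (χ : PontryaginDual H) :
    Crossed p μ α →ₙₐ[ℂ] Crossed p μ α :=
  Crossed.liftHom (Crossed.of p μ α ∘ₗ twistCc χ)
    (fun f => (Crossed.norm_of _).le.trans (universalNorm_twistCc_le χ f))
    (fun f g => by
      simp only [LinearMap.comp_apply, Crossed.of_mul_of, twistCc_convolution (μ := μ) (α := α)])

theorem Crossed.twist_of (χ : PontryaginDual H) (f : C_c(H, B)) :
    Crossed.twist p μ α χ (Crossed.of p μ α f) = Crossed.of p μ α (twistCc χ f) :=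
  Crossed.liftHom_of _ _ _ _

theorem Crossed.norm_twist_le (χ : PontryaginDual H) (x : Crossed p μ α) :
    ‖Crossed.twist p μ α χ x‖ ≤ ‖x‖ :=
  Crossed.norm_liftHom_le _ _ _ x

theorem Crossed.continuous_twist (χ : PontryaginDual H) :
    Continuous (Crossed.twist p μ α χ) :=
  Crossed.continuous_liftHom _ _ _

theorem Crossed.twist_one (x : Crossed p μ α) : Crossed.twist p μ α 1 x = x := by
  induction x using Crossed.induction_on with
  | hc => exact isClosed_eq (Crossed.continuous_twist 1) continuous_id
  | h f =>
    rw [Crossed.twist_of]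
    congr 1
    ext s
    simp [twistCc_apply]

theorem Crossed.twist_mul (χ ψ : PontryaginDual H) (x : Crossed p μ α) :
    Crossed.twist p μ α (χ * ψ) x = Crossed.twist p μ α χ (Crossed.twist p μ α ψ x) := by
  induction x using Crossed.induction_on with
  | hc =>
    exact isClosed_eq (Crossed.continuous_twist _)
      ((Crossed.continuous_twist χ).comp (Crossed.continuous_twist ψ))
  | h f =>
    rw [Crossed.twist_of, Crossed.twist_of, Crossed.twist_of]
    congr 1
    ext s
    have : (χ * ψ) s = χ s * ψ s := rfl
    simp only [twistCc_apply, this, Circle.coe_mul, map_mul, mul_smul]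

/-- A family of contractions which is pointwise continuous on `C_c(H, B)` is pointwise continuous
on the completion. -/
theorem Crossed.continuous_of_dense {Y : Type*} [TopologicalSpace Y]
    (T : Y → Crossed p μ α →ₙₐ[ℂ] Crossed p μ α) (hT : ∀ y x, ‖T y x‖ ≤ ‖x‖)
    (h : ∀ f, Continuous fun y => T y (Crossed.of p μ α f)) (x : Crossed p μ α) :
    Continuous fun y => T y x := by
  refine continuous_of_uniform_approx_of_continuous fun V hV => ?_
  obtain ⟨ε, hε, hV⟩ := Metric.mem_uniformity_dist.1 hV
  obtain ⟨f, hf⟩ := Crossed.denseRange_of.exists_dist_lt x hε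
  refine ⟨_, h f, fun y => hV ?_⟩
  rw [dist_eq_norm, ← map_sub]
  exact (hT y _).trans_lt (by rwa [← dist_eq_norm])

/-- A homomorphic family of contractive endomorphisms of `F^p(H, B, α)` acts isometrically. -/
theorem Crossed.norm_eq_of_group {K : Type*} [Group K]
    (T : K → Crossed p μ α →ₙₐ[ℂ] Crossed p μ α) (hT : ∀ k x, ‖T k x‖ ≤ ‖x‖)
    (h1 : ∀ x, T 1 x = x) (hm : ∀ k l x, T (k * l) x = T k (T l x)) (k : K)
    (x : Crossed p μ α) : ‖T k x‖ = ‖x‖ := by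
  refine le_antisymm (hT k x) ?_
  conv_lhs => rw [← h1 x, ← inv_mul_cancel k, hm]
  exact hT _ _

theorem Crossed.continuous_twist_of [LocallyCompactSpace H] (f : C_c(H, B)) :
    Continuous fun γ : PontryaginDual H => Crossed.twist p μ α γ (Crossed.of p μ α f) := by
  rw [continuous_iff_continuousAt]
  intro γ₀
  rw [ContinuousAt, tendsto_iff_norm_sub_tendsto_zero]
  have hb : ∀ γ : PontryaginDual H,
      ‖Crossed.twist p μ α γ (Crossed.of p μ α f) -
        Crossed.twist p μ α γ₀ (Crossed.of p μ α f)‖ ≤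
      ∫ s, ‖(starRingEnd ℂ (γ s : ℂ)) • f s - (starRingEnd ℂ (γ₀ s : ℂ)) • f s‖ ∂μ := by
    intro γ
    rw [Crossed.twist_of, Crossed.twist_of, ← map_sub]
    exact Crossed.norm_of_le _
  have hcont : Continuous fun γ : PontryaginDual H =>
      ∫ s, ‖(starRingEnd ℂ (γ s : ℂ)) • f s - (starRingEnd ℂ (γ₀ s : ℂ)) • f s‖ ∂μ := by
    rw [← continuousOn_univ]
    refine continuousOn_integral_of_compact_support (k := tsupport f) f.hasCompactSupport ?_ ?_
    · have h1 : Continuous f := map_continuous f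
      have h2 : Continuous γ₀ := map_continuous γ₀
      have h3 := continuous_dual_eval (H := H)
      have hcoe : Continuous fun z : Circle => (z : ℂ) := by fun_prop
      refine Continuous.continuousOn ?_
      refine Continuous.norm (Continuous.sub ?_ ?_)
      · exact (Complex.continuous_conj.comp (hcoe.comp h3)).smul
          (h1.comp continuous_snd)
      · exact (Complex.continuous_conj.comp (hcoe.comp
          (h2.comp continuous_snd))).smul (h1.comp continuous_snd)
    · intro γ s _ hs
      simp [image_eq_zero_of_notMem_tsupport hs]
  have := hcont.tendsto γ₀
  simp only [sub_self, norm_zero, integral_zero] at this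
  exact squeeze_zero (fun _ => norm_nonneg _) hb this

/-- The dual action `α̂` of the dual group `Ĥ` on `F^p(H, B, α)`, given on `C_c(H, B)` by
`α̂_γ(f)(s) = conj (γ s) • f s`. -/
def dualAction (p : ℝ≥0∞) [Fact (1 ≤ p)] {H : Type u} [CommGroup H] [TopologicalSpace H]
    [IsTopologicalGroup H] [LocallyCompactSpace H] [MeasurableSpace H] [BorelSpace H]
    (μ : Measure H) [IsFiniteMeasureOnCompacts μ] [μ.IsMulLeftInvariant]
    (α : IsometricAction H B) : IsometricAction (PontryaginDual H) (Crossed p μ α) where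
  act := Crossed.twist p μ α
  act_one := Crossed.twist_one
  act_mul := Crossed.twist_mul
  norm_act := Crossed.norm_eq_of_group _ Crossed.norm_twist_le Crossed.twist_one
    Crossed.twist_mul
  continuous_act := Crossed.continuous_of_dense _ Crossed.norm_twist_le
    Crossed.continuous_twist_of

theorem dualAction_of {H : Type u} [CommGroup H] [TopologicalSpace H]
    [IsTopologicalGroup H] [LocallyCompactSpace H] [MeasurableSpace H] [BorelSpace H]
    (μ : Measure H) [IsFiniteMeasureOnCompacts μ] [μ.IsMulLeftInvariant]
    (α : IsometricAction H B) (γ : PontryaginDual H) (f : C_c(H, B)) :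
    (dualAction p μ α).act γ (Crossed.of p μ α f) = Crossed.of p μ α (twistCc γ f) :=
  Crossed.twist_of γ f

end Functoriality

/-! ### The concrete dynamical systems -/

/-- Pull back an action along a continuous homomorphism. -/
def IsometricAction.comap {K H B : Type u} [Group K] [TopologicalSpace K] [Group H]
    [TopologicalSpace H] [NonUnitalNormedRing B] [NormedSpace ℂ B]
    (α : IsometricAction H B) (e : K →ₜ* H) : IsometricAction K B where
  act k := α.act (e k)
  act_one b := by rw [map_one, α.act_one]
  act_mul s t b := by rw [map_mul, α.act_mul]
  norm_act s b := α.norm_act _ b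
  continuous_act b := (α.continuous_act b).comp (map_continuous e)

instance isFiniteMeasureOnCompacts_count {G : Type u} [TopologicalSpace G] [DiscreteTopology G]
    [MeasurableSpace G] [BorelSpace G] :
    IsFiniteMeasureOnCompacts (Measure.count : Measure G) where
  lt_top_of_isCompact _ hK := Measure.count_apply_lt_top.2 hK.finite_of_discrete

section Concrete

variable {G A : Type u} [CommGroup G] [TopologicalSpace G] [IsTopologicalGroup G]
  [DiscreteTopology G] [NormedRing A] [NormedAlgebra ℂ A] [CompleteSpace A]

/-- The character `γ ↦ γ(s)` of `Ĝ` defined by `s ∈ G`. -/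
def evalChar (s : G) : PontryaginDual (PontryaginDual G) :=
  ({ toFun := fun γ => γ s
     map_one' := rfl
     map_mul' := fun _ _ => rfl
     continuous_toFun :=
      (continuous_dual_eval (H := G)).comp (continuous_id.prodMk continuous_const) } :
    PontryaginDual G →ₜ* Circle)

theorem evalChar_apply (s : G) (γ : PontryaginDual G) : evalChar s γ = γ s := rfl

/-- The canonical homomorphism from the discrete group `G` to its double dual. -/
def evalHom (G : Type u) [CommGroup G] [TopologicalSpace G] [IsTopologicalGroup G]
    [DiscreteTopology G] : G →ₜ* PontryaginDual (PontryaginDual G) where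
  toFun := evalChar
  map_one' := PontryaginDual.ext fun γ => map_one γ
  map_mul' s t := PontryaginDual.ext fun γ => map_mul γ s t
  continuous_toFun := continuous_of_discreteTopology

/-- The endomorphism `f ↦ (t ↦ θ (f (σ t)))` of `C_0(G, A)`. -/
def c0Map (σ : G ≃ₜ G) (θ : A →ₙₐ[ℂ] A) (hθ : ∀ a, ‖θ a‖ = ‖a‖) :
    C₀(G, A) →ₙₐ[ℂ] C₀(G, A) where
  toFun f :=
    { toFun := fun t => θ (f (σ t))
      continuous_toFun := continuous_of_discreteTopology
      zero_at_infty' := by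
        refine squeeze_zero_norm (a := fun t => ‖f (σ t)‖) (fun t => (hθ _).le) ?_
        have := (f.zero_at_infty'.comp σ.isClosedEmbedding.tendsto_cocompact).norm
        simpa using this }
  map_smul' c f := by ext t; exact map_smul θ c (f (σ t))
  map_zero' := by ext t; exact map_zero θ
  map_add' f g := by ext t; exact map_add θ (f (σ t)) (g (σ t))
  map_mul' f g := by ext t; exact map_mul θ (f (σ t)) (g (σ t))

theorem c0Map_apply (σ : G ≃ₜ G) (θ : A →ₙₐ[ℂ] A) (hθ : ∀ a, ‖θ a‖ = ‖a‖) (f : C₀(G, A))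
    (t : G) : c0Map σ θ hθ f t = θ (f (σ t)) := rfl

theorem norm_c0Map (σ : G ≃ₜ G) (θ : A →ₙₐ[ℂ] A) (hθ : ∀ a, ‖θ a‖ = ‖a‖) (f : C₀(G, A)) :
    ‖c0Map σ θ hθ f‖ = ‖f‖ := by
  refine le_antisymm ?_ ?_
  · rw [← ZeroAtInftyContinuousMap.norm_toBCF_eq_norm]
    refine (BoundedContinuousFunction.norm_le (norm_nonneg _)).2 fun t => ?_
    change ‖θ (f (σ t))‖ ≤ _
    rw [hθ, ← ZeroAtInftyContinuousMap.norm_toBCF_eq_norm]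
    exact f.toBCF.norm_coe_le_norm (σ t)
  · conv_lhs => rw [← ZeroAtInftyContinuousMap.norm_toBCF_eq_norm]
    refine (BoundedContinuousFunction.norm_le (norm_nonneg _)).2 fun t => ?_
    change ‖f t‖ ≤ _
    have h := (c0Map σ θ hθ f).toBCF.norm_coe_le_norm (σ.symm t)
    change ‖θ (f (σ (σ.symm t)))‖ ≤ _ at h
    rwa [hθ, σ.apply_symm_apply, ZeroAtInftyContinuousMap.norm_toBCF_eq_norm] at h

/-- The action `lt ⊗ α` of `G` on `C_0(G, A)`: `(lt ⊗ α)_s f(t) = α_s(f(s⁻¹ t))`. For the trivial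
action `α` this is `lt ⊗ id`. -/
def ltTensor (α : IsometricAction G A) : IsometricAction G C₀(G, A) where
  act s := c0Map (Homeomorph.mulLeft s⁻¹) (α.act s) (α.norm_act s)
  act_one f := by ext t; simp [c0Map_apply, α.act_one]
  act_mul s r f := by ext t; simp [c0Map_apply, α.act_mul, mul_assoc]
  norm_act s f := norm_c0Map _ _ _ f
  continuous_act f := continuous_of_discreteTopology

theorem ltTensor_apply (α : IsometricAction G A) (s : G) (f : C₀(G, A)) (t : G) :
    (ltTensor α).act s f t = α.act s (f (s⁻¹ * t)) := rfl

/-- The action `rt ⊗ α` of `G` on `C_0(G, A)`: `(rt ⊗ α)_r f(t) = α_r(f(t r))`. -/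
def rtTensor (α : IsometricAction G A) : IsometricAction G C₀(G, A) where
  act r := c0Map (Homeomorph.mulRight r) (α.act r) (α.norm_act r)
  act_one f := by ext t; simp [c0Map_apply, α.act_one]
  act_mul s r f := by
    ext t
    simp [c0Map_apply, α.act_mul, mul_assoc]
  norm_act s f := norm_c0Map _ _ _ f
  continuous_act f := continuous_of_discreteTopology

theorem rtTensor_apply (α : IsometricAction G A) (r : G) (f : C₀(G, A)) (t : G) :
    (rtTensor α).act r f t = α.act r (f (t * r)) := rfl

variable [MeasurableSpace G] [BorelSpace G]
  [MeasurableSpace (PontryaginDual G)] [BorelSpace (PontryaginDual G)]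
  {p : ℝ≥0∞} [Fact (1 ≤ p)] (μ : Measure (PontryaginDual G)) [IsFiniteMeasureOnCompacts μ]
  [μ.IsMulLeftInvariant] (α : IsometricAction G A)

/-- Each `α_s` is equivariant for the trivial action of `Ĝ` on `A`. -/
def actEquivariant (s : G) :
    EquivariantHom (trivialAction (PontryaginDual G) A) (trivialAction (PontryaginDual G) A) where
  hom := α.act s
  norm_hom_le a := (α.norm_act s a).le
  denseRange_hom := Function.Surjective.denseRange fun a => ⟨_, α.act_act_inv s a⟩
  equivariant _ _ := rfl

/-- Each `(rt ⊗ α)_r` is equivariant for the action `lt ⊗ id` of `G` on `C_0(G, A)`. -/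
def rtEquivariant (r : G) :
    EquivariantHom (ltTensor (trivialAction G A)) (ltTensor (trivialAction G A)) where
  hom := (rtTensor α).act r
  norm_hom_le a := ((rtTensor α).norm_act r a).le
  denseRange_hom := Function.Surjective.denseRange fun a => ⟨_, (rtTensor α).act_act_inv r a⟩
  equivariant s f := by
    ext t
    rw [rtTensor_apply, ltTensor_apply, ltTensor_apply, rtTensor_apply, mul_assoc]
    rfl

/-- The automorphism `(β̂ ⊗ α)_s` of `F^p(Ĝ, A, β)`, `β` being the trivial action. -/
def dualTensorMap (p : ℝ≥0∞) [Fact (1 ≤ p)] (s : G) :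
    Crossed p μ (trivialAction (PontryaginDual G) A) →ₙₐ[ℂ]
      Crossed p μ (trivialAction (PontryaginDual G) A) :=
  (Crossed.map p μ (actEquivariant α s)).comp (Crossed.twist p μ _ (evalChar s⁻¹))

theorem dualTensorMap_of (s : G) (φ : C_c(PontryaginDual G, A)) :
    dualTensorMap μ α p s (Crossed.of p μ _ φ) =
      Crossed.of p μ _ ((actEquivariant α s).compCc (twistCc (evalChar s⁻¹) φ)) := by
  change Crossed.map p μ _ (Crossed.twist p μ _ _ _) = _
  rw [Crossed.twist_of, Crossed.map_of]

/-- On functions, `(β̂ ⊗ α)_s(φ)(γ) = γ(s) α_s(φ(γ))`. -/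
theorem dualTensor_formula (s : G) (φ : C_c(PontryaginDual G, A)) (γ : PontryaginDual G) :
    (actEquivariant α s).compCc (twistCc (evalChar s⁻¹) φ) γ =
      (γ s : ℂ) • α.act s (φ γ) := by
  rw [EquivariantHom.compCc_apply, twistCc_apply, evalChar_apply]
  change α.act s _ = _
  rw [map_smul, map_inv, Circle.coe_inv_eq_conj, Complex.conj_conj]

theorem norm_dualTensorMap_le (s : G)
    (x : Crossed p μ (trivialAction (PontryaginDual G) A)) : ‖dualTensorMap μ α p s x‖ ≤ ‖x‖ :=
  (Crossed.norm_map_le _ _).trans (Crossed.norm_twist_le _ _)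

theorem continuous_dualTensorMap (s : G) : Continuous (dualTensorMap μ α p s) :=
  (Crossed.continuous_map _).comp (Crossed.continuous_twist _)

theorem dualTensorMap_one (x : Crossed p μ (trivialAction (PontryaginDual G) A)) :
    dualTensorMap μ α p 1 x = x := by
  induction x using Crossed.induction_on with
  | hc => exact isClosed_eq (continuous_dualTensorMap μ α 1) continuous_id
  | h φ =>
    rw [dualTensorMap_of]
    congr 1
    ext γ
    rw [dualTensor_formula, α.act_one]
    simp

theorem dualTensorMap_mul (s t : G) (x : Crossed p μ (trivialAction (PontryaginDual G) A)) :
    dualTensorMap μ α p (s * t) x = dualTensorMap μ α p s (dualTensorMap μ α p t x) := by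
  induction x using Crossed.induction_on with
  | hc =>
    exact isClosed_eq (continuous_dualTensorMap μ α _)
      ((continuous_dualTensorMap μ α s).comp (continuous_dualTensorMap μ α t))
  | h φ =>
    rw [dualTensorMap_of, dualTensorMap_of, dualTensorMap_of]
    congr 1
    ext γ
    rw [dualTensor_formula, dualTensor_formula, dualTensor_formula, α.act_mul, map_mul,
      map_smul, Circle.coe_mul, mul_smul]

/-- The action `β̂ ⊗ α` of `G` on `F^p(Ĝ, A, β)`, where `β` is the trivial action of `Ĝ`, given
on functions by `(β̂ ⊗ α)_s(φ)(γ) = γ(s) α_s(φ(γ))`. -/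
def dualTensor (p : ℝ≥0∞) [Fact (1 ≤ p)] :
    IsometricAction G (Crossed p μ (trivialAction (PontryaginDual G) A)) where
  act := dualTensorMap μ α p
  act_one := dualTensorMap_one μ α
  act_mul := dualTensorMap_mul μ α
  norm_act := Crossed.norm_eq_of_group _ (norm_dualTensorMap_le μ α) (dualTensorMap_one μ α)
    (dualTensorMap_mul μ α)
  continuous_act _ := continuous_of_discreteTopology

/-- The action `(rt ⊗ α) ⊗ id` of `G` on `F^p(G, C_0(G, A), lt ⊗ id)`, given on functions by
`(((rt ⊗ α) ⊗ id)_r F)(s, t) = α_r(F(s, t r))`. -/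
def rtTensorId (p : ℝ≥0∞) [Fact (1 ≤ p)] :
    IsometricAction G (Crossed p (Measure.count : Measure G) (ltTensor (trivialAction G A))) where
  act r := Crossed.map p Measure.count (rtEquivariant α r)
  act_one x := by
    induction x using Crossed.induction_on with
    | hc => exact isClosed_eq (Crossed.continuous_map _) continuous_id
    | h f =>
      rw [Crossed.map_of]
      congr 1
      ext s : 1
      exact (rtTensor α).act_one (f s)
  act_mul r r' x := by
    induction x using Crossed.induction_on with
    | hc =>
      exact isClosed_eq (Crossed.continuous_map _)
        ((Crossed.continuous_map _).comp (Crossed.continuous_map _))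
    | h f =>
      rw [Crossed.map_of, Crossed.map_of, Crossed.map_of]
      congr 1
      ext s : 1
      exact (rtTensor α).act_mul r r' (f s)
  norm_act r x := by
    refine le_antisymm (Crossed.norm_map_le _ x) ?_
    have key : Crossed.map p Measure.count (rtEquivariant α r⁻¹)
        (Crossed.map p Measure.count (rtEquivariant α r) x) = x := by
      induction x using Crossed.induction_on with
      | hc =>
        exact isClosed_eq ((Crossed.continuous_map _).comp (Crossed.continuous_map _))
          continuous_id
      | h f =>
        rw [Crossed.map_of, Crossed.map_of]
        congr 1
        ext s : 1
        exact (rtTensor α).act_inv_act r (f s)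
    conv_lhs => rw [← key]
    exact Crossed.norm_map_le _ _
  continuous_act _ := continuous_of_discreteTopology

/-- On functions, `(((rt ⊗ α) ⊗ id)_r F)(s, t) = α_r(F(s, t r))`. -/
theorem rtTensorId_formula (r s t : G) (F : C_c(G, C₀(G, A))) :
    (rtEquivariant α r).compCc F s t = α.act r (F s (t * r)) := rfl

/-- The double dual action of `G` on `F^p(Ĝ, F^p(G, A, α), α̂)`: the dual action of the dual of
`Ĝ`, where `t ∈ G` is identified with the character `γ ↦ γ(t)` of `Ĝ`. On functions it is
`(α̂̂_t F)(γ, s) = conj (γ t) • F(γ, s)`. -/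
def doubleDualAction (p : ℝ≥0∞) [Fact (1 ≤ p)] :
    IsometricAction G (Crossed p μ (dualAction p (Measure.count : Measure G) α)) :=
  (dualAction p μ (dualAction p Measure.count α)).comap (evalHom G)

theorem doubleDualAction_of (t : G)
    (F : C_c(PontryaginDual G, Crossed p (Measure.count : Measure G) α)) :
    (doubleDualAction μ α p).act t (Crossed.of p μ _ F) =
      Crossed.of p μ _ (twistCc (evalChar t) F) :=
  Crossed.twist_of _ F

end Concrete

/-! ### Functions of two variables in iterated crossed products -/

section Curry

variable {Y H B : Type u} [TopologicalSpace Y] [R1Space Y] [Group H] [TopologicalSpace H]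
  [IsTopologicalGroup H] [MeasurableSpace H] [BorelSpace H]
  [NonUnitalNormedRing B] [NormedSpace ℂ B] [IsScalarTower ℂ B B] [SMulCommClass ℂ B B]
  [CompleteSpace B]

/-- The slice `F(y, ·)` of a compactly supported function of two variables. -/
def slice (F : C_c(Y × H, B)) (y : Y) : C_c(H, B) where
  toFun s := F (y, s)
  continuous_toFun := (map_continuous F).comp (continuous_const.prodMk continuous_id)
  hasCompactSupport' :=
    HasCompactSupport.intro (F.hasCompactSupport.isCompact.image continuous_snd) fun _ hs =>
      image_eq_zero_of_notMem_tsupport fun h => hs ⟨_, h, rfl⟩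

theorem slice_apply (F : C_c(Y × H, B)) (y : Y) (s : H) : slice F y s = F (y, s) := rfl

/-- A function `F ∈ C_c(Y × H, B)` viewed as the element `y ↦ F(y, ·)` of
`C_c(Y, F^p(H, B, α))`. -/
def curryCc (p : ℝ≥0∞) [Fact (1 ≤ p)] (μ : Measure H) [IsFiniteMeasureOnCompacts μ]
    (α : IsometricAction H B) (F : C_c(Y × H, B)) : C_c(Y, Crossed p μ α) where
  toFun y := Crossed.of p μ α (slice F y)
  continuous_toFun := by
    rw [continuous_iff_continuousAt]
    intro y₀
    rw [ContinuousAt, tendsto_iff_norm_sub_tendsto_zero]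
    have hb : ∀ y, ‖Crossed.of p μ α (slice F y) - Crossed.of p μ α (slice F y₀)‖ ≤
        ∫ s, ‖F (y, s) - F (y₀, s)‖ ∂μ := by
      intro y
      rw [← map_sub]
      exact Crossed.norm_of_le _
    have hcont : Continuous fun y => ∫ s, ‖F (y, s) - F (y₀, s)‖ ∂μ := by
      rw [← continuousOn_univ]
      refine continuousOn_integral_of_compact_support (k := Prod.snd '' tsupport F)
        (F.hasCompactSupport.isCompact.image continuous_snd) ?_ ?_
      · have h1 : Continuous F := map_continuous F
        refine Continuous.continuousOn ?_
        exact (Continuous.sub h1 (h1.comp (continuous_const.prodMk continuous_snd))).norm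
      · intro y s _ hs
        have h0 : ∀ z, F (z, s) = 0 := fun z =>
          image_eq_zero_of_notMem_tsupport fun h => hs ⟨_, h, rfl⟩
        simp [h0]
    have := hcont.tendsto y₀
    simp only [sub_self, norm_zero, integral_zero] at this
    exact squeeze_zero (fun _ => norm_nonneg _) hb this
  hasCompactSupport' := by
    refine HasCompactSupport.intro (F.hasCompactSupport.isCompact.image continuous_fst)
      fun y hy => ?_
    have : slice F y = 0 := by
      ext s
      exact image_eq_zero_of_notMem_tsupport (x := (y, s)) fun h => hy ⟨(y, s), h, rfl⟩
    rw [this, map_zero]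

theorem curryCc_apply (p : ℝ≥0∞) [Fact (1 ≤ p)] (μ : Measure H) [IsFiniteMeasureOnCompacts μ]
    (α : IsometricAction H B) (F : C_c(Y × H, B)) (y : Y) :
    curryCc p μ α F y = Crossed.of p μ α (slice F y) := rfl

end Curry

/-! ### The maps `Φ₁`, `Φ₂`, `Φ₃` -/

section Phi

variable {G A : Type u} [CommGroup G] [TopologicalSpace G] [IsTopologicalGroup G]
  [DiscreteTopology G] [NormedRing A] [NormedAlgebra ℂ A] [CompleteSpace A]
  [MeasurableSpace G] [BorelSpace G]
  [MeasurableSpace (PontryaginDual G)] [BorelSpace (PontryaginDual G)]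
  {p : ℝ≥0∞} [Fact (1 ≤ p)] {μ : Measure (PontryaginDual G)} [IsFiniteMeasureOnCompacts μ]
  [μ.IsMulLeftInvariant] {α : IsometricAction G A}

/-- `Φ₁ : F^p(Ĝ, F^p(G, A, α), α̂) → F^p(G, F^p(Ĝ, A, β), β̂ ⊗ α)` is the continuous homomorphism
given by `Φ₁(F)(s, γ) = γ(s) F(γ, s)` for `F ∈ C_c(Ĝ × G, A)`. -/
structure IsPhi₁ (Φ : Crossed p μ (dualAction p (Measure.count : Measure G) α) →ₙₐ[ℂ]
    Crossed p (Measure.count : Measure G) (dualTensor μ α p)) : Prop where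
  continuous : Continuous Φ
  formula : ∀ F : C_c(PontryaginDual G × G, A), ∃ F' : C_c(G × PontryaginDual G, A),
    (∀ s γ, F' (s, γ) = (γ s : ℂ) • F (γ, s)) ∧
    Φ (Crossed.of p μ _ (curryCc p Measure.count α F)) =
      Crossed.of p Measure.count _ (curryCc p μ (trivialAction (PontryaginDual G) A) F')

/-- `Φ₂ : F^p(G, F^p(Ĝ, A, β), β̂ ⊗ α) → F^p(G, C_0(G, A), lt ⊗ α)` is the continuous homomorphism
given by `Φ₂(F)(s, t) = ∫ F(s, γ) conj(γ(t)) dμ(γ)` for `F ∈ C_c(G × Ĝ, A)`. -/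
structure IsPhi₂ (Φ : Crossed p (Measure.count : Measure G) (dualTensor μ α p) →ₙₐ[ℂ]
    Crossed p (Measure.count : Measure G) (ltTensor α)) : Prop where
  continuous : Continuous Φ
  formula : ∀ F : C_c(G × PontryaginDual G, A), ∃ F' : C_c(G, C₀(G, A)),
    (∀ s t, F' s t = ∫ γ, (starRingEnd ℂ (γ t : ℂ)) • F (s, γ) ∂μ) ∧
    Φ (Crossed.of p Measure.count _ (curryCc p μ (trivialAction (PontryaginDual G) A) F)) =
      Crossed.of p Measure.count _ F'

/-- `Φ₃ : F^p(G, C_0(G, A), lt ⊗ α) → F^p(G, C_0(G, A), lt ⊗ id)` is the continuous homomorphism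
given by `Φ₃(F)(s, t) = α_t⁻¹(F(s, t))` for `F ∈ C_c(G, C_0(G, A))`. -/
structure IsPhi₃ (Φ : Crossed p (Measure.count : Measure G) (ltTensor α) →ₙₐ[ℂ]
    Crossed p (Measure.count : Measure G) (ltTensor (trivialAction G A))) : Prop where
  continuous : Continuous Φ
  formula : ∀ F : C_c(G, C₀(G, A)), ∃ F' : C_c(G, C₀(G, A)),
    (∀ s t, F' s t = α.act t⁻¹ (F s t)) ∧
    Φ (Crossed.of p Measure.count _ F) = Crossed.of p Measure.count _ F'

end Phi

/-! ### `L^p` operator algebras and unique matrix norms -/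

/-- `A` is an `L^p` operator algebra: it has an isometric representation on some `L^p` space. -/
def IsLpOperatorAlgebra (p : ℝ≥0∞) [Fact (1 ≤ p)] (A : Type u) [NormedRing A]
    [NormedAlgebra ℂ A] : Prop :=
  ∃ (X : Type u) (_ : MeasurableSpace X) (ν : Measure X)
    (π : A →ₙₐ[ℂ] (Lp ℂ p ν →L[ℂ] Lp ℂ p ν)), ∀ a, ‖π a‖ = ‖a‖

/-- A matrix of operators on a Banach space `E` acting on the `ℓ^p` direct sum of `n` copies of
`E`. For `E = L^p(X, ν)` this sum is `L^p({1, …, n} × X)`, with counting measure on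
`{1, …, n}`. -/
def matrixOperator (p : ℝ≥0∞) [Fact (1 ≤ p)] {E : Type u} [NormedAddCommGroup E]
    [NormedSpace ℂ E] {n : ℕ} (T : Matrix (Fin n) (Fin n) (E →L[ℂ] E)) :
    PiLp p (fun _ : Fin n => E) →L[ℂ] PiLp p (fun _ : Fin n => E) :=
  ((PiLp.continuousLinearEquiv p ℂ (fun _ : Fin n => E)).symm :
      (Fin n → E) →L[ℂ] PiLp p (fun _ : Fin n => E)) ∘L
    (ContinuousLinearMap.pi fun i => ∑ j, (T i j) ∘L ContinuousLinearMap.proj j) ∘L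
    (PiLp.continuousLinearEquiv p ℂ (fun _ : Fin n => E) :
      PiLp p (fun _ : Fin n => E) →L[ℂ] (Fin n → E))

theorem matrixOperator_apply (p : ℝ≥0∞) [Fact (1 ≤ p)] {E : Type u} [NormedAddCommGroup E]
    [NormedSpace ℂ E] {n : ℕ} (T : Matrix (Fin n) (Fin n) (E →L[ℂ] E))
    (ξ : PiLp p (fun _ : Fin n => E)) (i : Fin n) :
    matrixOperator p T ξ i = ∑ j, T i j (ξ j) := by
  simp [matrixOperator]

/-- `A` has unique `L^p` operator matrix norms: any two isometric representations on separable
`L^p` spaces of `σ`-finite measures induce the same norms on all matrix algebras over `A`. -/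
def HasUniqueLpMatrixNorms (p : ℝ≥0∞) [Fact (1 ≤ p)] (A : Type u) [NormedRing A]
    [NormedAlgebra ℂ A] : Prop :=
  ∀ (X Y : Type u) (_ : MeasurableSpace X) (_ : MeasurableSpace Y) (ν : Measure X)
    (κ : Measure Y) (_ : SigmaFinite ν) (_ : SigmaFinite κ)
    (_ : TopologicalSpace.SeparableSpace (Lp ℂ p ν))
    (_ : TopologicalSpace.SeparableSpace (Lp ℂ p κ))
    (π : A →ₙₐ[ℂ] (Lp ℂ p ν →L[ℂ] Lp ℂ p ν)) (σ : A →ₙₐ[ℂ] (Lp ℂ p κ →L[ℂ] Lp ℂ p κ)),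
    (∀ a, ‖π a‖ = ‖a‖) → (∀ a, ‖σ a‖ = ‖a‖) →
    ∀ (n : ℕ) (a : Matrix (Fin n) (Fin n) A),
      ‖matrixOperator p (a.map π)‖ = ‖matrixOperator p (a.map σ)‖

end LpCrossed

end

open LpCrossed

noncomputable section

set_option linter.unusedSectionVars false

namespace LpCrossed

/-! ### Extending nondegenerate representations to left multipliers -/

section Multiplier

variable {D E : Type*} [NonUnitalNormedRing D] [NormedSpace ℂ D]
  [NormedAddCommGroup E] [NormedSpace ℂ E]

/-! A full crossed product is normed by the integrated forms of covariant representations, so a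
homomorphism D₁ → D₂ between two of them can be built backwards. Attach to every covariant
representation ρ of the system behind D₂ a covariant representation ρ' of the system behind D₁ on
the same L^p space, in such a way that for each x in a dense subset of D₁ some y in D₂ satisfies
ρ'(x) = ρ(y) for all ρ at once. Then x ↦ y extends to a contractive homomorphism
(`exists_hom_of_compatible`). Neither boundedness nor multiplicativity has to be computed on
functions.

Passing from ρ to ρ' requires extending a nondegenerate representation π of a Banach algebra to its
left multipliers. Given a contractive left approximate unit (e), the extension of L is the strong
limit of π(L e) (`NondegenerateRep.exists_extension`). Such units exist in crossed products with
unital coefficients, ‖1‖ = 1 (normalised bump functions), and in C_0(G, A) (indicators of finite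
sets). A covariant pair of multipliers thereby becomes a covariant representation
(`MultiplierSystem.covRep`).

For Φ₁, let (Π, v) represent (G, F^p(Ĝ, A, β), β̂ ⊗ α). Extending Π to multipliers splits it into
commuting representations π of A and w of Ĝ, and covariance of v becomes v_s π(a) = π(α_s a) v_s
together with the Weyl relation v_s w_γ = γ(s) w_γ v_s. So (π, v) is covariant for α, and
conjugation by w_γ implements α̂_γ on π ⋊ v; hence (π ⋊ v, w) is covariant for α̂. Fubini exchanges
the two integrations and the Weyl relation produces the factor γ(s).

For Φ₂, constants from A and the functions t ↦ conj γ(t) are multipliers of C_0(G, A). A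
representation Π of C_0(G, A) therefore yields one of F^p(Ĝ, A, β), sending f to Π of its Fourier
transform. The transform vanishes at infinity by the Riemann–Lebesgue lemma and intertwines β̂ ⊗ α
with lt ⊗ α. Φ₃ is functoriality applied to the pointwise isomorphism given by α_t⁻¹ at t.

Uniqueness and equivariance are checked on functions; those of two variables are dense in the
iterated crossed products (`Crossed.denseRange_of_curryCc`). The composite sends F to α_t⁻¹ ∫
conj(γ(t)) γ(s) F(γ, s) dμ(γ). An extra factor conj(γ(r)) replaces t by tr in the character, and
α_t⁻¹ = α_r α_{tr}⁻¹ accounts for the rest. -/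

/-- A Banach algebra has a contractive left approximate unit. -/
def HasContractiveLeftApproxUnit (D : Type*) [NonUnitalNormedRing D] : Prop :=
  ∃ l : Filter D, l.NeBot ∧ (∀ᶠ e in l, ‖e‖ ≤ 1) ∧
    ∀ x, Filter.Tendsto (fun e => e * x) l (𝓝 x)

/-- A nondegenerate contractive representation of a Banach algebra on a Banach space. -/
structure NondegenerateRep (D E : Type*) [NonUnitalNormedRing D] [NormedSpace ℂ D]
    [NormedAddCommGroup E] [NormedSpace ℂ E] where
  hom : D →ₙₐ[ℂ] (E →L[ℂ] E)
  norm_hom_le : ∀ d, ‖hom d‖ ≤ ‖d‖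
  nondegenerate : Dense (Submodule.span ℂ {η | ∃ d ξ, η = hom d ξ} : Set E)

theorem NondegenerateRep.norm_apply_le (π : NondegenerateRep D E) (d : D) (ξ : E) :
    ‖π.hom d ξ‖ ≤ ‖d‖ * ‖ξ‖ :=
  (π.hom d).le_of_opNorm_le (π.norm_hom_le d) ξ

/-- A nondegenerate representation as a continuous linear map. -/
def NondegenerateRep.clm (π : NondegenerateRep D E) : D →L[ℂ] (E →L[ℂ] E) :=
  LinearMap.mkContinuous
    { toFun := π.hom
      map_add' := map_add π.hom
      map_smul' := fun c b => map_smul π.hom c b } 1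
    (fun b => by simpa using π.norm_hom_le b)

theorem NondegenerateRep.continuous_hom (π : NondegenerateRep D E) : Continuous π.hom :=
  π.clm.continuous

/-- A closed submodule containing all vectors `π(d) ξ` is everything. -/
theorem NondegenerateRep.mem_of_isClosed (π : NondegenerateRep D E) (S : Submodule ℂ E)
    (hS : IsClosed (S : Set E)) (h : ∀ d ξ, π.hom d ξ ∈ S) (ξ : E) : ξ ∈ S := by
  have h1 : (Submodule.span ℂ {η | ∃ d ξ, η = π.hom d ξ}) ≤ S :=
    Submodule.span_le.2 (by rintro _ ⟨d, ξ, rfl⟩; exact h d ξ)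
  have h2 := hS.closure_subset_iff.2 h1
  exact h2 (π.nondegenerate ξ)

/-- The equalizer of two operators is a closed subspace. Operator identities thus reduce to the
vectors π(d)ξ, where extended multipliers act explicitly. -/
theorem NondegenerateRep.clm_ext {F : Type*} [NormedAddCommGroup F] [NormedSpace ℂ F]
    (π : NondegenerateRep D E) {S T : E →L[ℂ] F} (h : ∀ d ξ, S (π.hom d ξ) = T (π.hom d ξ)) :
    S = T := by
  ext ξ
  exact π.mem_of_isClosed (LinearMap.eqLocus S.toLinearMap T.toLinearMap)
    (isClosed_eq S.continuous T.continuous) h ξ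

/-- A bounded left multiplier of a Banach algebra. -/
structure LeftMultiplier (D : Type*) [NonUnitalNormedRing D] [NormedSpace ℂ D] where
  clm : D →L[ℂ] D
  map_mul : ∀ x y, clm (x * y) = clm x * y

variable [CompleteSpace E]

/-- `T` is the strong limit of π(L e) along the approximate unit: π(L e)π(x)ξ = π(L(e x))ξ converges
to π(L x)ξ, and the bound ‖π(L e)‖ ≤ ‖L‖, valid eventually, carries convergence to the closed span.
Taking a limit avoids having to prove that π(x)ξ ↦ π(L x)ξ is well defined. -/
theorem NondegenerateRep.exists_extension (hD : HasContractiveLeftApproxUnit D)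
    (π : NondegenerateRep D E) (L : LeftMultiplier D) :
    ∃ T : E →L[ℂ] E, (∀ x ξ, T (π.hom x ξ) = π.hom (L.clm x) ξ) ∧ ‖T‖ ≤ ‖L.clm‖ := by
  obtain ⟨l, hl, hnorm, hlim⟩ := hD
  have hbound : ∀ᶠ e in l, ∀ ξ, ‖π.hom (L.clm e) ξ‖ ≤ ‖L.clm‖ * ‖ξ‖ := by
    filter_upwards [hnorm] with e he ξ
    refine (π.norm_apply_le _ _).trans (mul_le_mul_of_nonneg_right ?_ (norm_nonneg _))
    exact (L.clm.le_opNorm e).trans (mul_le_of_le_one_right (norm_nonneg _) he)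
  have hgen : ∀ x ξ, Filter.Tendsto (fun e => π.hom (L.clm e) (π.hom x ξ)) l
      (𝓝 (π.hom (L.clm x) ξ)) := by
    intro x ξ
    have h1 : Continuous fun y => π.hom (L.clm y) ξ :=
      (π.continuous_hom.comp L.clm.continuous).clm_apply continuous_const
    refine ((h1.tendsto x).comp (hlim x)).congr fun e => ?_
    simp only [Function.comp, L.map_mul, map_mul]
    rfl
  -- The vectors at which the net is Cauchy form a subspace. It contains every π(d)ξ, so closedness
  -- makes it all of `E`.
  let S : Submodule ℂ E :=
    { carrier := {ξ | Cauchy (Filter.map (fun e => π.hom (L.clm e) ξ) l)}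
      add_mem' := by
        intro ξ η hξ hη
        obtain ⟨a, ha⟩ := CompleteSpace.complete hξ
        obtain ⟨b, hb⟩ := CompleteSpace.complete hη
        have : Filter.Tendsto (fun e => π.hom (L.clm e) (ξ + η)) l (𝓝 (a + b)) := by
          simpa using Filter.Tendsto.add (f := fun e => π.hom (L.clm e) ξ) ha hb
        exact this.cauchy_map
      zero_mem' := by
        have : Filter.Tendsto (fun e => π.hom (L.clm e) (0 : E)) l (𝓝 0) := by simp
        exact this.cauchy_map
      smul_mem' := by
        intro c ξ hξ
        obtain ⟨a, ha⟩ := CompleteSpace.complete hξ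
        have : Filter.Tendsto (fun e => π.hom (L.clm e) (c • ξ)) l (𝓝 (c • a)) := by
          simpa using Filter.Tendsto.const_smul (f := fun e => π.hom (L.clm e) ξ) ha c
        exact this.cauchy_map }
  have hS : IsClosed (S : Set E) := by
    refine isClosed_of_closure_subset fun ξ hξ => ?_
    change Cauchy (Filter.map (fun e => π.hom (L.clm e) ξ) l)
    rw [Metric.cauchy_iff]
    refine ⟨inferInstance, fun ε hε => ?_⟩
    have hK : 0 < ‖L.clm‖ + 1 := by positivity
    -- Replacing ξ by η costs at most ε/3 at each end, uniformly in `e`; the summand 1 keeps the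
    -- denominator positive when `L` is zero.
    obtain ⟨η, hη, hd⟩ := Metric.mem_closure_iff.1 hξ (ε / (3 * (‖L.clm‖ + 1))) (by positivity)
    obtain ⟨t, ht, hdist⟩ := (Metric.cauchy_iff.1 (show Cauchy _ from hη)).2 (ε / 3)
      (by positivity)
    have hclose : ∀ e, (∀ ξ, ‖π.hom (L.clm e) ξ‖ ≤ ‖L.clm‖ * ‖ξ‖) →
        dist (π.hom (L.clm e) ξ) (π.hom (L.clm e) η) < ε / 3 := by
      intro e he
      rw [dist_eq_norm, ← map_sub]
      refine (he _).trans_lt ?_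
      rw [dist_eq_norm] at hd
      calc ‖L.clm‖ * ‖ξ - η‖ ≤ (‖L.clm‖ + 1) * ‖ξ - η‖ := by gcongr; linarith
        _ < (‖L.clm‖ + 1) * (ε / (3 * (‖L.clm‖ + 1))) := by gcongr
        _ = ε / 3 := by field_simp
    refine ⟨(fun e => π.hom (L.clm e) ξ) ''
      ({e | ∀ ξ, ‖π.hom (L.clm e) ξ‖ ≤ ‖L.clm‖ * ‖ξ‖} ∩
        (fun e => π.hom (L.clm e) η) ⁻¹' t),
      Filter.image_mem_map (Filter.inter_mem hbound ht), ?_⟩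
    rintro _ ⟨e, ⟨he, het⟩, rfl⟩ _ ⟨e', ⟨he', het'⟩, rfl⟩
    have h1 := hclose e he
    have h2 := hclose e' he'
    have h3 := hdist _ het _ het'
    have h4 := dist_triangle4 (π.hom (L.clm e) ξ) (π.hom (L.clm e) η)
      (π.hom (L.clm e') η) (π.hom (L.clm e') ξ)
    rw [dist_comm (π.hom (L.clm e') η)] at h4
    change dist (π.hom (L.clm e) ξ) (π.hom (L.clm e') ξ) < ε
    linarith
  have hex : ∀ ξ, ∃ η, Filter.Tendsto (fun e => π.hom (L.clm e) ξ) l (𝓝 η) := fun ξ =>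
    CompleteSpace.complete (show Cauchy _ from
      π.mem_of_isClosed S hS (fun d ζ => (hgen d ζ).cauchy_map) ξ)
  choose T hT using hex
  let T' : E →ₗ[ℂ] E := linearMapOfTendsto (l := l) T (fun e => (π.hom (L.clm e)).toLinearMap)
    (tendsto_pi_nhds.2 hT)
  have hT' : ∀ ξ, ‖T' ξ‖ ≤ ‖L.clm‖ * ‖ξ‖ := fun ξ =>
    le_of_tendsto (hT ξ).norm (hbound.mono fun e he => he ξ)
  exact ⟨T'.mkContinuous _ hT', fun x ξ => tendsto_nhds_unique (hT _) (hgen x ξ),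
    LinearMap.mkContinuous_norm_le _ (norm_nonneg _) _⟩

/-- The extension of a nondegenerate representation to left multipliers. -/
def NondegenerateRep.extend (hD : HasContractiveLeftApproxUnit D)
    (π : NondegenerateRep D E) (L : LeftMultiplier D) : E →L[ℂ] E :=
  (π.exists_extension hD L).choose

theorem NondegenerateRep.extend_apply (hD : HasContractiveLeftApproxUnit D)
    (π : NondegenerateRep D E) (L : LeftMultiplier D) (x : D) (ξ : E) :
    π.extend hD L (π.hom x ξ) = π.hom (L.clm x) ξ :=
  (π.exists_extension hD L).choose_spec.1 x ξ

theorem NondegenerateRep.norm_extend_le (hD : HasContractiveLeftApproxUnit D)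
    (π : NondegenerateRep D E) (L : LeftMultiplier D) : ‖π.extend hD L‖ ≤ ‖L.clm‖ :=
  (π.exists_extension hD L).choose_spec.2

end Multiplier

/-! ### Homomorphisms determined by families of representations -/

/-- By `hnorm` the family `b` is jointly norming on `D₂`, so a solution y of b_i(y) = a_i(x) is
unique and satisfies ‖y‖ ≤ ‖x‖. Solvability on a dense set then spreads to all x by completeness of
`D₂`. -/
theorem exists_hom_of_compatible {D₁ D₂ : Type*} {ι : Type*} [NonUnitalNormedRing D₁]
    [NormedSpace ℂ D₁] [NonUnitalNormedRing D₂] [NormedSpace ℂ D₂] [CompleteSpace D₂]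
    {R : ι → Type*} [∀ i, NormedRing (R i)] [∀ i, NormedAlgebra ℂ (R i)]
    (a : ∀ i, D₁ →ₙₐ[ℂ] R i) (b : ∀ i, D₂ →ₙₐ[ℂ] R i) (ha : ∀ i x, ‖a i x‖ ≤ ‖x‖)
    (hb : ∀ i y, ‖b i y‖ ≤ ‖y‖) (hnorm : ∀ y C, 0 ≤ C → (∀ i, ‖b i y‖ ≤ C) → ‖y‖ ≤ C)
    {s : Set D₁} (hs : Dense s) (h : ∀ x ∈ s, ∃ y, ∀ i, a i x = b i y) :
    ∃ Φ : D₁ →ₙₐ[ℂ] D₂, Continuous Φ ∧ ∀ x i, b i (Φ x) = a i x := by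
  have hinj : ∀ y y', (∀ i, b i y = b i y') → y = y' := by
    intro y y' hyy
    rw [← sub_eq_zero, ← norm_le_zero_iff]
    refine hnorm _ 0 le_rfl fun i => ?_
    rw [map_sub, hyy, sub_self, norm_zero]
  have hca : ∀ i, Continuous (a i) := fun i =>
    AddMonoidHomClass.continuous_of_bound (a i) 1 fun x => by simpa using ha i x
  have hcb : ∀ i, Continuous (b i) := fun i =>
    AddMonoidHomClass.continuous_of_bound (b i) 1 fun x => by simpa using hb i x
  have hall : ∀ x, ∃ y, ∀ i, a i x = b i y := by
    intro x
    obtain ⟨u, hu, hux⟩ := mem_closure_iff_seq_limit.1 (hs x)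
    choose y hy using fun n => h (u n) (hu n)
    have hyle : ∀ m n, dist (y m) (y n) ≤ dist (u m) (u n) := by
      intro m n
      rw [dist_eq_norm, dist_eq_norm]
      refine hnorm _ _ (norm_nonneg _) fun i => ?_
      rw [map_sub, ← hy, ← hy, ← map_sub]
      exact ha i _
    have hcau : CauchySeq y := by
      rw [Metric.cauchySeq_iff]
      intro ε hε
      obtain ⟨N, hN⟩ := Metric.cauchySeq_iff.1 hux.cauchySeq ε hε
      exact ⟨N, fun m hm n hn => (hyle m n).trans_lt (hN m hm n hn)⟩
    obtain ⟨z, hz⟩ := cauchySeq_tendsto_of_complete hcau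
    refine ⟨z, fun i => tendsto_nhds_unique (((hca i).tendsto x).comp hux) ?_⟩
    refine (((hcb i).tendsto z).comp hz).congr fun n => ?_
    simp [hy]
  choose φ hφ using hall
  -- Each algebraic law holds after applying every `b i`, because the `a i` are homomorphisms; joint
  -- injectivity lifts it to `D₂`.
  let Φ : D₁ →ₙₐ[ℂ] D₂ :=
    { toFun := φ
      map_smul' := fun c x => hinj _ _ fun i => by rw [← hφ, map_smul, hφ]; simp
      map_zero' := hinj _ _ fun i => by rw [← hφ, map_zero, map_zero]
      map_add' := fun x y => hinj _ _ fun i => by rw [← hφ, map_add, map_add, hφ, hφ]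
      map_mul' := fun x y => hinj _ _ fun i => by rw [← hφ, map_mul, map_mul, hφ, hφ] }
  refine ⟨Φ, AddMonoidHomClass.continuous_of_bound Φ 1 fun x => ?_, fun x i => (hφ x i).symm⟩
  rw [one_mul]
  refine hnorm _ _ (norm_nonneg _) fun i => ?_
  exact (congrArg norm (hφ x i)).symm.trans_le (ha i x)

/-! ### Integrated forms on the crossed product -/

section Integrated

variable {H B : Type u} [Group H] [TopologicalSpace H] [IsTopologicalGroup H]
  [MeasurableSpace H] [BorelSpace H]
  [NonUnitalNormedRing B] [NormedSpace ℂ B] [IsScalarTower ℂ B B] [SMulCommClass ℂ B B]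
  [CompleteSpace B]
  {p : ℝ≥0∞} [Fact (1 ≤ p)] {α : IsometricAction H B}
  (μ : Measure H) [IsFiniteMeasureOnCompacts μ] [μ.IsMulLeftInvariant]

/-- The integrated form of a covariant representation, extended to `F^p(H, B, α)`. -/
def CovRep.integratedHom (ρ : CovRep p α) : Crossed p μ α →ₙₐ[ℂ] (ρ.E →L[ℂ] ρ.E) :=
  Crossed.liftHom
    { toFun := ρ.integrated μ
      map_add' := ρ.integrated_add μ
      map_smul' := ρ.integrated_smul μ }
    (ρ.norm_integrated_le_universalNorm μ) (ρ.integrated_convolution μ)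

variable {μ}

theorem CovRep.integratedHom_of (ρ : CovRep p α) (f : C_c(H, B)) :
    ρ.integratedHom μ (Crossed.of p μ α f) = ρ.integrated μ f :=
  Crossed.liftHom_of _ _ _ _

theorem CovRep.norm_integratedHom_le (ρ : CovRep p α) (x : Crossed p μ α) :
    ‖ρ.integratedHom μ x‖ ≤ ‖x‖ :=
  Crossed.norm_liftHom_le _ _ _ x

theorem CovRep.continuous_integratedHom (ρ : CovRep p α) : Continuous (ρ.integratedHom μ) :=
  Crossed.continuous_liftHom _ _ _

/-- On functions this is the definition of the norm as a supremum. It survives completion because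
all integrated forms are contractive, so that an ε/2-approximation costs ε in total. -/
theorem Crossed.norm_le_of_forall_covRep (x : Crossed p μ α) (C : ℝ) (hC : 0 ≤ C)
    (h : ∀ ρ : CovRep p α, ‖ρ.integratedHom μ x‖ ≤ C) : ‖x‖ ≤ C := by
  refine le_of_forall_pos_le_add fun ε hε => ?_
  obtain ⟨f, hf⟩ := Crossed.denseRange_of.exists_dist_lt x (half_pos hε)
  rw [dist_eq_norm] at hf
  have h1 : ‖Crossed.of p μ α f‖ ≤ C + ε / 2 := by
    rw [Crossed.norm_of]
    refine universalNorm_le (by positivity) fun ρ => ?_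
    rw [← ρ.integratedHom_of]
    have h2 := (ρ.norm_integratedHom_le (x - Crossed.of p μ α f)).trans hf.le
    rw [map_sub] at h2
    have h3 := norm_sub_norm_le (ρ.integratedHom μ (Crossed.of p μ α f)) (ρ.integratedHom μ x)
    rw [norm_sub_rev] at h3
    linarith [h ρ]
  have h4 := norm_sub_norm_le x (Crossed.of p μ α f)
  linarith

/-- Covariant representations separate points, so identities in the crossed product can be verified
as operator identities. -/
theorem Crossed.ext_covRep {x y : Crossed p μ α}
    (h : ∀ ρ : CovRep p α, ρ.integratedHom μ x = ρ.integratedHom μ y) : x = y := by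
  rw [← sub_eq_zero, ← norm_le_zero_iff]
  refine Crossed.norm_le_of_forall_covRep _ 0 le_rfl fun ρ => ?_
  rw [map_sub, h, sub_self, norm_zero]

/-- The representation of the algebra in a covariant representation. -/
def CovRep.toNondegenerateRep (ρ : CovRep p α) : NondegenerateRep B ρ.E where
  hom := ρ.π
  norm_hom_le := ρ.norm_π_le
  nondegenerate := ρ.nondegenerate

end Integrated


/-- A contractive algebra homomorphism as a continuous linear map. -/
def contractiveHomClm {D R : Type*} [NonUnitalNormedRing D] [NormedSpace ℂ D]
    [NonUnitalNormedRing R] [NormedSpace ℂ R] (φ : D →ₙₐ[ℂ] R) (hφ : ∀ x, ‖φ x‖ ≤ ‖x‖) :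
    D →L[ℂ] R :=
  LinearMap.mkContinuous
    { toFun := φ
      map_add' := map_add φ
      map_smul' := fun c b => map_smul φ c b } 1
    (fun b => by simpa using hφ b)

/-! ### Approximate units by bump functions -/

section Bump

variable {H : Type u} [Group H] [TopologicalSpace H] [IsTopologicalGroup H]
  [MeasurableSpace H] [BorelSpace H] (μ : Measure H)

/-- The filter of nonnegative functions of integral one with support shrinking to the identity. -/
def bumpFilter : Filter C_c(H, ℝ) :=
  Filter.comap (fun φ : C_c(H, ℝ) => Function.support φ) (𝓝 (1 : H)).smallSets ⊓
    Filter.principal {φ | (∀ s, 0 ≤ φ s) ∧ ∫ s, φ s ∂μ = 1}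

theorem eventually_bumpFilter_nonneg : ∀ᶠ φ in bumpFilter μ, ∀ s, 0 ≤ φ s :=
  Filter.mem_inf_of_right (Filter.mem_principal.2 fun _ h => h.1)

theorem eventually_bumpFilter_integral : ∀ᶠ φ in bumpFilter μ, ∫ s, φ s ∂μ = 1 :=
  Filter.mem_inf_of_right (Filter.mem_principal.2 fun _ h => h.2)

theorem eventually_bumpFilter_support {U : Set H} (hU : U ∈ 𝓝 (1 : H)) :
    ∀ᶠ φ in bumpFilter μ, ∀ s, s ∉ U → φ s = 0 := by
  refine Filter.mem_inf_of_left ?_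
  refine Filter.mem_comap.2 ⟨{V | V ⊆ U}, ?_, ?_⟩
  · exact Filter.eventually_smallSets.2 ⟨U, hU, fun V hV => hV⟩
  · intro φ hφ s hs
    by_contra h
    exact hs (hφ h)

variable [LocallyCompactSpace H] [μ.IsOpenPosMeasure] [IsFiniteMeasureOnCompacts μ]

/-- Urysohn's lemma gives a compactly supported f ≥ 0 with f(1) = 1 vanishing off a prescribed
neighbourhood. Its integral is positive because the measure charges open sets, so f can be
normalised. -/
instance bumpFilter_neBot : (bumpFilter μ).NeBot := by
  rw [bumpFilter, Filter.inf_principal_neBot_iff]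
  rintro t ht
  obtain ⟨S, hS, hSt⟩ := Filter.mem_comap.1 ht
  obtain ⟨U, hU, hUS⟩ := Filter.eventually_smallSets.1 hS
  obtain ⟨V, hVU, hV, h1V⟩ := mem_nhds_iff.1 hU
  obtain ⟨f, hf1, hf0, hfc, hf⟩ := exists_continuous_one_zero_of_isCompact
    (isCompact_singleton (x := (1 : H))) hV.isClosed_compl
    (Set.disjoint_compl_right_iff_subset.2 (Set.singleton_subset_iff.2 h1V))
  have hpos : 0 < ∫ s, f s ∂μ := by
    refine f.continuous.integral_pos_of_hasCompactSupport_nonneg_nonzero hfc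
      (fun s => (hf s).1) (x := 1) ?_
    rw [hf1 rfl]
    exact one_ne_zero
  let φ : C_c(H, ℝ) :=
    { toFun := fun s => (∫ s, f s ∂μ)⁻¹ * f s
      continuous_toFun := by fun_prop
      hasCompactSupport' := hfc.mul_left }
  refine ⟨φ, hSt (hUS _ fun s hs => hVU ?_), fun s => ?_, ?_⟩
  · by_contra h
    refine hs ?_
    change (∫ s, f s ∂μ)⁻¹ * f s = 0
    rw [hf0 h]
    simp
  · exact mul_nonneg (inv_nonneg.2 hpos.le) (hf s).1
  · change ∫ s, (∫ s, f s ∂μ)⁻¹ * f s ∂μ = 1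
    rw [integral_const_mul, inv_mul_cancel₀ hpos.ne']

/-- Since φ ≥ 0 has integral one, the error is the φ-average of g(s) − g(1), and φ lives where this
difference is small. -/
theorem tendsto_integral_bumpFilter {E : Type*} [NormedAddCommGroup E] [NormedSpace ℝ E]
    [CompleteSpace E] {g : H → E} (hg : Continuous g) :
    Filter.Tendsto (fun φ : C_c(H, ℝ) => ∫ s, φ s • g s ∂μ) (bumpFilter μ) (𝓝 (g 1)) := by
  rw [Metric.tendsto_nhds]
  intro ε hε
  have hU : {s | dist (g s) (g 1) < ε / 2} ∈ 𝓝 (1 : H) :=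
    (Metric.tendsto_nhds.1 (hg.tendsto 1)) (ε / 2) (half_pos hε)
  filter_upwards [eventually_bumpFilter_nonneg μ, eventually_bumpFilter_integral μ,
    eventually_bumpFilter_support μ hU] with φ h0 h1 hs
  have hint : Integrable (fun s => φ s) μ :=
    (map_continuous φ).integrable_of_hasCompactSupport φ.hasCompactSupport
  have hint' : Integrable (fun s => φ s • g s) μ :=
    ((map_continuous φ).smul hg).integrable_of_hasCompactSupport φ.hasCompactSupport.smul_right
  have h2 : (∫ s, φ s • g s ∂μ) - g 1 = ∫ s, φ s • (g s - g 1) ∂μ := by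
    simp only [smul_sub]
    rw [integral_sub hint' (hint.smul_const _), integral_smul_const, h1, one_smul]
  rw [dist_eq_norm, h2]
  refine lt_of_le_of_lt (b := ε / 2) ?_ (half_lt_self hε)
  calc ‖∫ s, φ s • (g s - g 1) ∂μ‖ ≤ ∫ s, φ s * (ε / 2) ∂μ := by
        refine norm_integral_le_of_norm_le (hint.mul_const _)
          (Filter.Eventually.of_forall fun s => ?_)
        rw [norm_smul, Real.norm_of_nonneg (h0 s)]
        by_cases hsU : dist (g s) (g 1) < ε / 2
        · rw [← dist_eq_norm]
          exact mul_le_mul_of_nonneg_left hsU.le (h0 s)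
        · rw [hs s hsU]
          simp
    _ = ε / 2 := by rw [integral_mul_const, h1, one_mul]

/-- A scalar function of compact support as a function with values in a unital algebra. -/
def scalarCc {B : Type u} [NormedRing B] [NormedAlgebra ℂ B] (φ : C_c(H, ℝ)) : C_c(H, B) where
  toFun s := (φ s : ℂ) • (1 : B)
  continuous_toFun := by
    have := map_continuous φ
    fun_prop
  hasCompactSupport' := by
    refine φ.hasCompactSupport.mono ?_
    intro s hs h0
    apply hs
    simp only [h0]
    simp

theorem scalarCc_apply {B : Type u} [NormedRing B] [NormedAlgebra ℂ B] (φ : C_c(H, ℝ)) (s : H) :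
    (scalarCc φ : C_c(H, B)) s = (φ s : ℂ) • (1 : B) := rfl

end Bump

/-! ### Left multipliers of crossed products -/

section CrossedMultiplier

variable {H B : Type u} [Group H] [TopologicalSpace H] [IsTopologicalGroup H]
  [MeasurableSpace H] [BorelSpace H]
  [NonUnitalNormedRing B] [NormedSpace ℂ B] [IsScalarTower ℂ B B] [SMulCommClass ℂ B B]
  [CompleteSpace B]
  {p : ℝ≥0∞} [Fact (1 ≤ p)] {α : IsometricAction H B}

/-- Pointwise left multiplication by `b` on `C_c(H, B)`. -/
def leftMulCc (b : B) : C_c(H, B) →ₗ[ℂ] C_c(H, B) where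
  toFun f :=
    { toFun := fun s => b * f s
      continuous_toFun := continuous_const.mul (map_continuous f)
      hasCompactSupport' := f.hasCompactSupport.mul_left }
  map_add' f g := by ext s; exact mul_add _ _ _
  map_smul' c f := by ext s; exact mul_smul_comm c b (f s)

theorem leftMulCc_apply (b : B) (f : C_c(H, B)) (s : H) : leftMulCc b f s = b * f s := rfl

/-- The left translation `f ↦ (t ↦ α_s(f(s⁻¹ t)))` of `C_c(H, B)`. -/
def translateCc (α : IsometricAction H B) (s : H) : C_c(H, B) →ₗ[ℂ] C_c(H, B) where
  toFun f :=
    { toFun := fun t => α.act s (f (s⁻¹ * t))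
      continuous_toFun := (α.clm s).continuous.comp
        ((map_continuous f).comp (continuous_const.mul continuous_id))
      hasCompactSupport' := (f.hasCompactSupport.comp_homeomorph (Homeomorph.mulLeft s⁻¹)).comp_left
        (g := α.act s) (map_zero _) }
  map_add' f g := by ext t; exact map_add (α.act s) _ _
  map_smul' c f := by ext t; exact map_smul (α.act s) c _

theorem translateCc_apply (α : IsometricAction H B) (s : H) (f : C_c(H, B)) (t : H) :
    translateCc α s f t = α.act s (f (s⁻¹ * t)) := rfl

variable {μ : Measure H} [IsFiniteMeasureOnCompacts μ]

theorem CovRep.integrated_leftMulCc (ρ : CovRep p α) (b : B) (f : C_c(H, B)) :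
    ρ.integrated μ (leftMulCc b f) = ρ.π b * ρ.integrated μ f := by
  ext1 ξ
  change ∫ s, ρ.π (b * f s) (ρ.v s ξ) ∂μ = ρ.π b (∫ s, ρ.π (f s) (ρ.v s ξ) ∂μ)
  rw [← (ρ.π b).integral_comp_comm (ρ.integrable_integrand μ f ξ)]
  simp only [map_mul]
  rfl

variable [μ.IsMulLeftInvariant]

/-- Left invariance of the measure permits the substitution t ↦ s t, after which covariance pulls
v_s out of the integral. -/
theorem CovRep.integrated_translateCc (ρ : CovRep p α) (s : H) (f : C_c(H, B)) :
    ρ.integrated μ (translateCc α s f) = ρ.v s * ρ.integrated μ f := by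
  ext1 ξ
  change ∫ t, ρ.π (α.act s (f (s⁻¹ * t))) (ρ.v t ξ) ∂μ = ρ.v s (∫ t, ρ.π (f t) (ρ.v t ξ) ∂μ)
  rw [← (ρ.v s).integral_comp_comm (ρ.integrable_integrand μ f ξ),
    ← integral_mul_left_eq_self _ s]
  congr 1
  ext1 t
  rw [inv_mul_cancel_left, ρ.v_π, map_mul]
  rfl

theorem universalNorm_leftMulCc_le (b : B) (f : C_c(H, B)) :
    universalNorm p μ α (leftMulCc b f) ≤ ‖b‖ * universalNorm p μ α f :=
  universalNorm_le (mul_nonneg (norm_nonneg _) (universalNorm_nonneg p μ α f)) fun ρ => by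
    rw [ρ.integrated_leftMulCc]
    exact (norm_mul_le _ _).trans (mul_le_mul (ρ.norm_π_le b)
      (ρ.norm_integrated_le_universalNorm μ f) (norm_nonneg _) (norm_nonneg _))

theorem CovRep.norm_v_le (ρ : CovRep p α) (s : H) : ‖ρ.v s‖ ≤ 1 :=
  ContinuousLinearMap.opNorm_le_bound _ zero_le_one fun ξ => by rw [ρ.norm_v, one_mul]

theorem universalNorm_translateCc_le (s : H) (f : C_c(H, B)) :
    universalNorm p μ α (translateCc α s f) ≤ 1 * universalNorm p μ α f :=
  universalNorm_le (mul_nonneg zero_le_one (universalNorm_nonneg p μ α f)) fun ρ => by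
    rw [ρ.integrated_translateCc]
    exact (norm_mul_le _ _).trans (mul_le_mul (ρ.norm_v_le s)
      (ρ.norm_integrated_le_universalNorm μ f) (norm_nonneg _) zero_le_one)

/-- A bounded map which acts through the operator `T` on functions acts through `T` everywhere. -/
theorem CovRep.integratedHom_clm (ρ : CovRep p α) (L : Crossed p μ α →L[ℂ] Crossed p μ α)
    (T : ρ.E →L[ℂ] ρ.E)
    (h : ∀ f, ρ.integratedHom μ (L (Crossed.of p μ α f)) = T * ρ.integrated μ f)
    (x : Crossed p μ α) : ρ.integratedHom μ (L x) = T * ρ.integratedHom μ x := by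
  induction x using Crossed.induction_on with
  | hc =>
    exact isClosed_eq (ρ.continuous_integratedHom.comp L.continuous)
      (continuous_const.mul ρ.continuous_integratedHom)
  | h f => rw [h, ρ.integratedHom_of]

/-- An operator commuting with the algebra, and with the group up to a character, intertwines the
integrated forms of a function and its twist. -/
theorem CovRep.apply_integrated (ρ : CovRep p α) (χ : PontryaginDual H) (W : ρ.E →L[ℂ] ρ.E)
    (hπ : ∀ b ξ, W (ρ.π b ξ) = ρ.π b (W ξ))
    (hv : ∀ s ξ, W (ρ.v s ξ) = starRingEnd ℂ (χ s : ℂ) • ρ.v s (W ξ)) (f : C_c(H, B))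
    (ξ : ρ.E) : W (ρ.integrated μ f ξ) = ρ.integrated μ (twistCc χ f) (W ξ) := by
  rw [ρ.integrated_apply, ρ.integrated_apply,
    ← W.integral_comp_comm (ρ.integrable_integrand μ f ξ)]
  congr 1
  ext1 s
  rw [hπ, hv, twistCc_apply, map_smul, map_smul]
  rfl

/-- Reduces to functions the covariance of a representation that is itself an integrated form, as in
`CovRep.swapRep` and `CovRep.fourierRep`. -/
theorem CovRep.mul_integratedHom_mul (ρ : CovRep p α) (S T : ρ.E →L[ℂ] ρ.E)
    {θ : Crossed p μ α → Crossed p μ α} (hθ : Continuous θ)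
    (h : ∀ f, S * ρ.integrated μ f * T = ρ.integratedHom μ (θ (Crossed.of p μ α f)))
    (x : Crossed p μ α) : S * ρ.integratedHom μ x * T = ρ.integratedHom μ (θ x) := by
  induction x using Crossed.induction_on with
  | hc =>
    exact isClosed_eq ((continuous_const.mul ρ.continuous_integratedHom).mul continuous_const)
      (ρ.continuous_integratedHom.comp hθ)
  | h f => rw [ρ.integratedHom_of, h]

/-- Left multiplication by an element of `B`, as a left multiplier of `F^p(H, B, α)`. -/
def Crossed.leftMulClm (p : ℝ≥0∞) [Fact (1 ≤ p)] (μ : Measure H) [IsFiniteMeasureOnCompacts μ]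
    [μ.IsMulLeftInvariant] (α : IsometricAction H B) (b : B) : Crossed p μ α →L[ℂ] Crossed p μ α :=
  Crossed.lift (Crossed.of p μ α ∘ₗ leftMulCc b) ‖b‖
    (fun f => (Crossed.norm_of _).le.trans (universalNorm_leftMulCc_le b f))

theorem Crossed.leftMulClm_of (b : B) (f : C_c(H, B)) :
    Crossed.leftMulClm p μ α b (Crossed.of p μ α f) = Crossed.of p μ α (leftMulCc b f) :=
  Crossed.lift_of _ _ _ _

theorem Crossed.norm_leftMulClm_le (b : B) : ‖Crossed.leftMulClm p μ α b‖ ≤ ‖b‖ :=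
  ContinuousLinearMap.opNorm_le_bound _ (norm_nonneg _) (Crossed.norm_lift_le _ _ _)

theorem CovRep.integratedHom_leftMulClm (ρ : CovRep p α) (b : B) (x : Crossed p μ α) :
    ρ.integratedHom μ (Crossed.leftMulClm p μ α b x) = ρ.π b * ρ.integratedHom μ x :=
  ρ.integratedHom_clm _ _ (fun f => by
    rw [Crossed.leftMulClm_of, ρ.integratedHom_of, ρ.integrated_leftMulCc]) x

/-- Left translation by an element of `H`, as a left multiplier of `F^p(H, B, α)`. -/
def Crossed.translateClm (p : ℝ≥0∞) [Fact (1 ≤ p)] (μ : Measure H)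
    [IsFiniteMeasureOnCompacts μ] [μ.IsMulLeftInvariant]
    (α : IsometricAction H B) (s : H) : Crossed p μ α →L[ℂ] Crossed p μ α :=
  Crossed.lift (Crossed.of p μ α ∘ₗ translateCc α s) 1
    (fun f => (Crossed.norm_of _).le.trans (universalNorm_translateCc_le s f))

theorem Crossed.translateClm_of (s : H) (f : C_c(H, B)) :
    Crossed.translateClm p μ α s (Crossed.of p μ α f) =
      Crossed.of p μ α (translateCc α s f) :=
  Crossed.lift_of _ _ _ _

theorem Crossed.norm_translateClm_le (s : H) : ‖Crossed.translateClm p μ α s‖ ≤ 1 :=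
  ContinuousLinearMap.opNorm_le_bound _ zero_le_one (Crossed.norm_lift_le _ _ _)

theorem CovRep.integratedHom_translateClm (ρ : CovRep p α) (s : H) (x : Crossed p μ α) :
    ρ.integratedHom μ (Crossed.translateClm p μ α s x) = ρ.v s * ρ.integratedHom μ x :=
  ρ.integratedHom_clm _ _ (fun f => by
    rw [Crossed.translateClm_of, ρ.integratedHom_of, ρ.integrated_translateCc]) x

/-- Left multiplication by an element of `B`, as a left multiplier of `F^p(H, B, α)`. -/
def Crossed.leftMul (p : ℝ≥0∞) [Fact (1 ≤ p)] (μ : Measure H) [IsFiniteMeasureOnCompacts μ]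
    [μ.IsMulLeftInvariant] (α : IsometricAction H B) (b : B) :
    LeftMultiplier (Crossed p μ α) where
  clm := Crossed.leftMulClm p μ α b
  map_mul x y := Crossed.ext_covRep fun ρ => by
    rw [ρ.integratedHom_leftMulClm, _root_.map_mul (ρ.integratedHom μ), _root_.map_mul (ρ.integratedHom μ),
      ρ.integratedHom_leftMulClm, mul_assoc]

/-- Left translation by an element of `H`, as a left multiplier of `F^p(H, B, α)`. -/
def Crossed.translate (p : ℝ≥0∞) [Fact (1 ≤ p)] (μ : Measure H) [IsFiniteMeasureOnCompacts μ]
    [μ.IsMulLeftInvariant] (α : IsometricAction H B) (s : H) :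
    LeftMultiplier (Crossed p μ α) where
  clm := Crossed.translateClm p μ α s
  map_mul x y := Crossed.ext_covRep fun ρ => by
    rw [ρ.integratedHom_translateClm, _root_.map_mul (ρ.integratedHom μ), _root_.map_mul (ρ.integratedHom μ),
      ρ.integratedHom_translateClm, mul_assoc]

/-- This and the following multiplier identities hold because, in each covariant representation, the
multipliers act as left multiplication by `ρ.v s` and `ρ.π b`, which satisfy them. -/
theorem Crossed.translateClm_one (x : Crossed p μ α) : Crossed.translateClm p μ α 1 x = x :=
  Crossed.ext_covRep fun ρ => by rw [ρ.integratedHom_translateClm, map_one, one_mul]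

theorem Crossed.translateClm_mul (s t : H) (x : Crossed p μ α) :
    Crossed.translateClm p μ α (s * t) x =
      Crossed.translateClm p μ α s (Crossed.translateClm p μ α t x) :=
  Crossed.ext_covRep fun ρ => by
    simp only [ρ.integratedHom_translateClm, map_mul, mul_assoc]

theorem Crossed.leftMulClm_mul (a b : B) (x : Crossed p μ α) :
    Crossed.leftMulClm p μ α (a * b) x =
      Crossed.leftMulClm p μ α a (Crossed.leftMulClm p μ α b x) :=
  Crossed.ext_covRep fun ρ => by
    simp only [ρ.integratedHom_leftMulClm, map_mul, mul_assoc]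

theorem Crossed.leftMulClm_add (a b : B) (x : Crossed p μ α) :
    Crossed.leftMulClm p μ α (a + b) x =
      Crossed.leftMulClm p μ α a x + Crossed.leftMulClm p μ α b x :=
  Crossed.ext_covRep fun ρ => by
    simp only [ρ.integratedHom_leftMulClm, map_add, add_mul]

theorem Crossed.leftMulClm_smul (c : ℂ) (b : B) (x : Crossed p μ α) :
    Crossed.leftMulClm p μ α (c • b) x = c • Crossed.leftMulClm p μ α b x :=
  Crossed.ext_covRep fun ρ => by
    simp only [ρ.integratedHom_leftMulClm, map_smul, smul_mul_assoc]

theorem Crossed.translateClm_leftMulClm (s : H) (b : B) (x : Crossed p μ α) :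
    Crossed.translateClm p μ α s (Crossed.leftMulClm p μ α b x) =
      Crossed.leftMulClm p μ α (α.act s b) (Crossed.translateClm p μ α s x) :=
  Crossed.ext_covRep fun ρ => by
    simp only [ρ.integratedHom_leftMulClm, ρ.integratedHom_translateClm, ← mul_assoc]
    congr 1
    ext1 ξ
    exact ρ.v_π s b ξ

/-- Left multiplication by elements of `B` as a continuous bilinear map. -/
def Crossed.leftMulL (p : ℝ≥0∞) [Fact (1 ≤ p)] (μ : Measure H) [IsFiniteMeasureOnCompacts μ]
    [μ.IsMulLeftInvariant] (α : IsometricAction H B) :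
    B →L[ℂ] Crossed p μ α →L[ℂ] Crossed p μ α :=
  LinearMap.mkContinuous
    { toFun := Crossed.leftMulClm p μ α
      map_add' := fun a b => ContinuousLinearMap.ext fun x => Crossed.leftMulClm_add a b x
      map_smul' := fun c b => ContinuousLinearMap.ext fun x => Crossed.leftMulClm_smul c b x } 1
    (fun b => by simpa using Crossed.norm_leftMulClm_le b)

theorem Crossed.leftMulL_apply (b : B) : Crossed.leftMulL p μ α b = Crossed.leftMulClm p μ α b :=
  rfl

variable [LocallyCompactSpace H]

-- Translations are uniformly contractive, so functions suffice. For a function f the L¹ norm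
-- dominates the difference, and while s stays in a compact neighbourhood K of s₀ all translates are
-- supported in K · supp f, so the dominating integral is continuous there.
open scoped Pointwise in
theorem Crossed.continuous_translateClm (x : Crossed p μ α) :
    Continuous fun s => Crossed.translateClm p μ α s x := by
  suffices hf : ∀ f, Continuous fun s => Crossed.translateClm p μ α s (Crossed.of p μ α f) by
    refine continuous_of_uniform_approx_of_continuous fun V hV => ?_
    obtain ⟨ε, hε, hV⟩ := Metric.mem_uniformity_dist.1 hV
    obtain ⟨f, hfx⟩ := Crossed.denseRange_of.exists_dist_lt x hε
    refine ⟨_, hf f, fun y => hV ?_⟩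
    rw [dist_eq_norm, ← map_sub]
    refine ((Crossed.translateClm p μ α y).le_of_opNorm_le
      (Crossed.norm_translateClm_le y) _).trans_lt ?_
    rwa [one_mul, ← dist_eq_norm]
  intro f
  rw [continuous_iff_continuousAt]
  intro s₀
  obtain ⟨K, hK, hKs⟩ := exists_compact_mem_nhds s₀
  rw [ContinuousAt, tendsto_iff_norm_sub_tendsto_zero]
  have hb : ∀ s, ‖Crossed.translateClm p μ α s (Crossed.of p μ α f) -
      Crossed.translateClm p μ α s₀ (Crossed.of p μ α f)‖ ≤
      ∫ t, ‖α.act s (f (s⁻¹ * t)) - α.act s₀ (f (s₀⁻¹ * t))‖ ∂μ := by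
    intro s
    rw [Crossed.translateClm_of, Crossed.translateClm_of, ← map_sub]
    exact Crossed.norm_of_le _
  have hcont : ContinuousOn
      (fun s => ∫ t, ‖α.act s (f (s⁻¹ * t)) - α.act s₀ (f (s₀⁻¹ * t))‖ ∂μ) K := by
    refine continuousOn_integral_of_compact_support
      (k := K * tsupport f) (hK.mul f.hasCompactSupport.isCompact) ?_ ?_
    · have hf := map_continuous f
      refine Continuous.continuousOn (Continuous.norm (Continuous.sub ?_ ?_))
      · exact α.continuous_uncurry.comp (continuous_fst.prodMk
          (hf.comp (by fun_prop)))
      · exact (α.clm s₀).continuous.comp (hf.comp (by fun_prop))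
    · intro s t hs ht
      have h0 : ∀ s ∈ K, f (s⁻¹ * t) = 0 := fun s hs =>
        image_eq_zero_of_notMem_tsupport fun h => ht ⟨s, hs, _, h, mul_inv_cancel_left s t⟩
      simp [h0 s hs, h0 s₀ (mem_of_mem_nhds hKs)]
  have := (hcont.continuousAt hKs).tendsto
  simp only [sub_self, norm_zero, integral_zero] at this
  exact squeeze_zero (fun _ => norm_nonneg _) hb this

theorem Crossed.continuous_leftMul_translate (f : C_c(H, B)) (x : Crossed p μ α) :
    Continuous fun s => Crossed.leftMulClm p μ α (f s) (Crossed.translateClm p μ α s x) :=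
  ((Crossed.leftMulL p μ α).continuous.comp (map_continuous f)).clm_apply
    (Crossed.continuous_translateClm x)

theorem Crossed.integrable_leftMul_translate (f : C_c(H, B)) (x : Crossed p μ α) :
    Integrable (fun s => Crossed.leftMulClm p μ α (f s) (Crossed.translateClm p μ α s x)) μ := by
  refine (Crossed.continuous_leftMul_translate f x).integrable_of_hasCompactSupport ?_
  refine f.hasCompactSupport.mono ?_
  intro s hs h0
  apply hs
  simp only [h0, ← Crossed.leftMulL_apply]
  simp

/-- Left multiplication by a function is an integral of left multipliers. -/
theorem Crossed.of_mul_eq_integral (f : C_c(H, B)) (x : Crossed p μ α) :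
    Crossed.of p μ α f * x =
      ∫ s, Crossed.leftMulClm p μ α (f s) (Crossed.translateClm p μ α s x) ∂μ := by
  refine Crossed.ext_covRep fun ρ => ?_
  ext1 ξ
  have h := ((contractiveHomClm (ρ.integratedHom μ) ρ.norm_integratedHom_le).flip
    ξ).integral_comp_comm (Crossed.integrable_leftMul_translate f x)
  refine Eq.trans ?_ h
  rw [map_mul, ρ.integratedHom_of]
  change ∫ s, _ ∂μ = ∫ s, ρ.integratedHom μ _ ξ ∂μ
  simp only [ρ.integratedHom_leftMulClm, ρ.integratedHom_translateClm]
  rfl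

end CrossedMultiplier

/-! ### Unital coefficient algebras -/

section Unital

variable {H B : Type u} [Group H] [TopologicalSpace H] [IsTopologicalGroup H]
  [LocallyCompactSpace H] [MeasurableSpace H] [BorelSpace H]
  [NormedRing B] [NormedAlgebra ℂ B] [CompleteSpace B] [NormOneClass B]
  {p : ℝ≥0∞} [Fact (1 ≤ p)] {α : IsometricAction H B}
  {μ : Measure H} [IsFiniteMeasureOnCompacts μ] [μ.IsMulLeftInvariant] [μ.IsOpenPosMeasure]

theorem NondegenerateRep.map_one {E : Type*} [NormedAddCommGroup E] [NormedSpace ℂ E]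
    (π : NondegenerateRep B E) : π.hom 1 = 1 :=
  π.clm_ext fun d ξ => by
    change (π.hom 1 * π.hom d) ξ = _
    rw [← map_mul, one_mul]
    rfl

theorem Crossed.leftMulClm_one (x : Crossed p μ α) : Crossed.leftMulClm p μ α (1 : B) x = x :=
  Crossed.ext_covRep fun ρ => by
    rw [ρ.integratedHom_leftMulClm]
    have : ρ.π 1 = 1 := ρ.toNondegenerateRep.map_one
    rw [this, one_mul]

/-- Over a unital algebra, scalar functions act by averaging translates; combined with strong
continuity of translation this gives the approximate unit. -/
theorem Crossed.of_scalarCc_mul (φ : C_c(H, ℝ)) (x : Crossed p μ α) :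
    Crossed.of p μ α (scalarCc φ) * x = ∫ s, φ s • Crossed.translateClm p μ α s x ∂μ := by
  rw [Crossed.of_mul_eq_integral]
  congr 1
  ext1 s
  rw [scalarCc_apply, Crossed.leftMulClm_smul, Crossed.leftMulClm_one]
  exact RCLike.real_smul_eq_coe_smul (K := ℂ) _ _ |>.symm

theorem CovRep.integrated_scalarCc (ρ : CovRep p α) (φ : C_c(H, ℝ)) (ξ : ρ.E) :
    ρ.integrated μ (scalarCc φ) ξ = ∫ s, φ s • ρ.v s ξ ∂μ := by
  rw [ρ.integrated_apply]
  congr 1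
  ext1 s
  have : ρ.π 1 = 1 := ρ.toNondegenerateRep.map_one
  rw [scalarCc_apply, map_smul, this]
  exact RCLike.real_smul_eq_coe_smul (K := ℂ) _ _ |>.symm

-- The functions φ · 1 have L¹ norm ∫ φ = 1 because ‖1‖ = 1, and multiplying x by them averages
-- translates of x near the identity.
variable (p μ α) in
theorem Crossed.hasContractiveLeftApproxUnit : HasContractiveLeftApproxUnit (Crossed p μ α) := by
  refine ⟨(bumpFilter μ).map fun φ => Crossed.of p μ α (scalarCc φ), inferInstance, ?_, ?_⟩
  · rw [Filter.eventually_map]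
    filter_upwards [eventually_bumpFilter_nonneg μ, eventually_bumpFilter_integral μ]
      with φ h0 h1
    refine (Crossed.norm_of_le _).trans ?_
    refine le_of_eq (Eq.trans ?_ h1)
    congr 1
    ext1 s
    rw [scalarCc_apply, norm_smul, norm_one, mul_one, Complex.norm_real,
      Real.norm_of_nonneg (h0 s)]
  · intro x
    rw [Filter.tendsto_map'_iff]
    have h := tendsto_integral_bumpFilter μ (Crossed.continuous_translateClm (p := p) (μ := μ)
      (α := α) x)
    rw [Crossed.translateClm_one] at h
    exact h.congr fun φ => (Crossed.of_scalarCc_mul φ x).symm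

/-- The integrated form as a nondegenerate representation of the crossed product. -/
def CovRep.integratedRep (ρ : CovRep p α) (μ : Measure H) [IsFiniteMeasureOnCompacts μ]
    [μ.IsMulLeftInvariant] [μ.IsOpenPosMeasure] : NondegenerateRep (Crossed p μ α) ρ.E where
  hom := ρ.integratedHom μ
  norm_hom_le := ρ.norm_integratedHom_le
  nondegenerate ξ := by
    -- ξ is the limit of ∫ φ(s) v_s ξ ds, and each of these vectors lies in the range of the
    -- integrated form of φ · 1.
    have h := tendsto_integral_bumpFilter μ (ρ.continuous_v ξ)
    rw [map_one] at h
    refine mem_closure_of_tendsto h (Filter.Eventually.of_forall fun φ => ?_)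
    refine Submodule.subset_span ⟨Crossed.of p μ α (scalarCc φ), ξ, ?_⟩
    rw [ρ.integratedHom_of, ρ.integrated_scalarCc]

end Unital


/-! ### Approximation by elementary tensors -/

section Approx

/-- Compactly supported functions are uniformly approximated by sums of elementary tensors with
values in a dense set, with uniform control of supports. -/
theorem exists_approx_elementary {K E : Type*} [TopologicalSpace K] [T2Space K]
    [LocallyCompactSpace K] [ParacompactSpace K] [NormedAddCommGroup E] [NormedSpace ℝ E]
    {S : Set E} (hS : Dense S) (f : C_c(K, E)) :
    ∃ χ : C_c(K, ℝ), (∀ k, 0 ≤ χ k) ∧ ∀ ε > 0, ∃ (t : Finset K) (φ : K → C_c(K, ℝ)) (x : K → E),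
      (∀ i, x i ∈ S) ∧ ∀ k, ‖f k - ∑ i ∈ t, φ i k • x i‖ ≤ ε * χ k := by
  -- χ equals 1 on the support of f and is fixed before ε. Cutting the partition of unity by χ makes
  -- its members compactly supported and yields an error bound ε χ, integrable for every measure
  -- finite on compacts.
  obtain ⟨χ, hχ1, -, hχc, hχ⟩ := exists_continuous_one_zero_of_isCompact
    f.hasCompactSupport.isCompact isClosed_empty (Set.disjoint_empty _)
  refine ⟨⟨χ, hχc⟩, fun k => (hχ k).1, fun ε hε => ?_⟩
  have hx : ∀ i, ∃ y ∈ S, dist (f i) y < ε := fun i => hS.exists_dist_lt (f i) hε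
  choose x hxS hx using hx
  have hopen : ∀ i, IsOpen {k | dist (f k) (x i) < ε} := fun i =>
    isOpen_lt ((map_continuous f).dist continuous_const) continuous_const
  obtain ⟨t, ht⟩ := f.hasCompactSupport.isCompact.elim_finite_subcover
    (fun i => {k | dist (f k) (x i) < ε}) hopen fun k _ => Set.mem_iUnion.2 ⟨k, hx k⟩
  obtain ⟨ψ, hψ⟩ := PartitionOfUnity.exists_isSubordinate (ι := t) (isClosed_tsupport f)
    (fun i => {k | dist (f k) (x i) < ε}) (fun i => hopen i) (fun k hk => by
      obtain ⟨i, hi, hk⟩ := Set.mem_iUnion₂.1 (ht hk)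
      exact Set.mem_iUnion.2 ⟨⟨i, hi⟩, hk⟩)
  classical
  let φ : K → C_c(K, ℝ) := fun i =>
    { toFun := fun k => if h : i ∈ t then χ k * ψ ⟨i, h⟩ k else 0
      continuous_toFun := by
        by_cases h : i ∈ t
        · simp only [h, dite_true]
          exact χ.continuous.mul (ψ ⟨i, h⟩).continuous
        · simp only [h, dite_false]
          exact continuous_const
      hasCompactSupport' := hχc.mono fun k hk h0 => hk (by simp [h0]) }
  have hφ : ∀ (i : t) k, φ i k = χ k * ψ i k := by
    rintro ⟨i, hi⟩ k
    change (if h : i ∈ t then χ k * ψ ⟨i, h⟩ k else 0) = _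
    simp only [hi, dite_true]
  refine ⟨t, φ, x, hxS, fun k => ?_⟩
  change _ ≤ ε * χ k
  have hsum : (∑ i : t, ψ i k) ≤ 1 := by
    have := ψ.sum_le_one k
    rwa [finsum_eq_sum_of_fintype] at this
  -- On the support of f both χ and the sum of the partition are 1; elsewhere f vanishes.
  have hf : f k = χ k • ∑ i : t, ψ i k • f k := by
    by_cases hk : k ∈ tsupport f
    · have := ψ.sum_eq_one hk
      rw [finsum_eq_sum_of_fintype] at this
      rw [← Finset.sum_smul, this, hχ1 hk]
      simp
    · rw [image_eq_zero_of_notMem_tsupport hk]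
      simp
  have h1 : f k - ∑ i ∈ t, φ i k • x i = χ k • ∑ i : t, ψ i k • (f k - x i) := by
    rw [← Finset.sum_coe_sort t (fun i => φ i k • x i)]
    conv_lhs => rw [hf]
    simp only [hφ, smul_sub, Finset.sum_sub_distrib, Finset.smul_sum, mul_smul]
  rw [h1, norm_smul, Real.norm_of_nonneg (hχ k).1, mul_comm]
  refine mul_le_mul_of_nonneg_right ?_ (hχ k).1
  calc ‖∑ i : t, ψ i k • (f k - x i)‖ ≤ ∑ i : t, ψ i k * ε := by
        refine norm_sum_le_of_le _ fun i _ => ?_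
        rw [norm_smul, Real.norm_of_nonneg (ψ.nonneg i k)]
        by_cases hk : k ∈ tsupport (ψ i)
        · refine mul_le_mul_of_nonneg_left ?_ (ψ.nonneg i k)
          have := hψ i hk
          rw [← dist_eq_norm]
          exact le_of_lt this
        · rw [image_eq_zero_of_notMem_tsupport hk]
          simp
    _ ≤ ε := by
        rw [← Finset.sum_mul]
        exact mul_le_of_le_one_left hε.le hsum

/-- The elementary tensor `(k, s) ↦ φ(k) g(s)`. -/
def tensorCc {K H B : Type u} [TopologicalSpace K] [T2Space K] [TopologicalSpace H] [R1Space H]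
    [NormedAddCommGroup B] [NormedSpace ℝ B] (φ : C_c(K, ℝ)) (g : C_c(H, B)) :
    C_c(K × H, B) where
  toFun q := φ q.1 • g q.2
  continuous_toFun := by
    have := map_continuous φ
    have := map_continuous g
    fun_prop
  hasCompactSupport' := HasCompactSupport.intro
    (φ.hasCompactSupport.isCompact.prod g.hasCompactSupport.isCompact) fun q hq => by
      by_cases h : q.1 ∈ tsupport φ
      · rw [image_eq_zero_of_notMem_tsupport (f := g) fun h' => hq ⟨h, h'⟩, smul_zero]
      · rw [image_eq_zero_of_notMem_tsupport h, zero_smul]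

variable {K H B : Type u} [Group K] [TopologicalSpace K] [IsTopologicalGroup K] [T2Space K]
  [LocallyCompactSpace K] [ParacompactSpace K] [MeasurableSpace K] [BorelSpace K]
  [Group H] [TopologicalSpace H] [IsTopologicalGroup H] [MeasurableSpace H] [BorelSpace H]
  [NonUnitalNormedRing B] [NormedSpace ℂ B] [IsScalarTower ℂ B B] [SMulCommClass ℂ B B]
  [CompleteSpace B] {p : ℝ≥0∞} [Fact (1 ≤ p)] {α : IsometricAction H B}
  {μ : Measure H} [IsFiniteMeasureOnCompacts μ] [μ.IsMulLeftInvariant]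

/-- Functions of two variables are dense in an iterated crossed product. -/
theorem Crossed.denseRange_of_curryCc (ν : Measure K) [IsFiniteMeasureOnCompacts ν]
    (θ : IsometricAction K (Crossed p μ α)) :
    DenseRange fun F : C_c(K × H, B) => Crossed.of p ν θ (curryCc p μ α F) := by
  intro y
  refine Crossed.induction_on (P := fun y => y ∈ closure _) y isClosed_closure fun f => ?_
  -- The values are taken in the dense image of C_c(H, B), so each elementary tensor in the
  -- approximation comes from a function of two variables.
  obtain ⟨χ, hχ0, hχ⟩ := exists_approx_elementary
    (S := Set.range (Crossed.of p μ α)) Crossed.denseRange_of f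
  rw [Metric.mem_closure_iff]
  intro ε hε
  have hI : 0 ≤ ∫ k, χ k ∂ν := integral_nonneg hχ0
  -- Integrating the bound gives ε I/(I + 1) < ε with I = ∫ χ; the summand 1 covers I = 0 and makes
  -- the inequality strict.
  obtain ⟨t, φ, x, hx, hle⟩ := hχ (ε / (∫ k, χ k ∂ν + 1)) (by positivity)
  choose g hg using hx
  let F : C_c(K × H, B) := ∑ i ∈ t, tensorCc (φ i) (g i)
  refine ⟨_, ⟨F, rfl⟩, ?_⟩
  have hF : ∀ k, curryCc p μ α F k = ∑ i ∈ t, φ i k • x i := by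
    intro k
    have h1 : slice F k = ∑ i ∈ t, (φ i k : ℂ) • g i := by
      ext s
      rw [slice_apply, CompactlySupportedContinuousMap.sum_apply,
        CompactlySupportedContinuousMap.sum_apply]
      rfl
    rw [curryCc_apply, h1, map_sum]
    refine Finset.sum_congr rfl fun i _ => ?_
    rw [map_smul, hg]
    exact RCLike.real_smul_eq_coe_smul (K := ℂ) _ _ |>.symm
  rw [dist_eq_norm]
  change ‖Crossed.of p ν θ f - Crossed.of p ν θ _‖ < ε
  rw [← map_sub]
  refine (Crossed.norm_of_le _).trans_lt ?_
  have hχint : Integrable (fun k => χ k) ν :=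
    (map_continuous χ).integrable_of_hasCompactSupport χ.hasCompactSupport
  calc ∫ k, ‖(f - curryCc p μ α F) k‖ ∂ν ≤ ∫ k, ε / (∫ k, χ k ∂ν + 1) * χ k ∂ν := by
        refine integral_mono (integrable_norm_Cc ν _) (hχint.const_mul _) fun k => ?_
        change ‖f k - curryCc p μ α F k‖ ≤ _
        rw [hF]
        exact hle k
    _ = ε * ((∫ k, χ k ∂ν) / (∫ k, χ k ∂ν + 1)) := by
        rw [integral_const_mul]
        ring
    _ < ε := by
        refine mul_lt_of_lt_one_right hε ?_
        rw [div_lt_one (by positivity)]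
        linarith

end Approx


/-! ### Covariant homomorphisms into multiplier algebras -/

section MultiplierSystem

/-- A covariant homomorphism of a dynamical system `(H, B, α)` with unital `B` into the contractive
left multipliers of a Banach algebra `D`. -/
structure MultiplierSystem {H B : Type u} [Group H] [TopologicalSpace H] [NormedRing B]
    [NormedAlgebra ℂ B] (α : IsometricAction H B) (D : Type*) [NonUnitalNormedRing D]
    [NormedSpace ℂ D] where
  left : B →L[ℂ] D →L[ℂ] D
  left_mul_right : ∀ b x y, left b (x * y) = left b x * y
  left_mul : ∀ a b x, left (a * b) x = left a (left b x)
  left_one : ∀ x, left 1 x = x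
  norm_left_le : ∀ b, ‖left b‖ ≤ ‖b‖
  shift : H → D →L[ℂ] D
  shift_mul_right : ∀ s x y, shift s (x * y) = shift s x * y
  shift_mul : ∀ s t x, shift (s * t) x = shift s (shift t x)
  shift_one : ∀ x, shift 1 x = x
  norm_shift_le : ∀ s, ‖shift s‖ ≤ 1
  continuous_shift : ∀ x, Continuous fun s => shift s x
  covariant : ∀ s b x, shift s (left b x) = left (α.act s b) (shift s x)

variable {H B : Type u} [Group H] [TopologicalSpace H] [NormedRing B]
    [NormedAlgebra ℂ B] {α : IsometricAction H B} {D : Type*} [NonUnitalNormedRing D]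
    [NormedSpace ℂ D]

/-- The multiplier given by an element of the coefficient algebra. -/
def MultiplierSystem.leftMultiplier (M : MultiplierSystem α D) (b : B) : LeftMultiplier D :=
  ⟨M.left b, M.left_mul_right b⟩

/-- The multiplier given by an element of the group. -/
def MultiplierSystem.shiftMultiplier (M : MultiplierSystem α D) (s : H) : LeftMultiplier D :=
  ⟨M.shift s, M.shift_mul_right s⟩

section Rep

variable {E : Type*} [NormedAddCommGroup E] [NormedSpace ℂ E] [CompleteSpace E]
  (M : MultiplierSystem α D) (hD : HasContractiveLeftApproxUnit D) (π : NondegenerateRep D E)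

/-- The representation of the coefficient algebra. -/
def MultiplierSystem.algRep : B →ₙₐ[ℂ] (E →L[ℂ] E) where
  toFun b := π.extend hD (M.leftMultiplier b)
  map_smul' c b := π.clm_ext fun x ξ => by
    rw [π.extend_apply, _root_.smul_apply, MonoidHom.id_apply, π.extend_apply]
    change π.hom (M.left _ x) ξ = c • π.hom (M.left _ x) ξ
    rw [map_smul, _root_.smul_apply, map_smul]
    rfl
  map_zero' := π.clm_ext fun x ξ => by
    rw [π.extend_apply]
    change π.hom (M.left _ x) ξ = 0
    simp
  map_add' a b := π.clm_ext fun x ξ => by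
    rw [π.extend_apply, _root_.add_apply, π.extend_apply, π.extend_apply]
    change π.hom (M.left _ x) ξ = π.hom (M.left _ x) ξ + π.hom (M.left _ x) ξ
    rw [map_add, _root_.add_apply, map_add]
    rfl
  map_mul' a b := π.clm_ext fun x ξ => by
    rw [π.extend_apply]
    change _ = π.extend hD _ (π.extend hD _ _)
    rw [π.extend_apply, π.extend_apply]
    change π.hom (M.left _ x) ξ = π.hom (M.left _ (M.left _ x)) ξ
    rw [M.left_mul]

theorem MultiplierSystem.algRep_apply (b : B) (x : D) (ξ : E) :
    M.algRep hD π b (π.hom x ξ) = π.hom (M.left b x) ξ :=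
  π.extend_apply hD _ x ξ

theorem MultiplierSystem.norm_algRep_le (b : B) : ‖M.algRep hD π b‖ ≤ ‖b‖ :=
  (π.norm_extend_le hD _).trans (M.norm_left_le b)

theorem MultiplierSystem.algRep_one : M.algRep hD π 1 = 1 :=
  π.clm_ext fun x ξ => by
    rw [M.algRep_apply, M.left_one]
    rfl

/-- The representation of the group. -/
def MultiplierSystem.groupRep : H →* (E →L[ℂ] E) where
  toFun s := π.extend hD (M.shiftMultiplier s)
  map_one' := π.clm_ext fun x ξ => by
    rw [π.extend_apply]
    change π.hom (M.shift 1 x) ξ = π.hom x ξ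
    rw [M.shift_one]
  map_mul' s t := π.clm_ext fun x ξ => by
    rw [π.extend_apply]
    change _ = π.extend hD _ (π.extend hD _ _)
    rw [π.extend_apply, π.extend_apply]
    change π.hom (M.shift _ x) ξ = π.hom (M.shift _ (M.shift _ x)) ξ
    rw [M.shift_mul]

theorem MultiplierSystem.groupRep_apply (s : H) (x : D) (ξ : E) :
    M.groupRep hD π s (π.hom x ξ) = π.hom (M.shift s x) ξ :=
  π.extend_apply hD _ x ξ

theorem MultiplierSystem.norm_groupRep_apply_le (s : H) (ξ : E) :
    ‖M.groupRep hD π s ξ‖ ≤ ‖ξ‖ :=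
  ((M.groupRep hD π s).le_of_opNorm_le
    ((π.norm_extend_le hD _).trans (M.norm_shift_le s)) ξ).trans_eq (one_mul _)

/-- A contraction with contractive inverse is isometric. -/
theorem MultiplierSystem.norm_groupRep_apply (s : H) (ξ : E) :
    ‖M.groupRep hD π s ξ‖ = ‖ξ‖ := by
  refine le_antisymm (M.norm_groupRep_apply_le hD π s ξ) ?_
  have h : M.groupRep hD π s⁻¹ (M.groupRep hD π s ξ) = ξ := by
    change (M.groupRep hD π s⁻¹ * M.groupRep hD π s) ξ = ξ
    rw [← map_mul, inv_mul_cancel, map_one]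
    rfl
  conv_lhs => rw [← h]
  exact M.norm_groupRep_apply_le hD π _ _

/-- Vectors with continuous orbit form a subspace, closed because the operators are uniformly
contractive. It contains each π(x)η, since shifts of x vary continuously. -/
theorem MultiplierSystem.continuous_groupRep (ξ : E) :
    Continuous fun s => M.groupRep hD π s ξ := by
  let S : Submodule ℂ E :=
    { carrier := {ξ | Continuous fun s => M.groupRep hD π s ξ}
      add_mem' := fun {ξ η} hξ hη => by
        change Continuous fun s => M.groupRep hD π s (ξ + η)
        simp only [map_add]
        exact Continuous.add hξ hη
      zero_mem' := by
        change Continuous fun s => M.groupRep hD π s 0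
        simp only [map_zero]
        exact continuous_const
      smul_mem' := fun c ξ hξ => by
        change Continuous fun s => M.groupRep hD π s (c • ξ)
        simp only [map_smul]
        exact Continuous.const_smul hξ c }
  refine π.mem_of_isClosed S ?_ (fun x η => ?_) ξ
  · refine isClosed_of_closure_subset fun η hη => ?_
    change Continuous fun s => M.groupRep hD π s η
    refine continuous_of_uniform_approx_of_continuous fun V hV => ?_
    obtain ⟨ε, hε, hV⟩ := Metric.mem_uniformity_dist.1 hV
    obtain ⟨ζ, hζ, hd⟩ := Metric.mem_closure_iff.1 hη ε hε
    refine ⟨_, hζ, fun s => hV ?_⟩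
    rw [dist_eq_norm, ← map_sub]
    refine (M.norm_groupRep_apply_le hD π s _).trans_lt ?_
    rwa [← dist_eq_norm]
  · change Continuous fun s => M.groupRep hD π s (π.hom x η)
    simp only [M.groupRep_apply]
    exact (π.continuous_hom.comp (M.continuous_shift x)).clm_apply continuous_const

theorem MultiplierSystem.groupRep_algRep (s : H) (b : B) (ξ : E) :
    M.groupRep hD π s (M.algRep hD π b ξ) = M.algRep hD π (α.act s b) (M.groupRep hD π s ξ) := by
  have h : M.groupRep hD π s * M.algRep hD π b =
      M.algRep hD π (α.act s b) * M.groupRep hD π s := π.clm_ext fun x ξ => by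
    change M.groupRep hD π s (M.algRep hD π b (π.hom x ξ)) =
      M.algRep hD π (α.act s b) (M.groupRep hD π s (π.hom x ξ))
    rw [M.algRep_apply, M.groupRep_apply, M.groupRep_apply, M.algRep_apply, M.covariant]
  exact DFunLike.congr_fun h ξ

end Rep

variable {p : ℝ≥0∞} [Fact (1 ≤ p)] {X : Type u} [MeasurableSpace X] {ν : Measure X}
  [SigmaFinite ν]

/-- A nondegenerate representation of `D` on an `L^p` space induces a covariant representation
of any dynamical system acting on `D` by multipliers. -/
def MultiplierSystem.covRep (M : MultiplierSystem α D) (hD : HasContractiveLeftApproxUnit D)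
    (π : NondegenerateRep D (Lp ℂ p ν)) : CovRep p α where
  X := X
  ν := ν
  π := M.algRep hD π
  v := M.groupRep hD π
  norm_π_le := M.norm_algRep_le hD π
  nondegenerate := by
    refine dense_iff_closure_eq.2 (Set.eq_univ_of_forall fun ξ => subset_closure ?_)
    -- The unit of `B` acts as the identity, so every vector is already in the range.
    refine Submodule.subset_span ⟨1, ξ, ?_⟩
    rw [M.algRep_one]
    rfl
  norm_v := M.norm_groupRep_apply hD π
  continuous_v := M.continuous_groupRep hD π
  covariant t b := by
    ext1 ξ
    change M.groupRep hD π t (M.algRep hD π b (M.groupRep hD π t⁻¹ ξ)) = _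
    rw [M.groupRep_algRep]
    congr 1
    change (M.groupRep hD π t * M.groupRep hD π t⁻¹) ξ = ξ
    rw [← map_mul, mul_inv_cancel, map_one]
    rfl

variable [MeasurableSpace H] [BorelSpace H] {μ : Measure H} [IsFiniteMeasureOnCompacts μ]

theorem MultiplierSystem.integrable_left_shift (M : MultiplierSystem α D) (f : C_c(H, B)) (x : D) :
    Integrable (fun s => M.left (f s) (M.shift s x)) μ := by
  refine Continuous.integrable_of_hasCompactSupport
    ((M.left.continuous.comp (map_continuous f)).clm_apply (M.continuous_shift x)) ?_
  refine f.hasCompactSupport.mono ?_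
  intro s hs h0
  apply hs
  simp [h0]

variable [CompleteSpace D]

/-- The integrated form of the induced covariant representation. -/
theorem MultiplierSystem.integrated_covRep_apply (M : MultiplierSystem α D)
    (hD : HasContractiveLeftApproxUnit D) (π : NondegenerateRep D (Lp ℂ p ν))
    (f : C_c(H, B)) (x : D) (ξ : Lp ℂ p ν) :
    (M.covRep hD π).integrated μ f (π.hom x ξ) =
      π.hom (∫ s, M.left (f s) (M.shift s x) ∂μ) ξ := by
  refine Eq.trans ?_ ((π.clm.flip ξ).integral_comp_comm (M.integrable_left_shift f x))
  change ∫ s, M.algRep hD π (f s) (M.groupRep hD π s (π.hom x ξ)) ∂μ = _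
  congr 1
  ext1 s
  rw [M.groupRep_apply, M.algRep_apply]
  rfl

/-- If the multipliers integrate to multiplication by `y`, the integrated form is `π(y)`. -/
theorem MultiplierSystem.integrated_covRep (M : MultiplierSystem α D)
    (hD : HasContractiveLeftApproxUnit D) (π : NondegenerateRep D (Lp ℂ p ν))
    (f : C_c(H, B)) (y : D) (h : ∀ x, ∫ s, M.left (f s) (M.shift s x) ∂μ = y * x) :
    (M.covRep hD π).integrated μ f = π.hom y :=
  π.clm_ext fun x ξ => by
    refine (M.integrated_covRep_apply hD π f x ξ).trans ?_
    rw [h, map_mul]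
    rfl

end MultiplierSystem

/-- The multipliers of a crossed product. -/
def crossedMultiplierSystem {H B : Type u} [Group H] [TopologicalSpace H] [IsTopologicalGroup H]
    [LocallyCompactSpace H] [MeasurableSpace H] [BorelSpace H]
    [NormedRing B] [NormedAlgebra ℂ B] [CompleteSpace B] [NormOneClass B]
    (p : ℝ≥0∞) [Fact (1 ≤ p)] (μ : Measure H) [IsFiniteMeasureOnCompacts μ]
    [μ.IsMulLeftInvariant] [μ.IsOpenPosMeasure] (α : IsometricAction H B) :
    MultiplierSystem α (Crossed p μ α) where
  left := Crossed.leftMulL p μ α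
  left_mul_right b := (Crossed.leftMul p μ α b).map_mul
  left_mul := Crossed.leftMulClm_mul
  left_one := Crossed.leftMulClm_one
  norm_left_le := Crossed.norm_leftMulClm_le
  shift := Crossed.translateClm p μ α
  shift_mul_right s := (Crossed.translate p μ α s).map_mul
  shift_mul := Crossed.translateClm_mul
  shift_one := Crossed.translateClm_one
  norm_shift_le := Crossed.norm_translateClm_le
  continuous_shift := Crossed.continuous_translateClm
  covariant := Crossed.translateClm_leftMulClm

/-! ### Multipliers of `C_0(G, A)` -/

section C0

variable {G A : Type u} [TopologicalSpace G]
  [DiscreteTopology G] [NormedRing A] [NormedAlgebra ℂ A]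

theorem c0_norm_apply_le (f : C₀(G, A)) (t : G) : ‖f t‖ ≤ ‖f‖ := by
  rw [← ZeroAtInftyContinuousMap.norm_toBCF_eq_norm]
  exact f.toBCF.norm_coe_le_norm t

theorem c0_norm_le {f : C₀(G, A)} {C : ℝ} (hC : 0 ≤ C) (h : ∀ t, ‖f t‖ ≤ C) : ‖f‖ ≤ C := by
  rw [← ZeroAtInftyContinuousMap.norm_toBCF_eq_norm]
  exact (BoundedContinuousFunction.norm_le hC).2 h

/-- Evaluation at a point. -/
def c0Eval (t : G) : C₀(G, A) →L[ℂ] A :=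
  LinearMap.mkContinuous
    { toFun := fun f => f t
      map_add' := fun _ _ => rfl
      map_smul' := fun _ _ => rfl } 1 (fun f => by simpa using c0_norm_apply_le f t)

theorem c0Eval_apply (t : G) (f : C₀(G, A)) : c0Eval t f = f t := rfl

/-- In a discrete space compact sets are finite, so vanishing at infinity means convergence to zero
along the cofinite filter. -/
theorem finite_le_norm_c0 (f : C₀(G, A)) {ε : ℝ} (hε : 0 < ε) : {t | ε ≤ ‖f t‖}.Finite := by
  have h := f.zero_at_infty'
  rw [Filter.cocompact_eq_cofinite] at h
  have h2 := (h.norm.eventually_lt_const (show ‖(0 : A)‖ < ε by simpa using hε))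
  rw [Filter.eventually_cofinite] at h2
  exact h2.subset fun t ht => not_lt.2 ht

/-- Pointwise left multiplication by a bounded function. -/
def c0Mul (m : G → A) (C : ℝ) (hm : ∀ t, ‖m t‖ ≤ C) : C₀(G, A) →L[ℂ] C₀(G, A) :=
  LinearMap.mkContinuous
    { toFun := fun f =>
        { toFun := fun t => m t * f t
          continuous_toFun := continuous_of_discreteTopology
          zero_at_infty' := by
            refine squeeze_zero_norm (a := fun t => C * ‖f t‖) (fun t => ?_) ?_
            · exact (norm_mul_le _ _).trans
                (mul_le_mul_of_nonneg_right (hm t) (norm_nonneg _))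
            · simpa using f.zero_at_infty'.norm.const_mul C }
      map_add' := fun f g => by ext t; exact mul_add _ _ _
      -- If `G` is empty, `C` may be negative, while a supremum norm can only be bounded by a
      -- nonnegative constant; hence the maximum with 0.
      map_smul' := fun c f => by ext t; exact mul_smul_comm _ _ _ } (max C 0) (fun f => by
        refine c0_norm_le (by positivity) fun t => ?_
        change ‖m t * f t‖ ≤ _
        exact (norm_mul_le _ _).trans (mul_le_mul ((hm t).trans (le_max_left _ _))
          (c0_norm_apply_le f t) (norm_nonneg _) (le_max_right _ _)))

theorem c0Mul_apply (m : G → A) (C : ℝ) (hm : ∀ t, ‖m t‖ ≤ C) (f : C₀(G, A)) (t : G) :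
    c0Mul m C hm f t = m t * f t := rfl

theorem norm_c0Mul_le (m : G → A) (C : ℝ) (h0 : 0 ≤ C) (hm : ∀ t, ‖m t‖ ≤ C) :
    ‖c0Mul m C hm‖ ≤ C :=
  (LinearMap.mkContinuous_norm_le _ (le_max_right _ _) _).trans_eq (max_eq_left h0)

variable (G) in
/-- Left multiplication by constants. -/
def c0LeftMul : A →L[ℂ] C₀(G, A) →L[ℂ] C₀(G, A) :=
  LinearMap.mkContinuous (E := A) (F := C₀(G, A) →L[ℂ] C₀(G, A))
    { toFun := fun a => c0Mul (fun _ : G => a) ‖a‖ (fun _ => le_rfl)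
      map_add' := fun a b => by ext f t; exact add_mul _ _ _
      map_smul' := fun c a => by ext f t; exact smul_mul_assoc _ _ _ } 1
    (fun a => by simpa using norm_c0Mul_le _ _ (norm_nonneg a) _)

theorem c0LeftMul_apply (a : A) (f : C₀(G, A)) (t : G) : c0LeftMul G a f t = a * f t := rfl

variable [NormOneClass A]

-- Indicators of finite sets form the unit: they have norm at most 1, and f is smaller than ε/2 off
-- a finite set.
variable (G A) in
theorem c0_hasContractiveLeftApproxUnit : HasContractiveLeftApproxUnit C₀(G, A) := by
  classical
  let e : Finset G → C₀(G, A) := fun F =>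
    { toFun := fun t => if t ∈ F then 1 else 0
      continuous_toFun := continuous_of_discreteTopology
      zero_at_infty' := by
        rw [Filter.cocompact_eq_cofinite]
        refine tendsto_const_nhds.congr' ?_
        rw [Filter.EventuallyEq, Filter.eventually_cofinite]
        refine F.finite_toSet.subset fun t ht => ?_
        by_contra h
        exact ht (if_neg h).symm }
  have he : ∀ F t, e F t = if t ∈ F then 1 else 0 := fun _ _ => rfl
  refine ⟨Filter.atTop.map e, inferInstance, Filter.eventually_map.2 (Filter.Eventually.of_forall
    fun F => c0_norm_le zero_le_one fun t => ?_), fun f => ?_⟩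
  · rw [he]
    split_ifs <;> simp
  · rw [Filter.tendsto_map'_iff, Metric.tendsto_nhds]
    intro ε hε
    filter_upwards [Filter.eventually_ge_atTop (finite_le_norm_c0 f (half_pos hε)).toFinset]
      with F hF
    rw [dist_eq_norm]
    refine lt_of_le_of_lt (c0_norm_le (half_pos hε).le fun t => ?_) (half_lt_self hε)
    change ‖e F t * f t - f t‖ ≤ _
    rw [he]
    split_ifs with h
    · simpa using (half_pos hε).le
    · rw [zero_mul, zero_sub, norm_neg]
      by_contra hlt
      exact h (hF ((Set.Finite.mem_toFinset _).2 (not_le.1 hlt).le))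

end C0

/-! ### The Fourier transform `C(Ĝ, A) → C_0(G, A)` -/

section Fourier

variable {G A : Type u} [CommGroup G] [TopologicalSpace G] [IsTopologicalGroup G]
  [DiscreteTopology G] [NormedRing A] [NormedAlgebra ℂ A] [NormOneClass A]

theorem norm_conj_dual (γ : PontryaginDual G) (t : G) :
    ‖(starRingEnd ℂ (γ t : ℂ)) • (1 : A)‖ ≤ 1 := by
  rw [norm_smul, norm_one, mul_one, RCLike.norm_conj, Circle.norm_coe]

variable (A) in
/-- Multiplication by the conjugate of a character on `C_0(G, A)`. -/
def c0Char (γ : PontryaginDual G) : C₀(G, A) →L[ℂ] C₀(G, A) :=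
  c0Mul (fun t => (starRingEnd ℂ (γ t : ℂ)) • 1) 1 (norm_conj_dual γ)

theorem c0Char_apply (γ : PontryaginDual G) (f : C₀(G, A)) (t : G) :
    c0Char A γ f t = (starRingEnd ℂ (γ t : ℂ)) • f t := by
  rw [c0Char, c0Mul_apply, smul_mul_assoc, one_mul]

theorem continuous_dual_apply (t : G) : Continuous fun γ : PontryaginDual G => (γ t : ℂ) := by
  have h : Continuous fun z : Circle => (z : ℂ) := by fun_prop
  exact h.comp (continuous_dual_eval.comp (continuous_id.prodMk continuous_const))

/-- Where ‖f(t)‖ < ε/4 the difference is below ε/2 for any two characters, these being unimodular.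
Only finitely many t remain, and at each the evaluation is continuous in γ. The continuity is thus
strong, which is all a multiplier system needs. -/
theorem continuous_c0Char (f : C₀(G, A)) : Continuous fun γ => c0Char A γ f := by
  rw [continuous_iff_continuousAt]
  intro γ₀
  rw [ContinuousAt, Metric.tendsto_nhds]
  intro ε hε
  have h1 : ∀ t : G, ∀ᶠ γ in 𝓝 γ₀, ‖c0Char A γ f t - c0Char A γ₀ f t‖ < ε / 2 := by
    intro t
    have hc : Continuous fun γ => c0Char A γ f t := by
      simp only [c0Char_apply]
      exact (Complex.continuous_conj.comp (continuous_dual_apply t)).smul continuous_const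
    have := (Metric.tendsto_nhds.1 (hc.tendsto γ₀)) (ε / 2) (half_pos hε)
    simpa only [dist_eq_norm] using this
  have h2 := (Filter.eventually_all_finset (finite_le_norm_c0 f
    (show 0 < ε / 4 by positivity)).toFinset).2 fun t _ => h1 t
  filter_upwards [h2] with γ hγ
  rw [dist_eq_norm]
  refine lt_of_le_of_lt (c0_norm_le (half_pos hε).le fun t => ?_) (half_lt_self hε)
  change ‖c0Char A γ f t - c0Char A γ₀ f t‖ ≤ _
  by_cases ht : ε / 4 ≤ ‖f t‖
  · exact (hγ t ((Set.Finite.mem_toFinset _).2 ht)).le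
  · refine (norm_sub_le _ _).trans ?_
    rw [c0Char_apply, c0Char_apply, norm_smul, norm_smul, RCLike.norm_conj, RCLike.norm_conj,
      Circle.norm_coe, Circle.norm_coe]
    linarith

variable (G A) in
/-- The multipliers of `C_0(G, A)` given by constants and characters. -/
def c0MultiplierSystem : MultiplierSystem (trivialAction (PontryaginDual G) A) C₀(G, A) where
  left := c0LeftMul G
  left_mul_right b x y := by ext t; exact (mul_assoc _ _ _).symm
  left_mul a b x := by ext t; exact mul_assoc _ _ _
  left_one x := by ext t; exact one_mul _
  norm_left_le b := norm_c0Mul_le _ _ (norm_nonneg b) (fun _ => le_rfl)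
  shift := c0Char A
  shift_mul_right s x y := by ext t; exact (mul_assoc _ _ _).symm
  shift_mul s t x := by
    ext r
    have : (s * t) r = s r * t r := rfl
    rw [c0Char_apply, c0Char_apply, c0Char_apply, this, Circle.coe_mul, map_mul, mul_smul]
  shift_one x := by
    ext r
    rw [c0Char_apply]
    simp
  norm_shift_le s := norm_c0Mul_le _ _ zero_le_one _
  continuous_shift := continuous_c0Char
  covariant s b x := by
    ext t
    rw [c0Char_apply]
    change _ = b * c0Char A s x t
    rw [c0Char_apply, c0LeftMul_apply, mul_smul_comm]

/-- Characters of a discrete abelian group separate points. -/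
theorem exists_dual_apply_ne_one {t : G} (ht : t ≠ 1) : ∃ γ : PontryaginDual G, γ t ≠ 1 := by
  -- Homomorphisms to ℚ/ℤ separate the points of an abelian group. Composing with the injection ℚ/ℤ
  -- → ℝ/ℤ and with ℝ/ℤ → Circle gives a unitary character, continuous because `G` is discrete.
  obtain ⟨χ, hχ⟩ := CharacterModule.exists_character_apply_ne_zero_of_ne_zero
    (A := Additive G) (a := Additive.ofMul t) (fun h => ht h)
  let c : AddCircle (1 : ℚ) →+ AddCircle (1 : ℝ) :=
    QuotientAddGroup.map _ _ (Rat.castHom ℝ).toAddMonoidHom (by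
      rw [AddSubgroup.zmultiples_le]
      exact ⟨1, by simp⟩)
  have hc : ∀ x, c x = 0 → x = 0 := by
    intro x
    refine QuotientAddGroup.induction_on x fun q hq => ?_
    have hq' : ((q : ℝ) : AddCircle (1 : ℝ)) = 0 := hq
    rw [AddCircle.coe_eq_zero_iff] at hq'
    obtain ⟨n, hn⟩ := hq'
    refine (AddCircle.coe_eq_zero_iff (1 : ℚ)).2 ⟨n, ?_⟩
    simp only [zsmul_eq_mul, mul_one] at hn ⊢
    exact_mod_cast hn
  let γ : G →* Circle :=
    { toFun := fun g => AddCircle.toCircle (c (χ (Additive.ofMul g)))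
      map_one' := by
        rw [ofMul_one, map_zero, map_zero, AddCircle.toCircle_zero]
      map_mul' := fun g h => by
        rw [ofMul_mul, map_add, map_add, AddCircle.toCircle_add] }
  let γ' : PontryaginDual G :=
    ({ γ with continuous_toFun := continuous_of_discreteTopology } : G →ₜ* Circle)
  refine ⟨γ', fun h => hχ (hc _ ?_)⟩
  have h' : AddCircle.toCircle (c (χ (Additive.ofMul t))) = 1 := h
  rw [← AddCircle.toCircle_zero (T := (1 : ℝ))] at h'
  exact AddCircle.injective_toCircle one_ne_zero h'

variable [MeasurableSpace (PontryaginDual G)] [BorelSpace (PontryaginDual G)]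
  (μ : Measure (PontryaginDual G)) [IsProbabilityMeasure μ] [μ.IsMulLeftInvariant]

/-- Translation by γ₀ leaves the integral unchanged but multiplies it by γ₀(t), and γ₀ can be chosen
with γ₀(t) ≠ 1. -/
theorem integral_dual_apply_eq_zero {t : G} (ht : t ≠ 1) :
    ∫ γ : PontryaginDual G, (γ t : ℂ) ∂μ = 0 := by
  obtain ⟨γ₀, h⟩ := exists_dual_apply_ne_one ht
  have h1 := integral_mul_left_eq_self (μ := μ) (fun γ : PontryaginDual G => (γ t : ℂ)) γ₀
  have h2 : ∀ γ : PontryaginDual G, (((γ₀ * γ) t : Circle) : ℂ) = (γ₀ t : ℂ) * (γ t : ℂ) :=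
    fun γ => Circle.coe_mul _ _
  simp only [h2] at h1
  rw [integral_const_mul] at h1
  have h3 : ((γ₀ t : ℂ) - 1) * ∫ γ : PontryaginDual G, (γ t : ℂ) ∂μ = 0 := by
    rw [sub_mul, h1, one_mul, sub_self]
  refine (mul_eq_zero.1 h3).resolve_left fun h4 => h ?_
  exact Circle.ext (by rw [sub_eq_zero.1 h4]; rfl)

/-- The character of `Ĝ` defined by an element of `G`, as a continuous function. -/
def dualEvalMap (t : G) : C(PontryaginDual G, ℂ) := ⟨fun γ => γ t, continuous_dual_apply t⟩

/-- The inner product of the characters at s and t is the integral of γ(s⁻¹t), which is 1 if s = t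
and 0 otherwise. -/
theorem orthonormal_dualEvalMap :
    Orthonormal ℂ fun t : G => ContinuousMap.toLp 2 μ ℂ (dualEvalMap t) := by
  classical
  rw [orthonormal_iff_ite]
  intro s t
  rw [ContinuousMap.inner_toLp]
  have h : ∀ γ : PontryaginDual G, dualEvalMap t γ * starRingEnd ℂ (dualEvalMap s γ) =
      (γ (s⁻¹ * t) : ℂ) := by
    intro γ
    change (γ t : ℂ) * starRingEnd ℂ (γ s : ℂ) = _
    rw [map_mul, map_inv, Circle.coe_mul, Circle.coe_inv_eq_conj, mul_comm]
  simp only [h]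
  split_ifs with hst
  · subst hst
    simp
  · exact integral_dual_apply_eq_zero μ fun h => hst (inv_mul_eq_one.1 h)

/-- By Bessel's inequality the squared moduli of the coefficients are summable, so the coefficients
tend to zero along the cofinite filter. -/
theorem tendsto_scalar_coeff (φ : C(PontryaginDual G, ℂ)) :
    Filter.Tendsto (fun t : G => ∫ γ : PontryaginDual G, starRingEnd ℂ (γ t : ℂ) * φ γ ∂μ)
      Filter.cofinite (𝓝 0) := by
  have h := ((orthonormal_dualEvalMap (G := G) μ).inner_products_summable
    (ContinuousMap.toLp 2 μ ℂ φ)).tendsto_cofinite_zero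
  rw [tendsto_zero_iff_norm_tendsto_zero]
  have h2 := h.sqrt
  rw [Real.sqrt_zero] at h2
  refine h2.congr fun t => ?_
  rw [Real.sqrt_sq (norm_nonneg _), ContinuousMap.inner_toLp]
  congr 2
  ext1 γ
  exact mul_comm _ _

theorem integrable_coeff (f : C_c(PontryaginDual G, A)) (t : G) :
    Integrable (fun γ : PontryaginDual G => starRingEnd ℂ (γ t : ℂ) • f γ) μ :=
  ((Complex.continuous_conj.comp (continuous_dual_apply t)).smul
    (map_continuous f)).integrable_of_hasCompactSupport f.hasCompactSupport.smul_left

variable [CompleteSpace A]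

/-- The Riemann–Lebesgue lemma. -/
theorem tendsto_coeff (f : C_c(PontryaginDual G, A)) :
    Filter.Tendsto (fun t : G => ∫ γ : PontryaginDual G, starRingEnd ℂ (γ t : ℂ) • f γ ∂μ)
      Filter.cofinite (𝓝 0) := by
  -- Bessel's inequality is available only for scalar functions. An elementary-tensor approximation
  -- within ε/2 in L¹ reduces `f` to a finite sum of scalar functions times vectors; the L¹ norm
  -- bounds all Fourier coefficients at once.
  obtain ⟨χ, hχ0, hχ⟩ := exists_approx_elementary (dense_univ (X := A)) f
  have hχint : Integrable (fun k => χ k) μ :=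
    (map_continuous χ).integrable_of_hasCompactSupport χ.hasCompactSupport
  have hI : 0 ≤ ∫ k, χ k ∂μ := integral_nonneg hχ0
  rw [Metric.tendsto_nhds]
  intro ε hε
  obtain ⟨t, φ, x, -, hle⟩ := hχ (ε / 2 / (∫ k, χ k ∂μ + 1)) (by positivity)
  let ψ : PontryaginDual G → C(PontryaginDual G, ℂ) := fun i =>
    ⟨fun γ => (φ i γ : ℂ), Complex.continuous_ofReal.comp (map_continuous (φ i))⟩
  have hlim : Filter.Tendsto (fun r : G => ∑ i ∈ t,
      (∫ γ : PontryaginDual G, starRingEnd ℂ (γ r : ℂ) * ψ i γ ∂μ) • x i)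
      Filter.cofinite (𝓝 0) := by
    have := tendsto_finsetSum t fun i _ => (tendsto_scalar_coeff μ (ψ i)).smul_const (x i)
    simpa using this
  filter_upwards [Metric.tendsto_nhds.1 hlim (ε / 2) (half_pos hε)] with r hr
  rw [dist_zero_right] at hr ⊢
  have hcont : ∀ i, Continuous fun γ : PontryaginDual G => starRingEnd ℂ (γ r : ℂ) * ψ i γ :=
    fun i => (Complex.continuous_conj.comp (continuous_dual_apply r)).mul (ψ i).continuous
  have hint : ∀ i, Integrable (fun γ : PontryaginDual G => starRingEnd ℂ (γ r : ℂ) * ψ i γ) μ :=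
    fun i => (hcont i).integrable_of_hasCompactSupport (HasCompactSupport.of_compactSpace _)
  have hsum : ∑ i ∈ t, (∫ γ : PontryaginDual G, starRingEnd ℂ (γ r : ℂ) * ψ i γ ∂μ) • x i =
      ∫ γ : PontryaginDual G, ∑ i ∈ t, (starRingEnd ℂ (γ r : ℂ) * ψ i γ) • x i ∂μ := by
    rw [integral_finsetSum _ fun i _ => (hint i).smul_const _]
    simp only [integral_smul_const]
  have hdiff : ‖(∫ γ : PontryaginDual G, starRingEnd ℂ (γ r : ℂ) • f γ ∂μ) -
      ∑ i ∈ t, (∫ γ : PontryaginDual G, starRingEnd ℂ (γ r : ℂ) * ψ i γ ∂μ) • x i‖ ≤ ε / 2 := by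
    rw [hsum, ← integral_sub (integrable_coeff μ f r)
      (integrable_finsetSum _ fun i _ => (hint i).smul_const _)]
    calc _ ≤ ∫ k, ε / 2 / (∫ k, χ k ∂μ + 1) * χ k ∂μ := by
          refine norm_integral_le_of_norm_le (hχint.const_mul _)
            (Filter.Eventually.of_forall fun γ => ?_)
          have : starRingEnd ℂ (γ r : ℂ) • f γ - ∑ i ∈ t, (starRingEnd ℂ (γ r : ℂ) * ψ i γ) • x i =
              starRingEnd ℂ (γ r : ℂ) • (f γ - ∑ i ∈ t, φ i γ • x i) := by
            simp only [smul_sub, Finset.smul_sum, mul_smul]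
            rfl
          rw [this, norm_smul, RCLike.norm_conj, Circle.norm_coe, one_mul]
          exact hle γ
      _ = ε / 2 * ((∫ k, χ k ∂μ) / (∫ k, χ k ∂μ + 1)) := by
          rw [integral_const_mul]
          ring
      _ ≤ ε / 2 := by
          refine mul_le_of_le_one_right (half_pos hε).le ?_
          rw [div_le_one (by positivity)]
          linarith
  have := norm_sub_norm_le (∫ γ : PontryaginDual G, starRingEnd ℂ (γ r : ℂ) • f γ ∂μ)
    (∑ i ∈ t, (∫ γ : PontryaginDual G, starRingEnd ℂ (γ r : ℂ) * ψ i γ ∂μ) • x i)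
  linarith

/-- The Fourier transform of a continuous function on `Ĝ`. -/
def fourierC0 (f : C_c(PontryaginDual G, A)) : C₀(G, A) where
  toFun t := ∫ γ : PontryaginDual G, starRingEnd ℂ (γ t : ℂ) • f γ ∂μ
  continuous_toFun := continuous_of_discreteTopology
  zero_at_infty' := by
    rw [Filter.cocompact_eq_cofinite]
    exact tendsto_coeff μ f

theorem fourierC0_apply (f : C_c(PontryaginDual G, A)) (t : G) :
    fourierC0 μ f t = ∫ γ : PontryaginDual G, starRingEnd ℂ (γ t : ℂ) • f γ ∂μ := rfl

/-- Evaluation at t commutes with the integral and turns the integrand into conj(γ(t)) f(γ) g(t).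
This feeds `MultiplierSystem.integrated_covRep`, so the induced integrated form is the
representation of the Fourier transform. -/
theorem integral_c0MultiplierSystem (f : C_c(PontryaginDual G, A)) (g : C₀(G, A)) :
    ∫ γ, (c0MultiplierSystem G A).left (f γ) ((c0MultiplierSystem G A).shift γ g) ∂μ =
      fourierC0 μ f * g := by
  ext t
  rw [← c0Eval_apply, ← ContinuousLinearMap.integral_comp_comm _
    ((c0MultiplierSystem G A).integrable_left_shift f g)]
  change _ = fourierC0 μ f t * g t
  rw [fourierC0_apply, ← integral_mul_const_of_integrable (integrable_coeff μ f t)]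
  congr 1
  ext1 γ
  change f γ * c0Char A γ g t = _
  rw [c0Char_apply, mul_smul_comm, smul_mul_assoc]

end Fourier


/-! ### The homomorphism `Φ₁` -/

instance isOpenPosMeasure_count {G : Type u} [TopologicalSpace G] [MeasurableSpace G]
    [BorelSpace G] : (Measure.count : Measure G).IsOpenPosMeasure where
  open_pos U _ hne := by
    rw [Measure.count_ne_zero_iff]
    exact hne

section Phi

variable {G A : Type u} [CommGroup G] [TopologicalSpace G] [IsTopologicalGroup G]
  [DiscreteTopology G] [NormedRing A] [NormedAlgebra ℂ A] [CompleteSpace A] [NormOneClass A]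
  [MeasurableSpace G] [BorelSpace G]
  [MeasurableSpace (PontryaginDual G)] [BorelSpace (PontryaginDual G)]
  {p : ℝ≥0∞} [Fact (1 ≤ p)] {μ : Measure (PontryaginDual G)} [IsProbabilityMeasure μ]
  [μ.IsMulLeftInvariant] [μ.IsOpenPosMeasure] {α : IsometricAction G A}

/-- The function `(s, γ) ↦ γ(s) F(γ, s)`. -/
def swapTwistCc (F : C_c(PontryaginDual G × G, A)) : C_c(G × PontryaginDual G, A) where
  toFun q := (q.2 q.1 : ℂ) • F (q.2, q.1)
  continuous_toFun := by
    have h1 := map_continuous F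
    have h2 : Continuous fun z : Circle => (z : ℂ) := by fun_prop
    exact (h2.comp (continuous_dual_eval.comp continuous_swap)).smul (h1.comp continuous_swap)
  hasCompactSupport' := by
    refine (F.hasCompactSupport.comp_homeomorph
      (Homeomorph.prodComm G (PontryaginDual G))).mono fun q hq h0 => hq ?_
    have h : F (q.2, q.1) = 0 := h0
    simp only [h, smul_zero]

theorem dualTensorMap_leftMulClm (s : G) (a : A)
    (x : Crossed p μ (trivialAction (PontryaginDual G) A)) :
    dualTensorMap μ α p s (Crossed.leftMulClm p μ _ a x) =
      Crossed.leftMulClm p μ _ (α.act s a) (dualTensorMap μ α p s x) := by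
  induction x using Crossed.induction_on with
  | hc =>
    exact isClosed_eq ((continuous_dualTensorMap μ α s).comp (ContinuousLinearMap.continuous _))
      ((ContinuousLinearMap.continuous _).comp (continuous_dualTensorMap μ α s))
  | h f =>
    rw [Crossed.leftMulClm_of, dualTensorMap_of, dualTensorMap_of, Crossed.leftMulClm_of]
    congr 1
    ext γ
    rw [dualTensor_formula, leftMulCc_apply, leftMulCc_apply, dualTensor_formula, map_mul,
      mul_smul_comm]

/-- Source of the Weyl relation: γ'(s) = γ(s) · (γ⁻¹γ')(s), so multiplication by evaluation at s and
translation by γ commute up to the scalar γ(s). -/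
theorem dualTensorMap_translateClm (s : G) (γ : PontryaginDual G)
    (x : Crossed p μ (trivialAction (PontryaginDual G) A)) :
    dualTensorMap μ α p s (Crossed.translateClm p μ _ γ x) =
      (γ s : ℂ) • Crossed.translateClm p μ _ γ (dualTensorMap μ α p s x) := by
  induction x using Crossed.induction_on with
  | hc =>
    exact isClosed_eq ((continuous_dualTensorMap μ α s).comp (ContinuousLinearMap.continuous _))
      (Continuous.const_smul ((Crossed.translateClm p μ (trivialAction (PontryaginDual G) A) γ).continuous.comp
        (continuous_dualTensorMap μ α s)) (γ s : ℂ))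
  | h f =>
    rw [Crossed.translateClm_of, dualTensorMap_of, dualTensorMap_of, Crossed.translateClm_of,
      ← map_smul]
    congr 1
    ext γ'
    rw [dualTensor_formula, translateCc_apply, CompactlySupportedContinuousMap.smul_apply,
      translateCc_apply, dualTensor_formula]
    change (γ' s : ℂ) • α.act s (f (γ⁻¹ * γ')) =
      (γ s : ℂ) • (((γ⁻¹ * γ') s : Circle) : ℂ) • α.act s (f (γ⁻¹ * γ'))
    have h : γ s * (γ⁻¹ * γ') s = γ' s := by
      change γ s * ((γ s)⁻¹ * γ' s) = γ' s
      rw [mul_inv_cancel_left]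
    rw [smul_smul, ← Circle.coe_mul, h]

/-- The covariant representation of `(Ĝ, A)` underlying a representation of `F^p(Ĝ, A, β)`. -/
def CovRep.disintegrate (ρ : CovRep p (dualTensor μ α p)) :
    CovRep p (trivialAction (PontryaginDual G) A) :=
  (crossedMultiplierSystem p μ (trivialAction (PontryaginDual G) A)).covRep
    (Crossed.hasContractiveLeftApproxUnit p _ μ) ρ.toNondegenerateRep

/-- Left multiplication by f is the integral of its multipliers, so reintegrating the extracted pair
recovers the original representation. -/
theorem CovRep.integrated_disintegrate (ρ : CovRep p (dualTensor μ α p))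
    (f : C_c(PontryaginDual G, A)) :
    ρ.disintegrate.integrated μ f = ρ.π (Crossed.of p μ _ f) :=
  MultiplierSystem.integrated_covRep _ _ _ _ _ fun x => (Crossed.of_mul_eq_integral f x).symm

/-- The algebra part of the disintegration, acting on the original space. -/
def CovRep.disintegrateAlg (ρ : CovRep p (dualTensor μ α p)) : A →ₙₐ[ℂ] (ρ.E →L[ℂ] ρ.E) :=
  ρ.disintegrate.π

/-- The group part of the disintegration, acting on the original space. -/
def CovRep.disintegrateGroup (ρ : CovRep p (dualTensor μ α p)) :
    PontryaginDual G →* (ρ.E →L[ℂ] ρ.E) :=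
  ρ.disintegrate.v

theorem CovRep.disintegrateAlg_apply (ρ : CovRep p (dualTensor μ α p)) (a : A)
    (x : Crossed p μ (trivialAction (PontryaginDual G) A)) (ξ : ρ.E) :
    ρ.disintegrateAlg a (ρ.π x ξ) = ρ.π (Crossed.leftMulClm p μ _ a x) ξ :=
  MultiplierSystem.algRep_apply _ _ ρ.toNondegenerateRep a x ξ

theorem CovRep.disintegrateGroup_apply (ρ : CovRep p (dualTensor μ α p)) (γ : PontryaginDual G)
    (x : Crossed p μ (trivialAction (PontryaginDual G) A)) (ξ : ρ.E) :
    ρ.disintegrateGroup γ (ρ.π x ξ) = ρ.π (Crossed.translateClm p μ _ γ x) ξ :=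
  MultiplierSystem.groupRep_apply _ _ ρ.toNondegenerateRep γ x ξ

theorem CovRep.disintegrate_comm (ρ : CovRep p (dualTensor μ α p)) (γ : PontryaginDual G)
    (a : A) (ξ : ρ.E) :
    ρ.disintegrateGroup γ (ρ.disintegrateAlg a ξ) =
      ρ.disintegrateAlg a (ρ.disintegrateGroup γ ξ) :=
  ρ.disintegrate.v_π γ a ξ

/-- On vectors π(x)ξ, covariance moves v_s past π(x) and replaces a x by its image under (β̂ ⊗ α)_s,
which carries the multiplier a to α_s(a). -/
theorem CovRep.v_disintegrateAlg (ρ : CovRep p (dualTensor μ α p)) (s : G) (a : A) (ξ : ρ.E) :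
    ρ.v s (ρ.disintegrateAlg a ξ) = ρ.disintegrateAlg (α.act s a) (ρ.v s ξ) := by
  have key : ∀ x ξ, ρ.v s (ρ.disintegrateAlg a (ρ.π x ξ)) =
      ρ.disintegrateAlg (α.act s a) (ρ.v s (ρ.π x ξ)) := fun x ξ => by
    refine (congrArg (ρ.v s) (ρ.disintegrateAlg_apply a x ξ)).trans ((ρ.v_π s _ ξ).trans ?_)
    refine Eq.trans ?_ (congrArg (ρ.disintegrateAlg (α.act s a)) (ρ.v_π s x ξ)).symm
    refine Eq.trans ?_ (ρ.disintegrateAlg_apply (α.act s a) _ (ρ.v s ξ)).symm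
    exact congrArg (fun y => ρ.π y (ρ.v s ξ)) (dualTensorMap_leftMulClm s a x)
  exact DFunLike.congr_fun (ρ.toNondegenerateRep.clm_ext
    (S := (ρ.v s).comp (ρ.disintegrateAlg a))
    (T := (ρ.disintegrateAlg (α.act s a)).comp (ρ.v s)) key) ξ

/-- The Weyl relation between G and Ĝ, inherited from `dualTensorMap_translateClm` on the vectors
π(x)ξ. -/
theorem CovRep.v_disintegrateGroup (ρ : CovRep p (dualTensor μ α p)) (s : G)
    (γ : PontryaginDual G) (ξ : ρ.E) :
    ρ.v s (ρ.disintegrateGroup γ ξ) = (γ s : ℂ) • ρ.disintegrateGroup γ (ρ.v s ξ) := by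
  have key : ∀ x ξ, ρ.v s (ρ.disintegrateGroup γ (ρ.π x ξ)) =
      (γ s : ℂ) • ρ.disintegrateGroup γ (ρ.v s (ρ.π x ξ)) := fun x ξ => by
    refine (congrArg (ρ.v s) (ρ.disintegrateGroup_apply γ x ξ)).trans ((ρ.v_π s _ ξ).trans ?_)
    refine Eq.trans ?_ (congrArg (fun η => (γ s : ℂ) • ρ.disintegrateGroup γ η)
      (ρ.v_π s x ξ)).symm
    refine Eq.trans ?_ (congrArg (fun η => (γ s : ℂ) • η)
      (ρ.disintegrateGroup_apply γ _ (ρ.v s ξ))).symm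
    refine (congrArg (fun y => ρ.π y (ρ.v s ξ)) (dualTensorMap_translateClm s γ x)).trans ?_
    exact DFunLike.congr_fun (map_smul ρ.π (γ s : ℂ) _) (ρ.v s ξ)
  exact DFunLike.congr_fun (ρ.toNondegenerateRep.clm_ext
    (S := (ρ.v s).comp (ρ.disintegrateGroup γ))
    (T := (γ s : ℂ) • (ρ.disintegrateGroup γ).comp (ρ.v s)) key) ξ

/-- The covariant representation of `(G, A, α)` underlying a covariant representation of
`(G, F^p(Ĝ, A, β), β̂ ⊗ α)`. -/
def CovRep.innerRep (ρ : CovRep p (dualTensor μ α p)) : CovRep p α where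
  X := ρ.X
  ν := ρ.ν
  π := ρ.disintegrateAlg
  v := ρ.v
  norm_π_le := ρ.disintegrate.norm_π_le
  nondegenerate := ρ.disintegrate.nondegenerate
  norm_v := ρ.norm_v
  continuous_v := ρ.continuous_v
  covariant t a := by
    ext1 ξ
    change ρ.v t (ρ.disintegrateAlg a (ρ.v t⁻¹ ξ)) = _
    rw [ρ.v_disintegrateAlg]
    congr 1
    change (ρ.v t * ρ.v t⁻¹) ξ = ξ
    rw [← map_mul, mul_inv_cancel, map_one]
    rfl

/-- Read backwards, the Weyl relation says w_γ v_s = conj(γ(s)) v_s w_γ, while w_γ commutes with A.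
Conjugation by w_γ therefore implements the dual action on the integrated form. -/
theorem CovRep.disintegrateGroup_innerRep (ρ : CovRep p (dualTensor μ α p))
    (γ : PontryaginDual G) (f : C_c(G, A)) (ξ : ρ.E) :
    ρ.disintegrateGroup γ (ρ.innerRep.integrated Measure.count f ξ) =
      ρ.innerRep.integrated Measure.count (twistCc γ f) (ρ.disintegrateGroup γ ξ) := by
  refine ρ.innerRep.apply_integrated γ (ρ.disintegrateGroup γ) (ρ.disintegrate_comm γ)
    (fun s η => ?_) f ξ
  have h : starRingEnd ℂ (γ s : ℂ) * (γ s : ℂ) = 1 := by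
    rw [← Circle.coe_inv_eq_conj, ← Circle.coe_mul, inv_mul_cancel]
    rfl
  have h1 := congrArg (fun ζ => starRingEnd ℂ (γ s : ℂ) • ζ) (ρ.v_disintegrateGroup s γ η)
  simp only [smul_smul, h, one_smul] at h1
  exact h1.symm

/-- The covariant representation of `(Ĝ, F^p(G, A, α), α̂)` induced by one of
`(G, F^p(Ĝ, A, β), β̂ ⊗ α)`. -/
def CovRep.swapRep (ρ : CovRep p (dualTensor μ α p)) :
    CovRep p (dualAction p (Measure.count : Measure G) α) where
  X := ρ.X
  ν := ρ.ν
  π := ρ.innerRep.integratedHom Measure.count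
  v := ρ.disintegrateGroup
  norm_π_le := ρ.innerRep.norm_integratedHom_le
  nondegenerate := (ρ.innerRep.integratedRep Measure.count).nondegenerate
  norm_v := ρ.disintegrate.norm_v
  continuous_v := ρ.disintegrate.continuous_v
  covariant γ x := by
    refine ρ.innerRep.mul_integratedHom_mul (ρ.disintegrateGroup γ) (ρ.disintegrateGroup γ⁻¹)
      (Crossed.continuous_twist γ) (fun f => ?_) x
    rw [Crossed.twist_of, ρ.innerRep.integratedHom_of]
    refine ContinuousLinearMap.ext fun ξ => ?_
    refine (ρ.disintegrateGroup_innerRep γ f (ρ.disintegrateGroup γ⁻¹ ξ)).trans ?_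
    refine congrArg (ρ.innerRep.integrated Measure.count (twistCc γ f)) ?_
    change (ρ.disintegrateGroup γ * ρ.disintegrateGroup γ⁻¹) ξ = ξ
    rw [← map_mul, mul_inv_cancel, map_one]
    rfl

theorem CovRep.swapRep_integrated_eq (ρ : CovRep p (dualTensor μ α p))
    (F : C_c(PontryaginDual G × G, A)) (ξ : ρ.E) :
    ρ.swapRep.integrated μ (curryCc p Measure.count α F) ξ =
      ∫ γ, ∫ s, ρ.disintegrateAlg (F (γ, s)) (ρ.v s (ρ.disintegrateGroup γ ξ))
        ∂(Measure.count : Measure G) ∂μ := by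
  refine integral_congr_ae (Filter.Eventually.of_forall fun γ => ?_)
  exact DFunLike.congr_fun (ρ.innerRep.integratedHom_of (μ := Measure.count) (slice F γ))
    (ρ.disintegrateGroup γ ξ)

/-- The factor γ(s) in the twisted function is exactly what turns w_γ v_s into v_s w_γ, the order in
which the other integrated form composes them. -/
theorem CovRep.integrated_swapTwistCc (ρ : CovRep p (dualTensor μ α p))
    (F : C_c(PontryaginDual G × G, A)) (ξ : ρ.E) :
    ρ.integrated Measure.count
        (curryCc p μ (trivialAction (PontryaginDual G) A) (swapTwistCc F)) ξ =
      ∫ s, ∫ γ, ρ.disintegrateAlg (F (γ, s)) (ρ.v s (ρ.disintegrateGroup γ ξ))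
        ∂μ ∂(Measure.count : Measure G) := by
  refine integral_congr_ae (Filter.Eventually.of_forall fun s => ?_)
  refine (DFunLike.congr_fun (ρ.integrated_disintegrate _) (ρ.v s ξ)).symm.trans ?_
  refine integral_congr_ae (Filter.Eventually.of_forall fun γ => ?_)
  have h1 : ρ.disintegrateAlg ((γ s : ℂ) • F (γ, s)) = (γ s : ℂ) • ρ.disintegrateAlg (F (γ, s)) :=
    map_smul ρ.disintegrateAlg _ _
  have h2 := congrArg (ρ.disintegrateAlg (F (γ, s))) (ρ.v_disintegrateGroup s γ ξ)
  rw [ContinuousLinearMap.map_smul] at h2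
  exact (DFunLike.congr_fun h1 _).trans h2.symm

/-- Both sides are iterated integrals, in opposite orders, of one continuous compactly supported
function on Ĝ × G. -/
theorem CovRep.swapRep_integrated (ρ : CovRep p (dualTensor μ α p))
    (F : C_c(PontryaginDual G × G, A)) (ξ : ρ.E) :
    ρ.swapRep.integrated μ (curryCc p Measure.count α F) ξ =
      ρ.integrated Measure.count
        (curryCc p μ (trivialAction (PontryaginDual G) A) (swapTwistCc F)) ξ := by
  refine (ρ.swapRep_integrated_eq F ξ).trans (Eq.trans ?_ (ρ.integrated_swapTwistCc F ξ).symm)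
  have hF : Continuous fun q : PontryaginDual G × G => ρ.disintegrateAlg (F q) :=
    ρ.disintegrate.continuous_π.comp (map_continuous F)
  have hw : Continuous fun q : PontryaginDual G × G => ρ.disintegrateGroup q.1 ξ :=
    (ρ.disintegrate.continuous_v ξ).comp continuous_fst
  have hc : Continuous fun q : PontryaginDual G × G =>
      ρ.disintegrateAlg (F q) (ρ.v q.2 (ρ.disintegrateGroup q.1 ξ)) :=
    hF.clm_apply (ρ.continuous_v_uncurry.comp (continuous_snd.prodMk hw))
  have hs : HasCompactSupport fun q : PontryaginDual G × G =>
      ρ.disintegrateAlg (F q) (ρ.v q.2 (ρ.disintegrateGroup q.1 ξ)) := by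
    refine F.hasCompactSupport.mono fun q hq h0 => hq ?_
    have h1 : ρ.disintegrateAlg (F q) = 0 := (congrArg _ h0).trans (map_zero ρ.disintegrateAlg)
    exact DFunLike.congr_fun h1 _
  exact integral_integral_swap_of_hasCompactSupport (E := ρ.E)
    (f := fun γ s => ρ.disintegrateAlg (F (γ, s)) (ρ.v s (ρ.disintegrateGroup γ ξ))) hc hs

-- Each representation ρ of the target pulls back to `ρ.swapRep` on the same space, and the two
-- integrated forms agree on functions of two variables, which are dense in the source.
variable (p μ α) in
theorem exists_isPhi₁ : ∃ Φ : Crossed p μ (dualAction p (Measure.count : Measure G) α) →ₙₐ[ℂ]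
    Crossed p (Measure.count : Measure G) (dualTensor μ α p), IsPhi₁ Φ := by
  have key : ∀ (F : C_c(PontryaginDual G × G, A)) (ρ : CovRep p (dualTensor μ α p)),
      (ρ.swapRep.integratedHom μ (Crossed.of p μ _ (curryCc p Measure.count α F)) :
        ρ.E →L[ℂ] ρ.E) = ρ.integratedHom Measure.count (Crossed.of p Measure.count _
        (curryCc p μ (trivialAction (PontryaginDual G) A) (swapTwistCc F))) := by
    intro F ρ
    rw [ρ.integratedHom_of]
    refine (ρ.swapRep.integratedHom_of _).trans ?_
    exact ContinuousLinearMap.ext fun ξ => ρ.swapRep_integrated F ξ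
  obtain ⟨Φ, hΦ, h⟩ := exists_hom_of_compatible
    (D₁ := Crossed p μ (dualAction p (Measure.count : Measure G) α))
    (D₂ := Crossed p (Measure.count : Measure G) (dualTensor μ α p))
    (R := fun ρ : CovRep p (dualTensor μ α p) => ρ.E →L[ℂ] ρ.E)
    (fun ρ => ρ.swapRep.integratedHom μ) (fun ρ => ρ.integratedHom Measure.count)
    (fun ρ => ρ.swapRep.norm_integratedHom_le) (fun ρ => ρ.norm_integratedHom_le)
    Crossed.norm_le_of_forall_covRep (Crossed.denseRange_of_curryCc μ _) (by
      rintro _ ⟨F, rfl⟩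
      exact ⟨_, key F⟩)
  refine ⟨Φ, hΦ, fun F => ⟨swapTwistCc F, fun s γ => rfl, Crossed.ext_covRep fun ρ => ?_⟩⟩
  exact (h _ ρ).trans (key F ρ)

/-- The formula fixes the values of the image function, hence the function itself; continuity and
density of two-variable functions then determine the map. -/
theorem IsPhi₁.eq {Φ Φ' : Crossed p μ (dualAction p (Measure.count : Measure G) α) →ₙₐ[ℂ]
    Crossed p (Measure.count : Measure G) (dualTensor μ α p)} (h : IsPhi₁ Φ) (h' : IsPhi₁ Φ') :
    Φ = Φ' := by
  refine DFunLike.coe_injective ((Crossed.denseRange_of_curryCc μ _).equalizer h.continuous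
    h'.continuous (funext fun F => ?_))
  obtain ⟨F₁, hF₁, h₁⟩ := h.formula F
  obtain ⟨F₂, hF₂, h₂⟩ := h'.formula F
  have : F₁ = F₂ := by
    ext ⟨s, γ⟩
    rw [hF₁, hF₂]
  simp only [Function.comp]
  rw [h₁, h₂, this]

/-! ### The homomorphism `Φ₂` -/

/-- The covariant representation of `(Ĝ, A)` underlying a representation of `C_0(G, A)`. -/
def CovRep.charRep (ρ : CovRep p (ltTensor α)) :
    CovRep p (trivialAction (PontryaginDual G) A) :=
  (c0MultiplierSystem G A).covRep (c0_hasContractiveLeftApproxUnit G A) ρ.toNondegenerateRep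

theorem CovRep.integrated_charRep (ρ : CovRep p (ltTensor α)) (f : C_c(PontryaginDual G, A)) :
    (ρ.charRep.integratedHom μ (Crossed.of p μ _ f) : ρ.E →L[ℂ] ρ.E) = ρ.π (fourierC0 μ f) := by
  refine (ρ.charRep.integratedHom_of f).trans ?_
  exact MultiplierSystem.integrated_covRep _ _ _ _ _ fun g => integral_c0MultiplierSystem μ f g

/-- Because γ(s) conj(γ(t)) = conj(γ(s⁻¹t)), multiplication by evaluation at s becomes translation
by s; the automorphism α_s passes through the integral. -/
theorem fourierC0_dualTensor (s : G) (f : C_c(PontryaginDual G, A)) :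
    fourierC0 μ ((actEquivariant α s).compCc (twistCc (evalChar s⁻¹) f)) =
      (ltTensor α).act s (fourierC0 μ f) := by
  ext t
  rw [ltTensor_apply, fourierC0_apply, fourierC0_apply]
  refine Eq.trans ?_ ((α.clm s).integral_comp_comm (integrable_coeff μ f (s⁻¹ * t)))
  congr 1
  ext1 γ
  rw [dualTensor_formula]
  change _ = α.act s (starRingEnd ℂ (γ (s⁻¹ * t) : ℂ) • f γ)
  rw [map_smul, smul_smul]
  congr 1
  rw [map_mul, map_inv, Circle.coe_mul, Circle.coe_inv_eq_conj, map_mul, Complex.conj_conj,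
    mul_comm]

variable (μ) in
/-- The covariant representation of `(G, F^p(Ĝ, A, β), β̂ ⊗ α)` induced by one of
`(G, C_0(G, A), lt ⊗ α)`. -/
def CovRep.fourierRep (ρ : CovRep p (ltTensor α)) : CovRep p (dualTensor μ α p) where
  X := ρ.X
  ν := ρ.ν
  π := ρ.charRep.integratedHom μ
  v := ρ.v
  norm_π_le := ρ.charRep.norm_integratedHom_le
  nondegenerate := (ρ.charRep.integratedRep μ).nondegenerate
  norm_v := ρ.norm_v
  continuous_v := ρ.continuous_v
  covariant s x := by
    refine ρ.charRep.mul_integratedHom_mul (ρ.v s) (ρ.v s⁻¹) (continuous_dualTensorMap μ α s)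
      (fun f => ?_) x
    -- Covariance for lt ⊗ α at the Fourier transform of f, read through the intertwining identity,
    -- is covariance for β̂ ⊗ α at f.
    have h1 := ρ.covariant s (fourierC0 μ f)
    rw [← fourierC0_dualTensor, ← ρ.integrated_charRep, ← ρ.integrated_charRep,
      ← dualTensorMap_of] at h1
    exact (congrArg (fun T => ρ.v s * T * ρ.v s⁻¹) (ρ.charRep.integratedHom_of f)).symm.trans h1

variable (μ) in
/-- The partial Fourier transform of a function of two variables. -/
def partialFourier (F : C_c(G × PontryaginDual G, A)) : C_c(G, C₀(G, A)) where
  toFun s := fourierC0 μ (slice F s)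
  continuous_toFun := continuous_of_discreteTopology
  hasCompactSupport' := by
    refine HasCompactSupport.intro (F.hasCompactSupport.isCompact.image continuous_fst)
      fun s hs => ?_
    ext t
    rw [fourierC0_apply]
    have : ∀ γ, slice F s γ = 0 := fun γ =>
      image_eq_zero_of_notMem_tsupport (x := (s, γ)) fun h => hs ⟨(s, γ), h, rfl⟩
    simp [this]

theorem CovRep.integrated_fourierRep (ρ : CovRep p (ltTensor α))
    (F : C_c(G × PontryaginDual G, A)) (ξ : ρ.E) :
    (ρ.fourierRep μ).integrated Measure.count
        (curryCc p μ (trivialAction (PontryaginDual G) A) F) ξ =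
      ρ.integrated Measure.count (partialFourier μ F) ξ := by
  change ∫ s, (ρ.charRep.integratedHom μ (Crossed.of p μ _ (slice F s)) : ρ.E →L[ℂ] ρ.E)
    (ρ.v s ξ) ∂_ = ∫ s, ρ.π (fourierC0 μ (slice F s)) (ρ.v s ξ) ∂_
  simp only [ρ.integrated_charRep]
  rfl

variable [Countable G]

-- The same principle as for Φ₁, with `ρ.fourierRep` as pullback and the partial Fourier transform
-- supplying the matching element of the target.
variable (p μ α) in
theorem exists_isPhi₂ : ∃ Φ : Crossed p (Measure.count : Measure G) (dualTensor μ α p) →ₙₐ[ℂ]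
    Crossed p (Measure.count : Measure G) (ltTensor α), IsPhi₂ Φ := by
  have key : ∀ (F : C_c(G × PontryaginDual G, A)) (ρ : CovRep p (ltTensor α)),
      ((ρ.fourierRep μ).integratedHom Measure.count (Crossed.of p Measure.count _
        (curryCc p μ (trivialAction (PontryaginDual G) A) F)) : ρ.E →L[ℂ] ρ.E) =
      ρ.integratedHom Measure.count (Crossed.of p Measure.count _ (partialFourier μ F)) := by
    intro F ρ
    rw [ρ.integratedHom_of]
    refine ((ρ.fourierRep μ).integratedHom_of _).trans ?_
    exact ContinuousLinearMap.ext fun ξ => ρ.integrated_fourierRep F ξ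
  obtain ⟨Φ, hΦ, h⟩ := exists_hom_of_compatible
    (D₁ := Crossed p (Measure.count : Measure G) (dualTensor μ α p))
    (D₂ := Crossed p (Measure.count : Measure G) (ltTensor α))
    (R := fun ρ : CovRep p (ltTensor α) => ρ.E →L[ℂ] ρ.E)
    (fun ρ => (ρ.fourierRep μ).integratedHom Measure.count)
    (fun ρ => ρ.integratedHom Measure.count)
    (fun ρ => (ρ.fourierRep μ).norm_integratedHom_le) (fun ρ => ρ.norm_integratedHom_le)
    Crossed.norm_le_of_forall_covRep (Crossed.denseRange_of_curryCc Measure.count _) (by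
      rintro _ ⟨F, rfl⟩
      exact ⟨_, key F⟩)
  refine ⟨Φ, hΦ, fun F => ⟨partialFourier μ F, fun s γ => rfl, Crossed.ext_covRep fun ρ => ?_⟩⟩
  exact (h _ ρ).trans (key F ρ)

theorem IsPhi₂.eq {Φ Φ' : Crossed p (Measure.count : Measure G) (dualTensor μ α p) →ₙₐ[ℂ]
    Crossed p (Measure.count : Measure G) (ltTensor α)} (h : IsPhi₂ Φ) (h' : IsPhi₂ Φ') :
    Φ = Φ' := by
  refine DFunLike.coe_injective ((Crossed.denseRange_of_curryCc Measure.count _).equalizer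
    h.continuous h'.continuous (funext fun F => ?_))
  obtain ⟨F₁, hF₁, h₁⟩ := h.formula F
  obtain ⟨F₂, hF₂, h₂⟩ := h'.formula F
  have : F₁ = F₂ := by
    ext s t
    rw [hF₁, hF₂]
  simp only [Function.comp]
  rw [h₁, h₂, this]

end Phi

/-! ### The homomorphism `Φ₃` -/

section Untwist

variable {G A : Type u} [CommGroup G] [TopologicalSpace G] [IsTopologicalGroup G]
  [DiscreteTopology G] [NormedRing A] [NormedAlgebra ℂ A] [CompleteSpace A]

/-- The endomorphism `f ↦ (t ↦ α_{σ(t)}(f t))` of `C_0(G, A)`. -/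
def c0Fiber (α : IsometricAction G A) (σ : G → G) : C₀(G, A) →ₙₐ[ℂ] C₀(G, A) where
  toFun f :=
    { toFun := fun t => α.act (σ t) (f t)
      continuous_toFun := continuous_of_discreteTopology
      zero_at_infty' := by
        refine squeeze_zero_norm (a := fun t => ‖f t‖) (fun t => (α.norm_act _ _).le) ?_
        simpa using f.zero_at_infty'.norm }
  map_smul' c f := by ext t; exact map_smul (α.act (σ t)) c (f t)
  map_zero' := by ext t; exact map_zero (α.act (σ t))
  map_add' f g := by ext t; exact map_add (α.act (σ t)) (f t) (g t)
  map_mul' f g := by ext t; exact map_mul (α.act (σ t)) (f t) (g t)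

/-- The equivariant isomorphism `f ↦ (t ↦ α_t⁻¹(f t))` from `lt ⊗ α` to `lt ⊗ id`. -/
def untwistEquivariant (α : IsometricAction G A) :
    EquivariantHom (ltTensor α) (ltTensor (trivialAction G A)) where
  hom := c0Fiber α fun t => t⁻¹
  norm_hom_le f := c0_norm_le (norm_nonneg _) fun t =>
    (α.norm_act _ _).trans_le (c0_norm_apply_le f t)
  denseRange_hom := Function.Surjective.denseRange fun f =>
    ⟨c0Fiber α (fun t => t) f, by ext t; exact α.act_inv_act t (f t)⟩
  equivariant s f := by
    ext t
    -- Since t⁻¹s = (s⁻¹t)⁻¹, the twist by α_s is absorbed into the shift of base point, leaving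
    -- pure translation.
    change α.act t⁻¹ (α.act s (f (s⁻¹ * t))) = α.act (s⁻¹ * t)⁻¹ (f (s⁻¹ * t))
    rw [← α.act_mul, mul_inv_rev, inv_inv]

variable [MeasurableSpace G] [BorelSpace G] {p : ℝ≥0∞} [Fact (1 ≤ p)]

variable (p) in
theorem isPhi₃_map (α : IsometricAction G A) :
    IsPhi₃ (Crossed.map p (Measure.count : Measure G) (untwistEquivariant α)) where
  continuous := Crossed.continuous_map _
  formula F := ⟨(untwistEquivariant α).compCc F, fun _ _ => rfl, Crossed.map_of _ F⟩

theorem IsPhi₃.eq {α : IsometricAction G A}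
    {Φ Φ' : Crossed p (Measure.count : Measure G) (ltTensor α) →ₙₐ[ℂ]
      Crossed p (Measure.count : Measure G) (ltTensor (trivialAction G A))}
    (h : IsPhi₃ Φ) (h' : IsPhi₃ Φ') : Φ = Φ' := by
  refine DFunLike.coe_injective (Crossed.denseRange_of.equalizer
    h.continuous h'.continuous (funext fun F => ?_))
  obtain ⟨F₁, hF₁, h₁⟩ := h.formula F
  obtain ⟨F₂, hF₂, h₂⟩ := h'.formula F
  have : F₁ = F₂ := by
    ext s t
    rw [hF₁, hF₂]
  simp only [Function.comp]
  rw [h₁, h₂, this]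

end Untwist

/-! ### Equivariance -/

section Equivariance

variable {G A : Type u} [CommGroup G] [TopologicalSpace G] [IsTopologicalGroup G]
  [DiscreteTopology G] [NormedRing A] [NormedAlgebra ℂ A] [CompleteSpace A] [NormOneClass A]
  [MeasurableSpace G] [BorelSpace G]
  [MeasurableSpace (PontryaginDual G)] [BorelSpace (PontryaginDual G)]
  {p : ℝ≥0∞} [Fact (1 ≤ p)] {μ : Measure (PontryaginDual G)} [IsProbabilityMeasure μ]
  [μ.IsMulLeftInvariant] {α : IsometricAction G A}

/-- The function `(γ, s) ↦ conj (γ(r)) F(γ, s)`. -/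
def twistFstCc (r : G) (F : C_c(PontryaginDual G × G, A)) : C_c(PontryaginDual G × G, A) where
  toFun q := starRingEnd ℂ (q.1 r : ℂ) • F q
  continuous_toFun :=
    (Complex.continuous_conj.comp ((continuous_dual_apply r).comp continuous_fst)).smul
      (map_continuous F)
  hasCompactSupport' := F.hasCompactSupport.mono fun q hq h0 => hq (by simp only [h0, smul_zero])

theorem twistCc_evalChar_curryCc (r : G) (F : C_c(PontryaginDual G × G, A)) :
    twistCc (evalChar r) (curryCc p (Measure.count : Measure G) α F) =
      curryCc p Measure.count α (twistFstCc r F) := by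
  ext γ
  rw [twistCc_apply, curryCc_apply, curryCc_apply, ← map_smul]
  rfl

/-- Both sides are continuous in x, so two-variable functions suffice. There the double dual action
multiplies F by conj(γ(r)), and the explicit formula for the composite can be compared directly. -/
theorem IsPhi₁.comp_equivariant
    {Φ₁ : Crossed p μ (dualAction p (Measure.count : Measure G) α) →ₙₐ[ℂ]
        Crossed p (Measure.count : Measure G) (dualTensor μ α p)}
    {Φ₂ : Crossed p (Measure.count : Measure G) (dualTensor μ α p) →ₙₐ[ℂ]
        Crossed p (Measure.count : Measure G) (ltTensor α)}
    {Φ₃ : Crossed p (Measure.count : Measure G) (ltTensor α) →ₙₐ[ℂ]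
        Crossed p (Measure.count : Measure G) (ltTensor (trivialAction G A))}
    (h₁ : IsPhi₁ Φ₁) (h₂ : IsPhi₂ Φ₂) (h₃ : IsPhi₃ Φ₃) (r : G)
    (x : Crossed p μ (dualAction p (Measure.count : Measure G) α)) :
    (Φ₃.comp (Φ₂.comp Φ₁)) ((doubleDualAction μ α p).act r x) =
      (rtTensorId α p).act r ((Φ₃.comp (Φ₂.comp Φ₁)) x) := by
  have hcomp : ∀ F : C_c(PontryaginDual G × G, A), ∃ F' : C_c(G, C₀(G, A)),
      (∀ s t, F' s t = α.act t⁻¹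
        (∫ γ, starRingEnd ℂ (γ t : ℂ) • (γ s : ℂ) • F (γ, s) ∂μ)) ∧
      (Φ₃.comp (Φ₂.comp Φ₁)) (Crossed.of p μ _ (curryCc p Measure.count α F)) =
        Crossed.of p Measure.count _ F' := by
    intro F
    obtain ⟨F₁, hF₁, e₁⟩ := h₁.formula F
    obtain ⟨F₂, hF₂, e₂⟩ := h₂.formula F₁
    obtain ⟨F₃, hF₃, e₃⟩ := h₃.formula F₂
    refine ⟨F₃, fun s t => ?_, ?_⟩
    · rw [hF₃, hF₂]
      simp only [hF₁]
    · change Φ₃ (Φ₂ (Φ₁ _)) = _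
      rw [e₁, e₂, e₃]
  have hcont : Continuous (Φ₃.comp (Φ₂.comp Φ₁)) :=
    h₃.continuous.comp (h₂.continuous.comp h₁.continuous)
  refine (Crossed.denseRange_of_curryCc μ _).induction_on x (isClosed_eq
    (hcont.comp (Crossed.continuous_twist _)) ((Crossed.continuous_map _).comp hcont)) fun F => ?_
  obtain ⟨F', hF', e⟩ := hcomp F
  obtain ⟨F'', hF'', e'⟩ := hcomp (twistFstCc r F)
  rw [doubleDualAction_of, twistCc_evalChar_curryCc, e, e']
  refine Eq.trans ?_ (Crossed.map_of (rtEquivariant α r) F').symm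
  congr 1
  ext s t
  -- The outer automorphisms agree because r (t r)⁻¹ = t⁻¹, leaving an identity of integrands.
  rw [hF'', rtTensorId_formula, hF', ← α.act_mul, mul_inv_rev, mul_inv_cancel_left]
  congr 2
  ext1 γ
  -- The extra conj(γ(r)) combines with conj(γ(t)) into conj(γ(t r)).
  change starRingEnd ℂ (γ t : ℂ) • (γ s : ℂ) • starRingEnd ℂ (γ r : ℂ) • F (γ, s) = _
  rw [map_mul, Circle.coe_mul, map_mul, smul_smul, smul_smul, smul_smul]
  congr 1
  ring

end Equivariance

end LpCrossed

end

/-! ### Existence, uniqueness and equivariance of the three homomorphisms -/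

theorem lemma3p8 {G A : Type u} [CommGroup G] [TopologicalSpace G] [IsTopologicalGroup G]
    [DiscreteTopology G] [Countable G] [MeasurableSpace G] [BorelSpace G]
    [MeasurableSpace (PontryaginDual G)] [BorelSpace (PontryaginDual G)]
    (μ : Measure (PontryaginDual G)) [μ.IsHaarMeasure] [IsProbabilityMeasure μ]
    [NormedRing A] [NormOneClass A] [NormedAlgebra ℂ A] [CompleteSpace A]
    [TopologicalSpace.SeparableSpace A]
    (p : ℝ≥0∞) [Fact (1 ≤ p)] (hp : p ≠ ∞)
    (hA : IsLpOperatorAlgebra p A) (hU : HasUniqueLpMatrixNorms p A)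
    (α : IsometricAction G A) :
    (∃! Φ₁ : Crossed p μ (dualAction p (Measure.count : Measure G) α) →ₙₐ[ℂ]
        Crossed p (Measure.count : Measure G) (dualTensor μ α p),
      IsPhi₁ Φ₁) ∧
    (∃! Φ₂ : Crossed p (Measure.count : Measure G) (dualTensor μ α p) →ₙₐ[ℂ]
        Crossed p (Measure.count : Measure G) (ltTensor α),
      IsPhi₂ Φ₂) ∧
    (∃! Φ₃ : Crossed p (Measure.count : Measure G) (ltTensor α) →ₙₐ[ℂ]
        Crossed p (Measure.count : Measure G)
          (ltTensor (trivialAction G A)),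
      IsPhi₃ Φ₃) ∧
    ∀ (Φ₁ : Crossed p μ (dualAction p (Measure.count : Measure G) α) →ₙₐ[ℂ]
        Crossed p (Measure.count : Measure G) (dualTensor μ α p))
      (Φ₂ : Crossed p (Measure.count : Measure G) (dualTensor μ α p) →ₙₐ[ℂ]
        Crossed p (Measure.count : Measure G) (ltTensor α))
      (Φ₃ : Crossed p (Measure.count : Measure G) (ltTensor α) →ₙₐ[ℂ]
        Crossed p (Measure.count : Measure G)
          (ltTensor (trivialAction G A))),
      IsPhi₁ Φ₁ → IsPhi₂ Φ₂ → IsPhi₃ Φ₃ →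
      ∀ (r : G) (x : Crossed p μ
          (dualAction p (Measure.count : Measure G) α)),
        (Φ₃.comp (Φ₂.comp Φ₁)) ((doubleDualAction μ α p).act r x) =
          (rtTensorId α p).act r ((Φ₃.comp (Φ₂.comp Φ₁)) x) := by
  have hΦ₁ := exists_isPhi₁ p μ α
  have hΦ₂ := exists_isPhi₂ p μ α
  obtain ⟨Φ₁, h₁⟩ := hΦ₁
  obtain ⟨Φ₂, h₂⟩ := hΦ₂
  exact ⟨⟨Φ₁, h₁, fun _ h => h.eq h₁⟩, ⟨Φ₂, h₂, fun _ h => h.eq h₂⟩,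
    ⟨_, isPhi₃_map p α, fun _ h => h.eq (isPhi₃_map p α)⟩,
    fun _ _ _ k₁ k₂ k₃ r x => k₁.comp_equivariant k₂ k₃ r x⟩
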